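/- Let $M$ be a connected smooth manifold (Hausdorff, second countable, finite-dimensional, without boundary) and let $R=C^\infty(M)$. An octonion algebra over $R$ is a unital, not necessarily associative $R$-algebra $C$, finitely generated projective of rank $8$ as a module, with a quadratic form $q$ such that $q(xy)=q(x)q(y)$ and such that $b(x,y)=q(x+y)-q(x)-q(y)$ induces an isomorphism $C\to C^\vee$. The morphisms of the category $\mathrm{octalg}_R$ are the $R$-linear isomorphisms carrying multiplication, identity and bilinear form of the source to those of the target. For $p\in M$ with vanishing ideal $I_p\subset R$, the fibre $C/I_pC$ is a real octonion algebra; $C$ is called globally non-split (globally split) if for every $p$ this fibre has no zero divisors (has zero divisors). On $\mathbb R^7$ with dual basis $e^1,\dots,e^7$ put $$\varphi_0=e^{123}+e^{145}+e^{167}+e^{246}-e^{257}-e^{347}-e^{356},\qquad \sigma_0=e^{123}-e^{145}-e^{167}-e^{246}+e^{257}+e^{347}+e^{356},$$ and let $G_2\subset GL_7(\mathbb R)$ be the stabilizer of $\varphi_0$. * $\mathrm{fG2str}(M)$ is the category whose objects are the pairs $(E,P)$ of a smooth real vector bundle $E$ of rank $7$ over $M$ and a $G_2$-reduction $P$ of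 its frame bundle; morphisms $(E,P)\to(E',P')$ are the isomorphisms $f:E\to E'$ of smooth vector bundles over $M$ with $P'=fP$. * $\mathrm{fG2^*str}(M)$ is the category whose objects are the pairs $(E,\sigma)$ of a smooth real vector bundle $E$ of rank $7$ over $M$ and a $3$-form $\sigma$, i.e. an alternating $R$-trilinear form on $\Gamma(E)$, which at every point of $M$ is carried to $\sigma_0$ by some frame of $E$; morphisms $(E,\sigma)\to(E',\sigma')$ are the $R$-linear isomorphisms $f:\Gamma(E)\to\Gamma(E')$ with $\sigma'=f_*\sigma$. Theorem. There is an equivalence of categories $$\Phi:\ \mathrm{octalg}_{C^\infty(M)}\ \overset{\sim}{\longrightarrow}\ \mathrm{fG2str}(M)\sqcup\mathrm{fG2^*str}(M)$$ together with isomorphisms $\theta_C:\Gamma(E_{\Phi(C)})\cong 1^\perp\subset C$, natural in $C$ with respect to the restriction of morphisms to $1^\perp$, such that for every $C$: 1. under $\theta_C$ the $3$-form $\varphi_C(x,y,z)=\tfrac12 b(xy,z)$ on $1^\perp$ is the $3$-form of $\Phi(C)$: if $\Phi(C)=(E,P)$ lies in the first category, every frame in $P$ pulls $\varphi_C$ back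 to $\varphi_0$; if $\Phi(C)=(E,\sigma)$ lies in the second, $\varphi_C$ is $\sigma$; 2. either $\Phi(C)$ lies in $\mathrm{fG2str}(M)$ and $C$ is globally non-split, or $\Phi(C)$ lies in $\mathrm{fG2^*str}(M)$ and $C$ is globally split. -/

import Mathlib

open CategoryTheory Bundle Manifold
open scoped ContDiff Topology

universe u

noncomputable section

namespace OctG2

/-! ## Octonion algebras over a commutative ring -/

/-- An octonion algebra over `R`: a unital, not necessarily associative, `R`-algebra that is finitely
generated projective of rank `8` as a module, with a multiplicative quadratic form `norm` whose polar
form `b(x, y) = q(x + y) - q(x) - q(y)` identifies the module with its dual. -/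
structure OctonionAlgebra (R : Type u) [CommRing R] where
  carrier : Type u
  [nonAssocRing : NonAssocRing carrier]
  [module : Module R carrier]
  [isScalarTower : IsScalarTower R carrier carrier]
  [smulCommClass : SMulCommClass R carrier carrier]
  [finite : Module.Finite R carrier]
  [projective : Module.Projective R carrier]
  rank_eq : ∀ 𝔭 : PrimeSpectrum R, Module.rankAtStalk carrier 𝔭 = 8
  norm : QuadraticForm R carrier
  nondegenerate : Function.Bijective norm.polarBilin
  norm_mul : ∀ x y : carrier, norm (x * y) = norm x * norm y

namespace OctonionAlgebra

variable {R : Type u} [CommRing R]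

attribute [instance] nonAssocRing module isScalarTower smulCommClass finite projective

/-- The symmetric bilinear form of an octonion algebra. -/
def bilin (C : OctonionAlgebra R) : C.carrier →ₗ[R] C.carrier →ₗ[R] R :=
  C.norm.polarBilin

/-- A morphism of octonion algebras: a linear isomorphism carrying the multiplication, the identity
and the bilinear form of `C` to those of `C'`. -/
@[ext]
structure Hom (C C' : OctonionAlgebra R) where
  toEquiv : C.carrier ≃ₗ[R] C'.carrier
  map_mul : ∀ x y, toEquiv (x * y) = toEquiv x * toEquiv y
  map_one : toEquiv 1 = 1
  map_bilin : ∀ x y, C'.bilin (toEquiv x) (toEquiv y) = C.bilin x y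

instance : Category (OctonionAlgebra R) where
  Hom := Hom
  id C :=
    { toEquiv := LinearEquiv.refl R C.carrier
      map_mul := fun _ _ => rfl
      map_one := rfl
      map_bilin := fun _ _ => rfl }
  comp f g :=
    { toEquiv := f.toEquiv.trans g.toEquiv
      map_mul := fun x y => by simp [f.map_mul, g.map_mul]
      map_one := by simp [f.map_one, g.map_one]
      map_bilin := fun x y => by simp [f.map_bilin, g.map_bilin] }

/-- The orthogonal complement of the identity element. -/
def imag (C : OctonionAlgebra R) : Submodule R C.carrier :=
  LinearMap.ker (C.bilin 1)

/-- The functor sending an octonion algebra to the orthogonal complement of its identity element and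
a morphism to its restriction. -/
def imagFunctor : OctonionAlgebra R ⥤ ModuleCat.{u} R where
  obj C := ModuleCat.of R C.imag
  map {C C'} f := ModuleCat.ofHom
    (f.toEquiv.toLinearMap.restrict (p := C.imag) (q := C'.imag) fun x hx => by
      have h := f.map_bilin 1 x
      rw [f.map_one] at h
      exact h.trans hx)
  map_id _ := rfl
  map_comp _ _ := rfl

end OctonionAlgebra

/-! ## The model three-forms on `ℝ⁷` -/

/-- The standard fibre `ℝ⁷`. -/
abbrev V7 : Type := Fin 7 → ℝ

/-- The form `eⁱ ∧ eʲ ∧ eᵏ` on `ℝ⁷`, where `e⁰, …, e⁶` is the dual of the standard basis: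
`(x₀, x₁, x₂) ↦ det (e^{a}(x_b))` with `a` running through `i, j, k`. -/
def e3 (i j k : Fin 7) : V7 [⋀^Fin 3]→ₗ[ℝ] ℝ :=
  (Matrix.detRowAlternating : (Fin 3 → ℝ) [⋀^Fin 3]→ₗ[ℝ] ℝ).compLinearMap
    (LinearMap.funLeft ℝ ℝ ![i, j, k])

/-- `φ₀ = e¹²³ + e¹⁴⁵ + e¹⁶⁷ + e²⁴⁶ - e²⁵⁷ - e³⁴⁷ - e³⁵⁶` (coordinates are numbered from `0` below). -/
def phi0 : V7 [⋀^Fin 3]→ₗ[ℝ] ℝ :=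
  e3 0 1 2 + e3 0 3 4 + e3 0 5 6 + e3 1 3 5 - e3 1 4 6 - e3 2 3 6 - e3 2 4 5

/-- `σ₀ = e¹²³ - e¹⁴⁵ - e¹⁶⁷ - e²⁴⁶ + e²⁵⁷ + e³⁴⁷ + e³⁵⁶` (coordinates are numbered from `0` below). -/
def sigma0 : V7 [⋀^Fin 3]→ₗ[ℝ] ℝ :=
  e3 0 1 2 - e3 0 3 4 - e3 0 5 6 - e3 1 3 5 + e3 1 4 6 + e3 2 3 6 + e3 2 4 5

/-- The compact group `G₂`: the stabilizer of `φ₀` in `GL₇(ℝ)`. -/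
def G2 : Set (V7 ≃ₗ[ℝ] V7) :=
  {g | phi0.compLinearMap g.toLinearMap = phi0}

/-! ## Smooth vector bundles of rank seven -/

section Bundles

variable (n : ℕ) (M : Type u) [TopologicalSpace M] [ChartedSpace (EuclideanSpace ℝ (Fin n)) M]

/-- The ring `C^∞(M)`. -/
abbrev SmoothRing : Type u := C^∞⟮𝓡 n, M; ℝ⟯

/-- A smooth real vector bundle of rank `7` over `M`. -/
structure RankSevenBundle where
  fib : M → Type u
  [addCommGroup : ∀ p, AddCommGroup (fib p)]
  [module : ∀ p, Module ℝ (fib p)]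
  [fibTopology : ∀ p, TopologicalSpace (fib p)]
  [totalTopology : TopologicalSpace (TotalSpace V7 fib)]
  [fiberBundle : FiberBundle V7 fib]
  [vectorBundle : VectorBundle ℝ V7 fib]
  [smoothBundle : ContMDiffVectorBundle ∞ V7 fib (𝓡 n)]

attribute [instance] RankSevenBundle.addCommGroup RankSevenBundle.module
  RankSevenBundle.fibTopology RankSevenBundle.totalTopology RankSevenBundle.fiberBundle
  RankSevenBundle.vectorBundle RankSevenBundle.smoothBundle

variable {n M}

namespace RankSevenBundle

/-- The smooth global sections of `E`. -/
abbrev Sections (E : RankSevenBundle n M) : Type u := Cₛ^∞⟮𝓡 n; V7, E.fib⟯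

variable {E E' E'' : RankSevenBundle n M}

instance : SMul (SmoothRing n M) E.Sections where
  smul f s := ⟨fun p => f p • s p, f.contMDiff.smul_section s.contMDiff⟩

theorem smul_apply (f : SmoothRing n M) (s : E.Sections) (p : M) : (f • s) p = f p • s p := rfl

instance : Module (SmoothRing n M) E.Sections where
  one_smul s := by ext p; exact one_smul ℝ (s p)
  mul_smul f g s := by ext p; exact mul_smul (f p) (g p) (s p)
  smul_zero f := by ext p; exact smul_zero (f p)
  smul_add f s t := by ext p; exact smul_add (f p) (s p) (t p)
  add_smul f g s := by ext p; exact add_smul (f p) (g p) (s p)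
  zero_smul s := by ext p; exact zero_smul ℝ (s p)

/-- The map of total spaces induced by a family of linear maps of the fibres. -/
def totalMap (f : ∀ p, E.fib p ≃ₗ[ℝ] E'.fib p) (v : TotalSpace V7 E.fib) :
    TotalSpace V7 E'.fib :=
  ⟨v.1, f v.1 v.2⟩

/-- An isomorphism of smooth vector bundles over the identity of `M`. -/
@[ext]
structure Iso (E E' : RankSevenBundle n M) where
  toEquiv : ∀ p, E.fib p ≃ₗ[ℝ] E'.fib p
  smooth : ContMDiff ((𝓡 n).prod 𝓘(ℝ, V7)) ((𝓡 n).prod 𝓘(ℝ, V7)) ∞ (totalMap toEquiv)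
  smooth_symm : ContMDiff ((𝓡 n).prod 𝓘(ℝ, V7)) ((𝓡 n).prod 𝓘(ℝ, V7)) ∞
    (totalMap fun p => (toEquiv p).symm)

/-- The identity of a bundle. -/
def Iso.refl (E : RankSevenBundle n M) : Iso E E where
  toEquiv _ := LinearEquiv.refl ℝ _
  smooth := contMDiff_id
  smooth_symm := contMDiff_id

/-- The composition of bundle isomorphisms. -/
def Iso.trans (f : Iso E E') (g : Iso E' E'') : Iso E E'' where
  toEquiv p := (f.toEquiv p).trans (g.toEquiv p)
  smooth := g.smooth.comp f.smooth
  smooth_symm := f.smooth_symm.comp g.smooth_symm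

/-- The map of modules of global sections induced by a bundle isomorphism. -/
def Iso.mapSections (f : Iso E E') : E.Sections →ₗ[SmoothRing n M] E'.Sections where
  toFun s := ⟨fun p => f.toEquiv p (s p), f.smooth.comp s.contMDiff⟩
  map_add' s t := by ext p; exact (f.toEquiv p).map_add (s p) (t p)
  map_smul' a s := by ext p; exact (f.toEquiv p).map_smul (a p) (s p)

end RankSevenBundle

/-! ## Formal `G₂`-structures -/

variable (n M)

/-- A `G₂`-structure on a bundle of rank `7`: a `G₂`-reduction of its frame bundle, that is, a subset
`frames` of the frame bundle (with fibres `Isom(ℝ⁷, E_p)`) whose fibres are orbits of `G₂` under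
precomposition and that is a smooth principal subbundle, i.e. near every point there is a smooth
local frame with values in `frames`. -/
structure FormalG2Structure where
  bundle : RankSevenBundle n M
  frames : ∀ p, Set (V7 ≃ₗ[ℝ] bundle.fib p)
  orbit : ∀ p, ∀ u ∈ frames p, ∀ u' : V7 ≃ₗ[ℝ] bundle.fib p,
    u' ∈ frames p ↔ ∃ g ∈ G2, u' = g.trans u
  exists_local_frame : ∀ p, ∃ U : Set M, IsOpen U ∧ p ∈ U ∧
    ∃ u : ∀ q, V7 ≃ₗ[ℝ] bundle.fib q, (∀ q ∈ U, u q ∈ frames q) ∧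
      ∀ x : V7, ContMDiffOn (𝓡 n) ((𝓡 n).prod 𝓘(ℝ, V7)) ∞
        (fun q => (⟨q, u q x⟩ : TotalSpace V7 bundle.fib)) U

variable {n M}

/-- A morphism of formal `G₂`-structures `P → P'` is an isomorphism `f : E → E'` of the bundles with
`P' = f P`. -/
@[ext]
structure FormalG2Structure.Hom (P P' : FormalG2Structure n M) where
  toIso : RankSevenBundle.Iso P.bundle P'.bundle
  map_frames : ∀ p, P'.frames p = (fun u => u.trans (toIso.toEquiv p)) '' P.frames p

instance : Category (FormalG2Structure n M) where
  Hom := FormalG2Structure.Hom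
  id P :=
    { toIso := RankSevenBundle.Iso.refl P.bundle
      map_frames := fun p => (Set.image_id _).symm }
  comp f g :=
    { toIso := f.toIso.trans g.toIso
      map_frames := fun p => by
        rw [g.map_frames p, f.map_frames p, Set.image_image]
        rfl }

/-- The functor of global sections of the underlying bundle. -/
def FormalG2Structure.sections : FormalG2Structure n M ⥤ ModuleCat.{u} (SmoothRing n M) where
  obj P := ModuleCat.of _ P.bundle.Sections
  map f := ModuleCat.ofHom f.toIso.mapSections
  map_id _ := rfl
  map_comp _ _ := rfl

/-! ## Formal split `G₂*`-structures -/

variable (n M)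

/-- A split `G₂`-structure on a bundle `E` of rank `7`: an alternating `C^∞(M)`-trilinear form on the
sections of `E` which at every point is carried to `σ₀` by some frame. -/
structure FormalSplitG2Structure where
  bundle : RankSevenBundle n M
  form : bundle.Sections [⋀^Fin 3]→ₗ[SmoothRing n M] SmoothRing n M
  exists_frame : ∀ p, ∃ u : V7 ≃ₗ[ℝ] bundle.fib p, ∀ s : Fin 3 → bundle.Sections,
    form s p = sigma0 fun i => u.symm (s i p)

variable {n M}

/-- A morphism of formal split `G₂`-structures `σ → σ'` is a `C^∞(M)`-linear isomorphism
`f : Γ(E) → Γ(E')` with `σ' = f_* σ`. -/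
@[ext]
structure FormalSplitG2Structure.Hom (S S' : FormalSplitG2Structure n M) where
  toEquiv : S.bundle.Sections ≃ₗ[SmoothRing n M] S'.bundle.Sections
  map_form : S'.form = S.form.compLinearMap toEquiv.symm.toLinearMap

instance : Category (FormalSplitG2Structure n M) where
  Hom := FormalSplitG2Structure.Hom
  id S :=
    { toEquiv := LinearEquiv.refl _ _
      map_form := rfl }
  comp f g :=
    { toEquiv := f.toEquiv.trans g.toEquiv
      map_form := by rw [g.map_form, f.map_form]; rfl }

/-- The functor of global sections of the underlying bundle. -/
def FormalSplitG2Structure.sections :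
    FormalSplitG2Structure n M ⥤ ModuleCat.{u} (SmoothRing n M) where
  obj S := ModuleCat.of _ S.bundle.Sections
  map f := ModuleCat.ofHom f.toEquiv.toLinearMap
  map_id _ := rfl
  map_comp _ _ := rfl

/-! ## Comparison -/

variable (n M)

/-- The disjoint union of the categories of formal `G₂`-structures and of formal split
`G₂*`-structures. -/
abbrev FormalStructure : Type (u + 1) :=
  FormalG2Structure.{u} n M ⊕ FormalSplitG2Structure.{u} n M

variable {n M}

/-- The functor of global sections on the disjoint union of the two categories. -/
def formalSections : FormalStructure n M ⥤ ModuleCat.{u} (SmoothRing n M) :=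
  Functor.sum' (A := FormalG2Structure n M) (B := FormalSplitG2Structure n M)
    FormalG2Structure.sections FormalSplitG2Structure.sections

/-- The module of global sections of the bundle underlying a formal structure. -/
abbrev SectionsOf (X : FormalStructure n M) : Type u :=
  (formalSections (n := n) (M := M)).obj X

/-- `HasForm X τ`: the three-form that the formal structure `X` determines on the sections of its
bundle is `τ`. For a `G₂`-reduction this is the three-form whose pullback by every frame of the
reduction is `φ₀`; a split structure is itself a three-form. -/
def HasForm : (X : FormalStructure n M) →
    (SectionsOf X → SectionsOf X → SectionsOf X → SmoothRing n M) → Prop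
  | Sum.inl P, τ => ∀ (s : Fin 3 → P.bundle.Sections) (p : M), ∀ u ∈ P.frames p,
      τ (s 0) (s 1) (s 2) p = phi0 fun i => u.symm (s i p)
  | Sum.inr S, τ => ∀ s : Fin 3 → S.bundle.Sections, τ (s 0) (s 1) (s 2) = S.form s

/-- The trilinear form `φ_C(x, y, z) = ½ b(xy, z)` on the orthogonal complement of the identity. -/
def octonionForm (C : OctonionAlgebra (SmoothRing n M)) (x y z : C.imag) : SmoothRing n M :=
  (1 / 2 : ℝ) • C.bilin (x.1 * y.1) z.1

/-- The vanishing ideal of a point. -/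
def pointIdeal (n : ℕ) {M : Type u} [TopologicalSpace M]
    [ChartedSpace (EuclideanSpace ℝ (Fin n)) M] (p : M) : Ideal (SmoothRing n M) :=
  RingHom.ker (ContMDiffMap.evalRingHom (I := 𝓡 n) (I' := 𝓘(ℝ, ℝ)) (n := ∞) (R := ℝ) p)

/-- The fibre at `p` of the octonion algebra `C` over `C^∞(M)` is the real octonion algebra
`C ⧸ I_p C`. It is non-split if it has no zero divisors, and split otherwise; here this is expressed
on representatives. -/
def NonSplitAt (C : OctonionAlgebra (SmoothRing n M)) (p : M) : Prop :=
  ∀ x y : C.carrier, x * y ∈ pointIdeal n p • (⊤ : Submodule (SmoothRing n M) C.carrier) →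
    x ∈ pointIdeal n p • (⊤ : Submodule (SmoothRing n M) C.carrier) ∨
    y ∈ pointIdeal n p • (⊤ : Submodule (SmoothRing n M) C.carrier)

end Bundles

end OctG2

end

noncomputable section


namespace OctG2

/-! ## Cross products -/

/-! On a connected manifold q(1) is an idempotent function, and the rank excludes 0, so q(1) = 1. As
2 is invertible, C = R·1 ⊕ 1^⊥, and the whole algebra is encoded on 1^⊥ by the metric g = ½b and the
product c(x, y) = xy + ½b(x, y)1. Polarizing q(xy) = q(x)q(y) shows that (g, c) is a cross product.
Conversely, a cross product with perfect g on a projective module of rank seven defines an octonion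
algebra on R × V, the multiplicativity of the norm being Lagrange's identity `g_c_c`. The three-form
of the statement is g(c(x, y), z).

The decisive fact is pointwise, `g_eq_of_form`: the three-form alone determines g, and therefore c,
in either signature. A proportionality between two products c(x, y) and c(z, w) is visible to the
three-form; suitable relations of this kind force any two candidate metrics to be proportional, and
the rule for c(x, c(x, y)) makes the cube of the factor equal to 1. Hence isomorphisms of octonion
algebras are exactly the C^∞(M)-linear isomorphisms of 1^⊥ that preserve three-forms, and the
functor `toOct` from formal structures to octonion algebras is fully faithful.

A nondegenerate cross product on a real space of dimension seven has a basis generated by three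
orthogonal vectors a, b, d with g(a, a) = g(b, b) = 1, g(d, d) = s = ±1 and d ⊥ c(a, b). Its
multiplication table depends on s only: s = 1 gives φ₀ and s = -1 gives σ₀. Gram–Schmidt with
sections produces such triples smoothly near each point (`exists_isTriple`), so the sign is locally
constant, hence constant (`exists_isModelled`). For s = 1 the norm of each fibre is anisotropic,
which excludes zero divisors; for s = -1 an isotropic imaginary vector has square zero.

Two analytic inputs complete the argument. The first is the correspondence between bundles of rank
seven and finitely generated projective modules. Since M need not be compact, a bound on the number
of generators is required: over a compact set a bundle maps injectively to a trivial bundle of rank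
n + 7, because linear projections along a general line stay injective as long as the target is
larger (`FiberMap.InjOver.exists_reduced`); an exhaustion in three colours then glues these maps.
The second concerns split structures, which provide frames only pointwise. The orbit of σ₀ in the
space of three-forms is open, and the inverse function theorem supplies smoothly varying frames
(`exists_smooth_frame_of_form`). -/

/-- A cross product on a module: a symmetric bilinear form `g` and an alternating bilinear product `c`
whose associated trilinear form `g (c x y) z` is alternating and with
`c x (c x y) = g x y • x - g x x • y`. -/
structure CrossProduct (R V : Type*) [CommRing R] [AddCommGroup V] [Module R V] where
  g : V →ₗ[R] V →ₗ[R] R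
  c : V →ₗ[R] V →ₗ[R] V
  symm : ∀ x y, g x y = g y x
  self : ∀ x, c x x = 0
  skew : ∀ x y z, g (c x y) z = - g y (c x z)
  double : ∀ x y, c x (c x y) = g x y • x - g x x • y

namespace CrossProduct

variable {R V : Type*} [CommRing R] [AddCommGroup V] [Module R V] (X : CrossProduct R V)

theorem anti (x y : V) : X.c x y = - X.c y x := by
  have h := X.self (x + y)
  simp only [map_add, LinearMap.add_apply, X.self, zero_add, add_zero] at h
  exact eq_neg_of_add_eq_zero_right h

/-- The trilinear form `g (c x y) z`. -/
def form (x y z : V) : R := X.g (X.c x y) z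

theorem form_cyclic (x y z : V) : X.form x y z = X.form y z x := by
  unfold form
  rw [X.skew x y z, X.anti x z, X.symm y, map_neg, LinearMap.neg_apply, neg_neg, X.skew z x y,
    X.anti z y, X.symm x, map_neg, LinearMap.neg_apply, neg_neg]

theorem form_self (x z : V) : X.form x x z = 0 := by
  simp [form, X.self]

theorem g_c_left (x y : V) : X.g (X.c x y) x = 0 := by
  rw [X.skew, X.self, map_zero, neg_zero]

theorem g_c_right (x y : V) : X.g (X.c x y) y = 0 := by
  rw [X.anti, map_neg, LinearMap.neg_apply, X.g_c_left, neg_zero]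

/-- Polarization of `double` in the repeated argument. When the metric terms vanish it says that
products with x and with z anticommute, and it is the source of the multiplication table of an
adapted frame. -/
theorem double_polar (x z y : V) :
    X.c x (X.c z y) + X.c z (X.c x y) = X.g x y • z + X.g z y • x - (2 * X.g x z) • y := by
  have h := X.double (x + z) y
  simp only [map_add, LinearMap.add_apply, X.double, X.symm z x, add_smul, smul_add] at h
  rw [two_mul, add_smul]
  rw [← sub_eq_zero] at h ⊢
  rw [← h]
  abel

/-- Skewness moves one factor to the other side and `double` evaluates the resulting square. Thus
multiplication by x scales lengths by g(x, x) on the complement of x. -/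
theorem g_c_c (x y z : V) :
    X.g (X.c x y) (X.c x z) = X.g x x * X.g y z - X.g x y * X.g x z := by
  rw [X.skew, X.double]
  simp only [map_sub, map_smul, smul_eq_mul, X.symm y x]
  ring

/-- Two cross products with nondegenerate forms are intertwined by a linear equivalence that is
isometric and preserves the trilinear forms. -/
theorem map_c {W : Type*} [AddCommGroup W] [Module R W] (Y : CrossProduct R W)
    (hY : ∀ w, (∀ w', Y.g w w' = 0) → w = 0) (f : V ≃ₗ[R] W)
    (hf : ∀ x y z, Y.form (f x) (f y) (f z) = X.form x y z)
    (hg : ∀ x y, Y.g (f x) (f y) = X.g x y) (x y : V) : f (X.c x y) = Y.c (f x) (f y) := by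
  rw [← sub_eq_zero]
  refine hY _ fun w => ?_
  obtain ⟨z, rfl⟩ := f.surjective w
  have := hf x y z
  simp only [form] at this
  rw [map_sub, LinearMap.sub_apply, hg, this, sub_self]

/-- Transport of a cross product along a linear equivalence. -/
def transport {W : Type*} [AddCommGroup W] [Module R W] (f : V ≃ₗ[R] W) : CrossProduct R W where
  g := X.g.compl₁₂ f.symm.toLinearMap f.symm.toLinearMap
  c := (X.c.compl₁₂ f.symm.toLinearMap f.symm.toLinearMap).compr₂ f.toLinearMap
  symm x y := X.symm _ _
  self x := by simp [X.self]
  skew x y z := by simp [X.skew]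
  double x y := by simp [X.double]

@[simp]
theorem transport_g {W : Type*} [AddCommGroup W] [Module R W] (f : V ≃ₗ[R] W) (x y : W) :
    (X.transport f).g x y = X.g (f.symm x) (f.symm y) := rfl

@[simp]
theorem transport_c {W : Type*} [AddCommGroup W] [Module R W] (f : V ≃ₗ[R] W) (x y : W) :
    (X.transport f).c x y = f (X.c (f.symm x) (f.symm y)) := rfl

theorem transport_form {W : Type*} [AddCommGroup W] [Module R W] (f : V ≃ₗ[R] W) (x y z : W) :
    (X.transport f).form x y z = X.form (f.symm x) (f.symm y) (f.symm z) := by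
  simp [form]

/-! ### The octonion algebra of a cross product -/

/-- The algebra `R × V` with product `(a, x) (b, y) = (a b - g(x, y), a y + b x + c(x, y))`. -/
def Octonion (_ : CrossProduct R V) : Type _ := R × V

namespace Octonion

instance : AddCommGroup X.Octonion := inferInstanceAs (AddCommGroup (R × V))

instance : Module R X.Octonion := inferInstanceAs (Module R (R × V))

variable {X}

/-- The element `(r, v)`. -/
def mk (r : R) (v : V) : X.Octonion := (r, v)

@[simp] theorem fst_mk (r : R) (v : V) : (mk r v : X.Octonion).1 = r := rfl
@[simp] theorem snd_mk (r : R) (v : V) : (mk r v : X.Octonion).2 = v := rfl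

@[ext]
theorem ext {x y : X.Octonion} (h₁ : x.1 = y.1) (h₂ : x.2 = y.2) : x = y := Prod.ext h₁ h₂

theorem fst_add (x y : X.Octonion) : (x + y).1 = x.1 + y.1 := rfl
theorem snd_add (x y : X.Octonion) : (x + y).2 = x.2 + y.2 := rfl
theorem fst_smul (r : R) (x : X.Octonion) : (r • x).1 = r * x.1 := rfl
theorem snd_smul (r : R) (x : X.Octonion) : (r • x).2 = r • x.2 := rfl
theorem fst_zero : (0 : X.Octonion).1 = 0 := rfl
theorem snd_zero : (0 : X.Octonion).2 = 0 := rfl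

instance : Mul X.Octonion :=
  ⟨fun x y => (x.1 * y.1 - X.g x.2 y.2, x.1 • y.2 + y.1 • x.2 + X.c x.2 y.2)⟩

instance : One X.Octonion := ⟨((1 : R), (0 : V))⟩

theorem fst_mul (x y : X.Octonion) : (x * y).1 = x.1 * y.1 - X.g x.2 y.2 := rfl
theorem snd_mul (x y : X.Octonion) :
    (x * y).2 = x.1 • y.2 + y.1 • x.2 + X.c x.2 y.2 := rfl
theorem fst_one : (1 : X.Octonion).1 = 1 := rfl
theorem snd_one : (1 : X.Octonion).2 = 0 := rfl

instance : NonAssocRing X.Octonion :=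
  { (inferInstance : AddCommGroup X.Octonion) with
    left_distrib := fun x y z => by
      ext
      · simp only [fst_mul, fst_add, snd_add, map_add]; ring
      · simp only [snd_mul, fst_add, snd_add, map_add, smul_add, add_smul]; abel
    right_distrib := fun x y z => by
      ext
      · simp only [fst_mul, fst_add, snd_add, map_add, LinearMap.add_apply]; ring
      · simp only [snd_mul, fst_add, snd_add, map_add, LinearMap.add_apply, smul_add, add_smul]
        abel
    zero_mul := fun x => by
      ext <;> simp [fst_mul, snd_mul, fst_zero, snd_zero]
    mul_zero := fun x => by
      ext <;> simp [fst_mul, snd_mul, fst_zero, snd_zero]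
    one_mul := fun x => by
      ext <;> simp [fst_mul, snd_mul, fst_one, snd_one]
    mul_one := fun x => by
      ext <;> simp [fst_mul, snd_mul, fst_one, snd_one] }

instance : IsScalarTower R X.Octonion X.Octonion where
  smul_assoc r x y := by
    ext
    · simp only [smul_eq_mul, fst_mul, fst_smul, snd_smul, map_smul, LinearMap.smul_apply]; ring
    · simp only [smul_eq_mul, snd_mul, fst_smul, snd_smul, map_smul, LinearMap.smul_apply,
        smul_add, smul_smul]
      rw [mul_comm y.1 r]

instance : SMulCommClass R X.Octonion X.Octonion where
  smul_comm r x y := by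
    ext
    · simp only [smul_eq_mul, fst_mul, fst_smul, snd_smul, map_smul]; ring
    · simp only [smul_eq_mul, snd_mul, fst_smul, snd_smul, map_smul, smul_add, smul_smul]
      rw [mul_comm x.1 r]

variable (X)

/-- The bilinear form `((a, x), (b, y)) ↦ a b + g(x, y)`. -/
def pairing : X.Octonion →ₗ[R] X.Octonion →ₗ[R] R :=
  LinearMap.mk₂ R (fun x y => x.1 * y.1 + X.g x.2 y.2)
    (fun x y z => by simp only [fst_add, snd_add, map_add, LinearMap.add_apply]; ring)
    (fun r x y => by
      simp only [fst_smul, snd_smul, map_smul, LinearMap.smul_apply, smul_eq_mul]; ring)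
    (fun x y z => by simp only [fst_add, snd_add, map_add]; ring)
    (fun r x y => by simp only [fst_smul, snd_smul, map_smul, smul_eq_mul]; ring)

theorem pairing_apply (x y : X.Octonion) : pairing X x y = x.1 * y.1 + X.g x.2 y.2 := rfl

/-- The norm `(a, x) ↦ a² + g(x, x)`. -/
def norm : QuadraticForm R X.Octonion := LinearMap.BilinMap.toQuadraticMap (pairing X)

theorem norm_apply (x : X.Octonion) : norm X x = x.1 * x.1 + X.g x.2 x.2 := rfl

theorem norm_polar (x y : X.Octonion) : (norm X).polarBilin x y = 2 * pairing X x y := by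
  simp only [QuadraticMap.polarBilin_apply_apply, QuadraticMap.polar, norm_apply, pairing_apply,
    fst_add, snd_add, map_add, LinearMap.add_apply, X.symm y.2 x.2]
  ring

/-- The mixed terms cancel because c(x, y) is orthogonal to x and y; what remains is Lagrange's
identity `g_c_c`. -/
theorem norm_mul (x y : X.Octonion) : norm X (x * y) = norm X x * norm X y := by
  simp only [norm_apply, fst_mul, snd_mul, map_add, map_smul, LinearMap.add_apply,
    LinearMap.smul_apply, smul_eq_mul, X.g_c_c, X.g_c_left, X.g_c_right, X.symm y.2 x.2,
    X.symm x.2 (X.c _ _), X.symm y.2 (X.c _ _)]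
  ring

/-- The pairing of the octonion algebra is perfect if that of the cross product is. -/
theorem norm_polar_bijective [Invertible (2 : R)] (h : Function.Bijective X.g) :
    Function.Bijective (norm X).polarBilin := by
  constructor
  · rw [← LinearMap.ker_eq_bot, LinearMap.ker_eq_bot']
    intro x hx
    have hx' : ∀ y, pairing X x y = 0 := fun y => by
      have := LinearMap.congr_fun hx y
      rw [norm_polar, LinearMap.zero_apply] at this
      simpa using congrArg (⅟(2 : R) * ·) this
    have h1 : x.1 = 0 := by
      have := hx' (mk 1 0)
      simpa [pairing_apply] using this
    have h2 : x.2 = 0 := by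
      refine (LinearMap.ker_eq_bot'.1 (LinearMap.ker_eq_bot.2 h.1)) _ ?_
      ext y
      have := hx' (mk 0 y)
      simpa [pairing_apply] using this
    exact ext h1 h2
  · intro ℓ
    let ι : V →ₗ[R] X.Octonion :=
      { toFun := mk 0
        map_add' := fun v w => ext (by simp [fst_add]) (by simp [snd_add])
        map_smul' := fun r v => ext (by simp [fst_smul]) (by simp [snd_smul]) }
    obtain ⟨v, hv⟩ := h.2 (⅟(2 : R) • ℓ.comp ι)
    -- The polar form is twice `pairing`, so both components of the representing element carry the
    -- factor ½.
    refine ⟨mk (⅟(2 : R) * ℓ 1) v, LinearMap.ext fun y => ?_⟩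
    have h1 : X.g v y.2 = ⅟2 * ℓ (mk 0 y.2) := LinearMap.congr_fun hv y.2
    have h2 : y = y.1 • 1 + mk 0 y.2 := by
      ext <;> simp [fst_add, fst_smul, snd_add, snd_smul, fst_one, snd_one]
    have h3 : ℓ y = y.1 * ℓ 1 + ℓ (mk 0 y.2) := by
      conv_lhs => rw [h2]
      rw [map_add, map_smul, smul_eq_mul]
    rw [norm_polar, pairing_apply, fst_mk, snd_mk, h1, h3]
    linear_combination (y.1 * ℓ 1 + ℓ (mk 0 y.2)) * mul_invOf_self (2 : R)

end Octonion

end CrossProduct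

/-! ### The cross product of an octonion algebra -/

namespace OctonionAlgebra

variable {R : Type u} [CommRing R] (C : OctonionAlgebra R)

theorem bilin_apply (x y : C.carrier) : C.bilin x y = C.norm (x + y) - C.norm x - C.norm y := rfl

theorem bilin_symm (x y : C.carrier) : C.bilin x y = C.bilin y x := by
  rw [bilin_apply, bilin_apply, add_comm x y]; ring

theorem bilin_self (x : C.carrier) : C.bilin x x = 2 * C.norm x := by
  rw [bilin_apply, ← two_smul R x, QuadraticMap.map_smul]
  simp only [smul_eq_mul]; ring

theorem eq_of_bilin {x y : C.carrier} (h : ∀ z, C.bilin x z = C.bilin y z) : x = y :=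
  C.nondegenerate.1 (LinearMap.ext h)

theorem bilin_mul_mul_left (x y z : C.carrier) :
    C.bilin (x * y) (x * z) = C.norm x * C.bilin y z := by
  simp only [bilin_apply, ← mul_add, C.norm_mul]; ring

/-- Full polarization of the multiplicativity of the norm. For x orthogonal to 1 and z = 1 the
right-hand side vanishes, which makes left multiplication by x skew-adjoint. -/
theorem bilin_mul_mul (x y z w : C.carrier) :
    C.bilin (x * y) (z * w) + C.bilin (z * y) (x * w) = C.bilin x z * C.bilin y w := by
  have h := C.bilin_mul_mul_left (x + z) y w
  have h' := C.bilin_apply x z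
  simp only [add_mul, map_add, LinearMap.add_apply, bilin_mul_mul_left] at h
  linear_combination h - C.bilin y w * h'

theorem mem_imag {x : C.carrier} : x ∈ C.imag ↔ C.bilin 1 x = 0 := LinearMap.mem_ker

theorem bilin_one_imag (x : C.imag) : C.bilin x.1 1 = 0 := by
  rw [bilin_symm]; exact x.2

theorem bilin_imag_mul (x : C.imag) (y w : C.carrier) :
    C.bilin (x.1 * y) w = - C.bilin y (x.1 * w) := by
  have h := C.bilin_mul_mul x.1 y 1 w
  rw [one_mul, one_mul, bilin_one_imag, zero_mul] at h
  exact eq_neg_of_add_eq_zero_left h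

/-- Skewness of left multiplication together with its scaling of b, tested against all vectors. This
replaces associativity, which is not available. -/
theorem imag_mul_mul (x : C.imag) (y : C.carrier) :
    x.1 * (x.1 * y) = - (C.norm x.1 • y) := by
  refine C.eq_of_bilin fun w => ?_
  rw [bilin_imag_mul, bilin_mul_mul_left, map_neg, map_smul]; rfl

theorem imag_mul_self (x : C.imag) : x.1 * x.1 = - (C.norm x.1 • (1 : C.carrier)) := by
  simpa using C.imag_mul_mul x 1

variable [Invertible (2 : R)]

/-- The bilinear form `½ b` on the orthogonal complement of the identity. -/
def imagForm : C.imag →ₗ[R] C.imag →ₗ[R] R :=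
  ⅟(2 : R) • C.bilin.compl₁₂ C.imag.subtype C.imag.subtype

theorem imagForm_apply (x y : C.imag) : C.imagForm x y = ⅟2 * C.bilin x.1 y.1 := rfl

theorem imagForm_self (x : C.imag) : C.imagForm x x = C.norm x.1 := by
  rw [imagForm_apply, bilin_self, invOf_mul_cancel_left]

variable {C} (h1 : C.norm 1 = 1)

include h1

theorem imag_cross_mem (x y : C.imag) :
    x.1 * y.1 + C.imagForm x y • (1 : C.carrier) ∈ C.imag := by
  rw [mem_imag, bilin_symm, map_add, LinearMap.add_apply, bilin_imag_mul, mul_one, map_smul,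
    LinearMap.smul_apply, bilin_self, h1, imagForm_apply, C.bilin_symm y.1, smul_eq_mul]
  linear_combination C.bilin x.1 y.1 * invOf_mul_self (2 : R)

/-- The cross product `c(x, y) = x y + ½ b(x, y) 1` on the orthogonal complement of the identity. -/
def cross : CrossProduct R C.imag where
  g := C.imagForm
  c := LinearMap.mk₂ R (fun x y => ⟨x.1 * y.1 + C.imagForm x y • (1 : C.carrier),
      imag_cross_mem h1 x y⟩)
    (fun x y z => Subtype.ext <| by
      simp only [Submodule.coe_add, add_mul, map_add, LinearMap.add_apply, add_smul]; abel)
    (fun r x y => Subtype.ext <| by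
      simp only [Submodule.coe_smul, smul_mul_assoc, map_smul, LinearMap.smul_apply, smul_add,
        smul_assoc])
    (fun x y z => Subtype.ext <| by
      simp only [Submodule.coe_add, mul_add, map_add, add_smul]; abel)
    (fun r x y => Subtype.ext <| by
      simp only [Submodule.coe_smul, mul_smul_comm, map_smul, smul_add, smul_assoc])
  symm x y := by rw [imagForm_apply, imagForm_apply, bilin_symm]
  self x := Subtype.ext <| by
    simp [imag_mul_self, imagForm_self]
  skew x y z := by
    simp only [LinearMap.mk₂_apply, imagForm_apply, map_add, LinearMap.add_apply, map_smul,
      LinearMap.smul_apply]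
    rw [bilin_imag_mul, C.bilin_one_imag y, C.bilin_symm 1, C.bilin_one_imag z]
    simp
  double x y := Subtype.ext <| by
    have h0 : C.bilin x.1 (x.1 * y.1) = 0 := by
      have := C.bilin_mul_mul_left x.1 1 y.1
      rwa [mul_one, C.bilin_symm 1, C.bilin_one_imag, mul_zero] at this
    have h2 : C.imagForm x ⟨_, imag_cross_mem h1 x y⟩ = 0 := by
      rw [imagForm_apply, map_add, map_smul, h0, C.bilin_one_imag x, smul_zero, add_zero, mul_zero]
    simp only [LinearMap.mk₂_apply, h2, mul_add, imag_mul_mul, imagForm_self, mul_smul_comm,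
      mul_one, AddSubgroupClass.coe_sub, Submodule.coe_smul, zero_smul, add_zero]
    abel

theorem cross_g (x y : C.imag) : (cross h1).g x y = C.imagForm x y := rfl

theorem cross_c (x y : C.imag) :
    ((cross h1).c x y : C.carrier) = x.1 * y.1 + C.imagForm x y • (1 : C.carrier) := rfl

/-- The scalar correction in `cross` is orthogonal to the imaginary part and does not contribute. -/
theorem cross_form (x y z : C.imag) : (cross h1).form x y z = ⅟2 * C.bilin (x.1 * y.1) z.1 := by
  rw [CrossProduct.form, cross_g, imagForm_apply, cross_c, map_add, LinearMap.add_apply, map_smul,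
    LinearMap.smul_apply, C.bilin_symm 1, C.bilin_one_imag, smul_zero, add_zero]

end OctonionAlgebra

end OctG2

namespace OctG2

/-! ## The model cross products on `ℝ⁷` -/

/-- The coefficients of the diagonal metric `diag(1, 1, 1, s, s, s, s)`. -/
def diagSign (s : ℤˣ) : V7 := ![1, 1, 1, ((s : ℤ) : ℝ), ((s : ℤ) : ℝ), ((s : ℤ) : ℝ), ((s : ℤ) : ℝ)]

/-- The model cross product on `ℝ⁷` with metric `diag(1, 1, 1, s, s, s, s)`. -/
def modelMul (s : ℤˣ) (x y : V7) : V7 :=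
  ![x 1 * y 2 - x 2 * y 1 + (s : ℤ) * (x 3 * y 4 - x 4 * y 3 + (x 5 * y 6 - x 6 * y 5)),
    x 2 * y 0 - x 0 * y 2 + (s : ℤ) * (x 3 * y 5 - x 5 * y 3 - (x 4 * y 6 - x 6 * y 4)),
    x 0 * y 1 - x 1 * y 0 - (s : ℤ) * (x 3 * y 6 - x 6 * y 3 + (x 4 * y 5 - x 5 * y 4)),
    x 4 * y 0 - x 0 * y 4 + (x 5 * y 1 - x 1 * y 5) - (x 6 * y 2 - x 2 * y 6),
    x 0 * y 3 - x 3 * y 0 - (x 6 * y 1 - x 1 * y 6) - (x 5 * y 2 - x 2 * y 5),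
    x 6 * y 0 - x 0 * y 6 + (x 1 * y 3 - x 3 * y 1) - (x 2 * y 4 - x 4 * y 2),
    x 0 * y 5 - x 5 * y 0 - (x 1 * y 4 - x 4 * y 1) - (x 2 * y 3 - x 3 * y 2)]

/-- The model metric `diag(1, 1, 1, s, s, s, s)`. -/
def modelForm (s : ℤˣ) (x y : V7) : ℝ :=
  x 0 * y 0 + x 1 * y 1 + x 2 * y 2 + (s : ℤ) * (x 3 * y 3 + x 4 * y 4 + x 5 * y 5 + x 6 * y 6)

theorem ext_seven {x y : V7} (h0 : x 0 = y 0) (h1 : x 1 = y 1) (h2 : x 2 = y 2) (h3 : x 3 = y 3)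
    (h4 : x 4 = y 4) (h5 : x 5 = y 5) (h6 : x 6 = y 6) : x = y := by
  funext i
  fin_cases i <;> assumption

theorem modelMul_add_left (s : ℤˣ) (x y z : V7) :
    modelMul s (x + y) z = modelMul s x z + modelMul s y z := by
  apply ext_seven <;> simp [modelMul] <;> ring

theorem modelMul_smul_left (s : ℤˣ) (r : ℝ) (x y : V7) :
    modelMul s (r • x) y = r • modelMul s x y := by
  apply ext_seven <;> simp [modelMul] <;> ring

theorem modelMul_swap (s : ℤˣ) (x y : V7) : modelMul s x y = - modelMul s y x := by
  apply ext_seven <;> simp [modelMul] <;> ring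

theorem modelMul_double (s : ℤˣ) (x y : V7) :
    modelMul s x (modelMul s x y) = modelForm s x y • x - modelForm s x x • y := by
  -- The identity needs s² = 1, so the two signs are substituted before normalizing polynomials.
  rcases Int.units_eq_one_or s with rfl | rfl <;>
  apply ext_seven <;> simp [modelMul, modelForm] <;> ring

/-- The model cross product on `ℝ⁷` with metric `diag(1, 1, 1, s, s, s, s)`. -/
def model (s : ℤˣ) : CrossProduct ℝ V7 where
  g := LinearMap.mk₂ ℝ (modelForm s)
    (fun x y z => by simp [modelForm]; ring) (fun r x y => by simp [modelForm]; ring)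
    (fun x y z => by simp [modelForm]; ring) (fun r x y => by simp [modelForm]; ring)
  c := LinearMap.mk₂ ℝ (modelMul s) (modelMul_add_left s) (modelMul_smul_left s)
    (fun x y z => by
      rw [modelMul_swap, modelMul_add_left, modelMul_swap s y, modelMul_swap s z, neg_add, neg_neg,
        neg_neg])
    (fun r x y => by rw [modelMul_swap, modelMul_smul_left, modelMul_swap s y, smul_neg, neg_neg])
  symm x y := by simp [modelForm]; ring
  self x := self_eq_neg.1 (modelMul_swap s x x)
  skew x y z := by
    rcases Int.units_eq_one_or s with rfl | rfl <;> simp [modelForm, modelMul] <;> ring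
  double := modelMul_double s

theorem model_g (s : ℤˣ) (x y : V7) : (model s).g x y = modelForm s x y := rfl

theorem model_c (s : ℤˣ) (x y : V7) : (model s).c x y = modelMul s x y := rfl

theorem e3_apply (i j k : Fin 7) (v : Fin 3 → V7) :
    e3 i j k v = v 0 i * v 1 j * v 2 k - v 0 i * v 1 k * v 2 j - v 0 j * v 1 i * v 2 k
      + v 0 j * v 1 k * v 2 i + v 0 k * v 1 i * v 2 j - v 0 k * v 1 j * v 2 i := by
  change Matrix.det (Matrix.of fun a b => v a (![i, j, k] b)) = _
  rw [Matrix.det_fin_three]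
  rfl

/-- With `model_neg_one_form`, this places both three-forms of the theorem in one family of cross
products whose only parameter is the sign of the last four metric coefficients. -/
theorem model_one_form (v : Fin 3 → V7) : (model 1).form (v 0) (v 1) (v 2) = phi0 v := by
  simp only [phi0, AlternatingMap.add_apply, AlternatingMap.sub_apply, e3_apply, CrossProduct.form,
    model_g, model_c, modelForm]
  simp [modelMul]
  ring

theorem model_neg_one_form (v : Fin 3 → V7) : (model (-1)).form (v 0) (v 1) (v 2) = sigma0 v := by
  simp only [sigma0, AlternatingMap.add_apply, AlternatingMap.sub_apply, e3_apply,
    CrossProduct.form, model_g, model_c, modelForm]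
  simp [modelMul]
  ring

theorem model_g_single (s : ℤˣ) (x : V7) (i : Fin 7) :
    (model s).g x (Pi.single i 1) = diagSign s i * x i := by
  rw [model_g]
  fin_cases i <;> simp [modelForm, diagSign]

theorem diagSign_mul_self (s : ℤˣ) (i : Fin 7) : diagSign s i * diagSign s i = 1 := by
  rcases Int.units_eq_one_or s with rfl | rfl <;> fin_cases i <;> simp [diagSign]

theorem diagSign_ne_zero (s : ℤˣ) (i : Fin 7) : diagSign s i ≠ 0 := fun h => by
  simpa [h] using diagSign_mul_self s i

theorem model_nondegenerate (s : ℤˣ) (x : V7) (h : ∀ y, (model s).g x y = 0) : x = 0 := by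
  funext i
  have := h (Pi.single i 1)
  rw [model_g_single] at this
  exact (mul_eq_zero.1 this).resolve_left (diagSign_ne_zero s i)

/-! ### Adapted frames, and recovery of the metric from the three-form -/

namespace CrossProduct

section Real

variable {W : Type*} [AddCommGroup W] [Module ℝ W] (X : CrossProduct ℝ W)

/-- A triple generating an adapted frame of a cross product: the first two vectors have square
length `1`, the third one has square length `s`, and the third one is orthogonal to the first two and
their product. -/
structure IsTriple (s : ℤˣ) (a b d : W) : Prop where
  aa : X.g a a = 1
  bb : X.g b b = 1
  dd : X.g d d = (s : ℤ)
  ab : X.g a b = 0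
  ad : X.g a d = 0
  bd : X.g b d = 0
  cd : X.g (X.c a b) d = 0

/-- The seven vectors generated by a triple. -/
def tripleFrame (a b d : W) : Fin 7 → W :=
  ![a, b, X.c a b, d, X.c a d, X.c b d, X.c a (X.c b d)]

variable {X} {s : ℤˣ} {a b d : W}

/-- The Gram matrix of the seven vectors is forced: `g_c_c` gives the lengths of products, while
skewness and the orthogonality conditions on the triple make all mixed entries vanish. -/
theorem IsTriple.map_g (h : X.IsTriple s a b d) (x y : V7) :
    X.g (∑ i, x i • X.tripleFrame a b d i) (∑ i, y i • X.tripleFrame a b d i)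
      = modelForm s x y := by
  obtain ⟨aa, bb, dd, ab, ad, bd, cd⟩ := h
  have ba : X.g b a = 0 := by rw [X.symm, ab]
  have da : X.g d a = 0 := by rw [X.symm, ad]
  have db : X.g d b = 0 := by rw [X.symm, bd]
  have dc : X.g d (X.c a b) = 0 := by rw [X.symm, cd]
  have h41 : X.g (X.c a d) b = 0 := by rw [X.skew, dc, neg_zero]
  have h42 : X.g (X.c a d) (X.c a b) = 0 := by simp [X.g_c_c, ad, db, ab]
  have h44 : X.g (X.c a d) (X.c a d) = (s : ℤ) := by simp [X.g_c_c, aa, ad, dd]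
  have h22 : X.g (X.c a b) (X.c a b) = 1 := by simp [X.g_c_c, aa, bb, ab]
  have h50 : X.g (X.c b d) a = 0 := by rw [X.skew, X.anti b a, map_neg, dc, neg_zero, neg_zero]
  have h52 : X.g (X.c b d) (X.c a b) = 0 := by
    rw [X.anti a b, map_neg, X.g_c_c, bd, da, ba]; simp
  have h54 : X.g (X.c b d) (X.c a d) = 0 := by
    rw [X.anti a d, map_neg, X.anti b d, map_neg, LinearMap.neg_apply, X.g_c_c, ba, db, da]; simp
  have h55 : X.g (X.c b d) (X.c b d) = (s : ℤ) := by simp [X.g_c_c, bb, dd, bd]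
  have h05 : X.g a (X.c b d) = 0 := by rw [X.symm, h50]
  have h66 : X.g (X.c a (X.c b d)) (X.c a (X.c b d)) = (s : ℤ) := by
    rw [X.g_c_c, aa, h55, h05]; ring
  have h61 : X.g (X.c a (X.c b d)) b = 0 := by rw [X.skew, h52, neg_zero]
  have h62 : X.g (X.c a (X.c b d)) (X.c a b) = 0 := by simp [X.g_c_c, h05, ab, X.g_c_left]
  have h63 : X.g (X.c a (X.c b d)) d = 0 := by rw [X.skew, h54, neg_zero]
  have h64 : X.g (X.c a (X.c b d)) (X.c a d) = 0 := by simp [X.g_c_c, h05, ad, X.g_c_right]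
  have h60 := X.g_c_left a (X.c b d)
  have h65 := X.g_c_right a (X.c b d)
  have h20 := X.g_c_left a b
  have h21 := X.g_c_right a b
  have h40 := X.g_c_left a d
  have h43 := X.g_c_right a d
  have h51 := X.g_c_left b d
  have h53 := X.g_c_right b d
  -- The expansion below meets every off-diagonal entry in both orders.
  have h02 := h20; rw [X.symm] at h02
  have h12 := h21; rw [X.symm] at h12
  have h04 := h40; rw [X.symm] at h04
  have h14 := h41; rw [X.symm] at h14
  have h24 := h42; rw [X.symm] at h24
  have h34 := h43; rw [X.symm] at h34
  have h15 := h51; rw [X.symm] at h15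
  have h25 := h52; rw [X.symm] at h25
  have h35 := h53; rw [X.symm] at h35
  have h45 := h54; rw [X.symm] at h45
  have h06 := h60; rw [X.symm] at h06
  have h16 := h61; rw [X.symm] at h16
  have h26 := h62; rw [X.symm] at h26
  have h36 := h63; rw [X.symm] at h36
  have h46 := h64; rw [X.symm] at h46
  have h56 := h65; rw [X.symm] at h56
  simp only [Fin.sum_univ_seven, tripleFrame, map_add, map_smul, LinearMap.add_apply,
    LinearMap.smul_apply, Matrix.cons_val, smul_eq_mul, *]
  simp only [modelForm]
  ring

/-- The 21 products of distinct frame vectors all follow from `double` and `double_polar`, because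
the metric terms in these identities are known from the Gram matrix. -/
theorem IsTriple.map_c (h : X.IsTriple s a b d) (x y : V7) :
    X.c (∑ i, x i • X.tripleFrame a b d i) (∑ i, y i • X.tripleFrame a b d i)
      = ∑ i, modelMul s x y i • X.tripleFrame a b d i := by
  -- Evaluating the Gram computation at standard basis vectors makes its single entries available
  -- again.
  have G : ∀ i j, X.g (X.tripleFrame a b d i) (X.tripleFrame a b d j)
      = modelForm s (Pi.single i 1) (Pi.single j 1) := fun i j => by
    have := h.map_g (Pi.single i 1) (Pi.single j 1)
    simpa [Pi.single_apply] using this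
  obtain ⟨aa, bb, dd, ab, ad, bd, cd⟩ := h
  set e2 := X.c a b with he2
  set e4 := X.c a d with he4
  set e5 := X.c b d with he5
  set e6 := X.c a e5 with he6
  have ba : X.g b a = 0 := by rw [X.symm, ab]
  have da : X.g d a = 0 := by rw [X.symm, ad]
  have db : X.g d b = 0 := by rw [X.symm, bd]
  have g05 : X.g a e5 = 0 := by simpa [tripleFrame, modelForm] using G 0 5
  have g14 : X.g b e4 = 0 := by simpa [tripleFrame, modelForm] using G 1 4
  have g24 : X.g e2 e4 = 0 := by simpa [tripleFrame, modelForm] using G 2 4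
  have g25 : X.g e2 e5 = 0 := by simpa [tripleFrame, modelForm] using G 2 5
  have g45 : X.g e4 e5 = 0 := by simpa [tripleFrame, modelForm] using G 4 5
  have g35 : X.g d e5 = 0 := by simpa [tripleFrame, modelForm] using G 3 5
  have g34 : X.g d e4 = 0 := by simpa [tripleFrame, modelForm] using G 3 4
  have g15 : X.g b e5 = 0 := by simpa [tripleFrame, modelForm] using G 1 5
  have g04 : X.g a e4 = 0 := by simpa [tripleFrame, modelForm] using G 0 4
  have g44 : X.g e4 e4 = (s : ℤ) := by simpa [tripleFrame, modelForm] using G 4 4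
  have g55 : X.g e5 e5 = (s : ℤ) := by simpa [tripleFrame, modelForm] using G 5 5
  have g53 : X.g e5 d = 0 := by rw [X.symm, g35]
  have g54 : X.g e5 e4 = 0 := by rw [X.symm, g45]
  have g51 : X.g e5 b = 0 := by rw [X.symm, g15]
  have g50 : X.g e5 a = 0 := by rw [X.symm, g05]
  have g41 : X.g e4 b = 0 := by rw [X.symm, g14]
  have g40 : X.g e4 a = 0 := by rw [X.symm, g04]
  have g43 : X.g e4 d = 0 := by rw [X.symm, g34]
  have c02 : X.c a e2 = -b := by rw [he2, X.double, ab, aa]; simp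
  have c04 : X.c a e4 = -d := by rw [he4, X.double, ad, aa]; simp
  have c06 : X.c a e6 = -e5 := by rw [he6, X.double, g05, aa]; simp
  have c12 : X.c b e2 = a := by rw [he2, X.anti a b, map_neg, X.double, ba, bb]; simp
  have c15 : X.c b e5 = -d := by rw [he5, X.double, bd, bb]; simp
  have c34 : X.c d e4 = ((s : ℤ) : ℝ) • a := by
    rw [he4, X.anti a d, map_neg, X.double, da, dd]; simp
  have c35 : X.c d e5 = ((s : ℤ) : ℝ) • b := by
    rw [he5, X.anti b d, map_neg, X.double, db, dd]; simp
  have c14 : X.c b e4 = -e6 := by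
    have := X.double_polar a b d
    rw [ad, bd, ab, ← he5, ← he4, ← he6] at this
    simp only [zero_smul, mul_zero, add_zero, sub_zero] at this
    exact eq_neg_of_add_eq_zero_right this
  have c16 : X.c b e6 = e4 := by
    have := X.double_polar a b e5
    rw [g05, g15, ab, c15, ← he6, map_neg, ← he4] at this
    simp only [zero_smul, mul_zero, add_zero, sub_zero] at this
    exact (neg_add_eq_zero.1 this).symm
  have c23 : X.c e2 d = -e6 := by
    have := X.double_polar d a b
    rw [db, ab, da, ← he2, X.anti d b, map_neg, ← he5, ← he6] at this
    simp only [zero_smul, mul_zero, add_zero, sub_zero] at this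
    rw [X.anti, add_neg_eq_zero.1 this]
  have c24 : X.c e2 e4 = -e5 := by
    have := X.double_polar e4 a b
    rw [g41, ab, g40, ← he2, X.anti e4 b, c14, neg_neg, c06] at this
    simp only [zero_smul, mul_zero, add_zero, sub_zero] at this
    rw [X.anti, add_neg_eq_zero.1 this]
  have c25 : X.c e2 e5 = e4 := by
    have := X.double_polar e5 b a
    rw [g50, ba, g51, X.anti b a, ← he2, X.anti e5 a, ← he6, map_neg, map_neg, c16] at this
    simp only [zero_smul, mul_zero, add_zero, sub_zero] at this
    rw [X.anti e5 e2, neg_neg] at this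
    exact add_neg_eq_zero.1 this
  have c26 : X.c e2 e6 = d := by
    have g60 : X.g e6 a = 0 := by simpa [tripleFrame, modelForm] using G 6 0
    have g61 : X.g e6 b = 0 := by simpa [tripleFrame, modelForm] using G 6 1
    have := X.double_polar e6 b a
    rw [g60, ba, g61, X.anti b a, ← he2, X.anti e6 a, c06, map_neg, neg_neg, c15,
      X.anti e6 e2, neg_neg] at this
    simp only [zero_smul, mul_zero, add_zero, sub_zero] at this
    exact add_neg_eq_zero.1 this
  have c36 : X.c d e6 = -(((s : ℤ) : ℝ) • e2) := by
    have := X.double_polar d a e5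
    rw [g35, g05, da, c35, ← he6, map_smul, ← he2] at this
    simp only [zero_smul, mul_zero, add_zero, sub_zero] at this
    exact eq_neg_of_add_eq_zero_left this
  have c45 : X.c e4 e5 = -(((s : ℤ) : ℝ) • e2) := by
    have := X.double_polar e4 b d
    rw [g43, bd, g41, ← he5, X.anti e4 d, c34, map_neg, map_smul, X.anti b a, ← he2] at this
    simp only [zero_smul, mul_zero, add_zero, sub_zero, smul_neg, neg_neg] at this
    exact eq_neg_of_add_eq_zero_left this
  have c46 : X.c e4 e6 = -(((s : ℤ) : ℝ) • b) := by
    have := X.double_polar e4 a e5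
    rw [g45, g05, g40, ← he6, c45, map_neg, map_smul, c02] at this
    simp only [zero_smul, mul_zero, add_zero, sub_zero, smul_neg, neg_neg] at this
    exact eq_neg_of_add_eq_zero_left this
  have c56 : X.c e5 e6 = ((s : ℤ) : ℝ) • a := by
    rw [he6, X.anti a e5, map_neg, X.double, g50, g55]; simp
  -- The table is completed by the products in reversed order.
  have r1 := X.anti b a
  have r2 := X.anti e2 a
  have r3 := X.anti d a
  have r4 := X.anti e4 a
  have r5 := X.anti e5 a
  have r6 := X.anti e6 a
  have r7 := X.anti e2 b
  have r8 := X.anti d b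
  have r9 := X.anti e4 b
  have r10 := X.anti e5 b
  have r11 := X.anti e6 b
  have r12 := X.anti d e2
  have r13 := X.anti e4 e2
  have r14 := X.anti e5 e2
  have r15 := X.anti e6 e2
  have r16 := X.anti e4 d
  have r17 := X.anti e5 d
  have r18 := X.anti e6 d
  have r19 := X.anti e5 e4
  have r20 := X.anti e6 e4
  have r21 := X.anti e6 e5
  rw [← he2] at r1
  rw [c02] at r2
  rw [← he4] at r3
  rw [c04] at r4
  rw [← he6] at r5
  rw [c06] at r6
  rw [c12] at r7
  rw [← he5] at r8
  rw [c14] at r9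
  rw [c15] at r10
  rw [c16] at r11
  rw [c23] at r12
  rw [c24] at r13
  rw [c25] at r14
  rw [c26] at r15
  rw [c34] at r16
  rw [c35] at r17
  rw [c36] at r18
  rw [c45] at r19
  rw [c46] at r20
  rw [c56] at r21
  simp only [Fin.sum_univ_seven, tripleFrame, map_add, map_smul, LinearMap.add_apply,
    LinearMap.smul_apply, Matrix.cons_val, X.self, modelMul, ← he2, ← he4, ← he5, ← he6, c02, c04,
    c06, c12, c14, c15, c16, c23, c24, c25, c26, c34, c35, c36, c45, c46, c56, r1, r2, r3, r4, r5,
    r6, r7, r8, r9, r10, r11, r12, r13, r14, r15, r16, r17, r18, r19, r20, r21]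
  module

/-- The frame generated by a triple, as a linear equivalence. -/
theorem IsTriple.exists_equiv (h : X.IsTriple s a b d) (hW : Module.finrank ℝ W = 7) :
    ∃ u : V7 ≃ₗ[ℝ] W, (∀ x, u x = ∑ i, x i • X.tripleFrame a b d i) ∧
      (∀ x y, X.g (u x) (u y) = (model s).g x y) ∧ (∀ x y, X.c (u x) (u y) = u ((model s).c x y)) := by
  have : FiniteDimensional ℝ W := Module.finite_of_finrank_pos (by omega)
  let f : V7 →ₗ[ℝ] W := Fintype.linearCombination ℝ (X.tripleFrame a b d)
  have hf : ∀ x, f x = ∑ i, x i • X.tripleFrame a b d i := fun x => rfl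
  have inj : Function.Injective f := by
    rw [← LinearMap.ker_eq_bot, LinearMap.ker_eq_bot']
    intro x hx
    refine model_nondegenerate s x fun y => ?_
    rw [model_g, ← h.map_g, ← hf, hx, map_zero, LinearMap.zero_apply]
  refine ⟨LinearEquiv.ofInjectiveOfFinrankEq f inj (by simp [hW]), hf, h.map_g, h.map_c⟩

variable (X) in
/-- A nondegenerate symmetric form has a non-isotropic vector orthogonal to a given orthogonal
family of fewer non-isotropic vectors than the dimension. -/
theorem exists_nonisotropic [FiniteDimensional ℝ W] (hX : ∀ w, (∀ w', X.g w w' = 0) → w = 0)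
    {ι : Type*} [Fintype ι] (e : ι → W) (he : ∀ i, X.g (e i) (e i) ≠ 0)
    (he' : ∀ i j, i ≠ j → X.g (e i) (e j) = 0) (hι : Fintype.card ι < Module.finrank ℝ W) :
    ∃ x, (∀ i, X.g (e i) x = 0) ∧ X.g x x ≠ 0 := by
  classical
  by_contra! hc
  -- If every vector of the complement is isotropic, polarization makes g vanish on the complement.
  -- A complement vector is then orthogonal also to all of W, since any w differs from its
  -- projection to the family by a complement vector. So the complement is 0, and the pairings with
  -- the family embed W in a space of too small dimension.
  have hc2 : ∀ x y, (∀ i, X.g (e i) x = 0) → (∀ i, X.g (e i) y = 0) → X.g x y = 0 := by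
    intro x y hx hy
    have h := hc (x + y) fun i => by rw [map_add, hx, hy, add_zero]
    simp only [map_add, LinearMap.add_apply, hc x hx, hc y hy, X.symm y x] at h
    linarith
  let F : W →ₗ[ℝ] (ι → ℝ) := LinearMap.pi fun i => X.g (e i)
  have hF : Function.Injective F := by
    rw [← LinearMap.ker_eq_bot, LinearMap.ker_eq_bot']
    intro x hx
    have hx' : ∀ i, X.g (e i) x = 0 := fun i => congrFun hx i
    refine hX x fun w => ?_
    have h1 : ∀ i, X.g (e i) (w - ∑ j, (X.g (e j) w / X.g (e j) (e j)) • e j) = 0 := by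
      intro i
      rw [map_sub, map_sum, Finset.sum_eq_single i]
      · rw [map_smul, smul_eq_mul, div_mul_cancel₀ _ (he i), sub_self]
      · intro j _ hj
        rw [map_smul, he' i j hj.symm, smul_zero]
      · simp
    have h2 := hc2 x _ hx' h1
    rw [map_sub, map_sum, Finset.sum_eq_zero, sub_zero] at h2
    · exact h2
    · intro j _
      rw [map_smul, X.symm x (e j), hx', smul_zero]
  have := LinearMap.finrank_le_finrank_of_injective hF
  simp at this
  omega

/-- A linear equivalence preserving trilinear forms preserves orthogonality and ratios of square
lengths of orthogonal non-isotropic vectors. -/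
theorem conformal_of_form {V : Type*} [AddCommGroup V] [Module ℝ V] (X : CrossProduct ℝ V)
    (Y : CrossProduct ℝ W) (hY : ∀ w, (∀ w', Y.g w w' = 0) → w = 0) (f : V ≃ₗ[ℝ] W)
    (hf : ∀ x y z, Y.form (f x) (f y) (f z) = X.form x y z) {a b y : V} (hab : X.g a b = 0)
    (ha : X.g a a ≠ 0) (hb : X.g b b ≠ 0) (hay : X.g a y = 0) (hby : X.g b y = 0)
    (hcy : X.g (X.c a b) y = 0) (hy : X.g y y ≠ 0) :
    Y.g (f a) (f b) = 0 ∧ X.g a a * Y.g (f b) (f b) = X.g b b * Y.g (f a) (f a) := by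
  -- With y outside the subspace spanned by a, b and c(a, b), this vector satisfies c(b, y') = -g(b,
  -- b) c(a, y) and c(a, y') = g(a, a) c(b, y). These relations involve the metric of X through
  -- scalars only.
  set y' := X.c b (X.c a y) with hy'
  have hba : X.g b a = 0 := by rw [X.symm, hab]
  have hya : X.g y a = 0 := by rw [X.symm, hay]
  have hyb : X.g y b = 0 := by rw [X.symm, hby]
  have hacy : X.g a (X.c a y) = 0 := by rw [X.symm, X.g_c_left]
  have hbcy : X.g b (X.c a y) = 0 := by
    rw [X.symm, X.skew, X.symm, hcy, neg_zero]
  have hcyb : X.g (X.c a y) b = 0 := by rw [X.symm, hbcy]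
  have R1 : X.c b y' = -(X.g b b • X.c a y) := by rw [hy', X.double, hbcy]; simp
  have R2 : X.c a y' = X.g a a • X.c b y := by
    have := X.double_polar a b (X.c a y)
    rw [hacy, hbcy, hab, X.double, hay] at this
    simp only [zero_smul, mul_zero, zero_add, sub_zero, zero_sub, map_neg, map_smul] at this
    exact add_neg_eq_zero.1 this
  -- A proportionality of two products can be tested by trilinear forms, because Y is nondegenerate;
  -- hence f carries it over although f is not yet known to preserve products.
  have trans : ∀ (x₁ x₂ x₃ x₄ : V) (r : ℝ), X.c x₁ x₂ = r • X.c x₃ x₄ →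
      Y.c (f x₁) (f x₂) = r • Y.c (f x₃) (f x₄) := by
    intro x₁ x₂ x₃ x₄ r h
    rw [← sub_eq_zero]
    refine hY _ fun w => ?_
    obtain ⟨z, rfl⟩ := f.surjective w
    have h1 := hf x₁ x₂ z
    have h2 := hf x₃ x₄ z
    simp only [form] at h1 h2
    rw [map_sub, map_smul, LinearMap.sub_apply, LinearMap.smul_apply, h1, h2, h]
    simp
  have R1' := trans b y' a y (-X.g b b) (by rw [R1, neg_smul])
  have R2' := trans a y' b y (X.g a a) R2
  -- Evaluating both iterated products by the transported relations leaves a linear relation among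
  -- y, y', a, b whose coefficients contain the unknown metric of Y. Pairing it with y' and with y
  -- isolates the two claims.
  have key := Y.double_polar (f a) (f b) (f y')
  rw [R1', R2', map_smul, map_smul, Y.double, Y.double] at key
  have key2 : f ((X.g b b * Y.g (f a) (f a) - X.g a a * Y.g (f b) (f b)) • y
      + (2 * Y.g (f a) (f b)) • y'
      + (-X.g b b * Y.g (f a) (f y) - Y.g (f b) (f y')) • a
      + (X.g a a * Y.g (f b) (f y) - Y.g (f a) (f y')) • b) = 0 := by
    simp only [map_add, map_smul]
    rw [← sub_eq_zero] at key
    rw [← key]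
    module
  have key3 := f.map_eq_zero_iff.1 key2
  have gyy' : X.g y y' = 0 := by
    rw [X.symm, hy', X.skew, X.anti a y, map_neg, X.anti b y, map_neg, LinearMap.neg_apply,
      X.g_c_c, hab, hya]
    simp
  have gy'a : X.g a y' = 0 := by
    rw [X.symm, hy', X.skew, X.anti b a, map_neg, neg_neg, X.g_c_c, hab, hay, hyb]; simp
  have gy'b : X.g b y' = 0 := by rw [X.symm, hy', X.g_c_left]
  have gy'y' : X.g y' y' = X.g b b * (X.g a a * X.g y y) := by
    rw [hy', X.g_c_c, X.g_c_c, hay, hbcy]; ring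
  have gy'y : X.g y' y = 0 := by rw [X.symm, gyy']
  constructor
  · have h := congrArg (X.g y') key3
    simp only [map_add, map_smul, gy'y, X.symm y' a, X.symm y' b, gy'a, gy'b, mul_zero, zero_add,
      add_zero, map_zero, smul_eq_mul, gy'y'] at h
    simpa [ha, hb, hy] using h
  · have h := congrArg (X.g y) key3
    simp only [map_add, map_smul, gyy', hya, hyb, mul_zero,
      add_zero, map_zero, smul_eq_mul] at h
    have := (mul_eq_zero.1 h).resolve_right hy
    linarith

/-- The trilinear form of a cross product determines its metric. -/
theorem g_eq_of_form (s : ℤˣ) (Y : CrossProduct ℝ W) (hY : ∀ w, (∀ w', Y.g w w' = 0) → w = 0)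
    (f : V7 ≃ₗ[ℝ] W) (hf : ∀ x y z, Y.form (f x) (f y) (f z) = (model s).form x y z) (x y : V7) :
    Y.g (f x) (f y) = (model s).g x y := by
  set e : Fin 7 → V7 := fun i => Pi.single i 1 with he
  have gij : ∀ i j, (model s).g (e i) (e j) = if i = j then diagSign s i else 0 := fun i j => by
    change (model s).g (Pi.single i 1) (Pi.single j 1) = _
    rw [model_g_single, Pi.single_apply]
    split_ifs with h1 h2 h2
    · rw [h1, mul_one]
    · exact absurd h1.symm h2
    · exact absurd h2.symm h1
    · rw [mul_zero]
  have gne : ∀ i, (model s).g (e i) (e i) ≠ 0 := fun i => by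
    rw [gij, if_pos rfl]; exact diagSign_ne_zero s i
  have pair : ∀ i j, i ≠ j → Y.g (f (e i)) (f (e j)) = 0 ∧
      diagSign s i * Y.g (f (e j)) (f (e j)) = diagSign s j * Y.g (f (e i)) (f (e i)) := by
    intro i j hij
    have h0 : (model s).g (e i) (e j) = 0 := by rw [gij, if_neg hij]
    have h0' : (model s).g (e j) (e i) = 0 := by rw [gij, if_neg hij.symm]
    set k := (model s).c (e i) (e j) with hk
    have h1 : (model s).g (e i) k = 0 := by rw [(model s).symm, hk, (model s).g_c_left]
    have h1' : (model s).g k (e i) = 0 := by rw [hk, (model s).g_c_left]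
    have h2 : (model s).g (e j) k = 0 := by rw [(model s).symm, hk, (model s).g_c_right]
    have h2' : (model s).g k (e j) = 0 := by rw [hk, (model s).g_c_right]
    have h3 : (model s).g k k ≠ 0 := by
      rw [hk, (model s).g_c_c, h0, zero_mul, sub_zero]
      exact mul_ne_zero (gne i) (gne j)
    -- The auxiliary fourth direction exists because 3 < 7.
    obtain ⟨y, hy, hyy⟩ := (model s).exists_nonisotropic (model_nondegenerate s) ![e i, e j, k]
      (fun l => by fin_cases l <;> simp [gne, h3])
      (fun l m hlm => by fin_cases l <;> fin_cases m <;> simp_all) (by simp)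
    have := conformal_of_form (model s) Y hY f hf h0 (gne i) (gne j) (hy 0) (hy 1) (hy 2) hyy
    rw [gij, gij, if_pos rfl, if_pos rfl] at this
    exact this
  set l := Y.g (f (e 0)) (f (e 0)) with hl
  have conf : ∀ x y, Y.g (f x) (f y) = l * (model s).g x y := by
    have : Y.g.compl₁₂ f.toLinearMap f.toLinearMap = l • (model s).g := by
      refine LinearMap.ext_basis (Pi.basisFun ℝ (Fin 7)) (Pi.basisFun ℝ (Fin 7)) fun i j => ?_
      simp only [Pi.basisFun_apply, LinearMap.compl₁₂_apply, LinearEquiv.coe_coe,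
        LinearMap.smul_apply, smul_eq_mul]
      change Y.g (f (e i)) (f (e j)) = l * (model s).g (e i) (e j)
      rw [gij]
      split_ifs with hij
      · subst hij
        by_cases h0 : i = 0
        · subst h0; simp [hl, diagSign]
        · have := (pair 0 i (Ne.symm h0)).2
          rw [show diagSign s 0 = 1 from rfl, one_mul] at this
          rw [this, mul_comm]
      · rw [(pair i j hij).1, mul_zero]
    intro x y
    exact LinearMap.congr_fun (LinearMap.congr_fun this x) y
  have hc : ∀ x y, f ((model s).c x y) = l • Y.c (f x) (f y) := by
    intro x y
    rw [← sub_eq_zero]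
    refine hY _ fun w => ?_
    obtain ⟨z, rfl⟩ := f.surjective w
    have := hf x y z
    simp only [form] at this
    rw [map_sub, LinearMap.sub_apply, map_smul, LinearMap.smul_apply, conf, this, smul_eq_mul,
      sub_self]
  have h01 : (model s).g (e 0) (e 1) = 0 := by rw [gij]; rfl
  have h00 : (model s).g (e 0) (e 0) = 1 := by rw [gij]; rfl
  have h11 : (model s).g (e 1) (e 1) = 1 := by rw [gij]; rfl
  -- Multiplying twice by the unit vector e₀ gives -e₁ in the model. On the other side each product
  -- contributes a factor l, and so does the length of f(e₀); hence l³ = 1, and l = 1 since l is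
  -- real.
  have h := hc (e 0) ((model s).c (e 0) (e 1))
  rw [(model s).double, hc (e 0) (e 1), map_smul, Y.double, conf, conf, h01, h00] at h
  have h' := congrArg (fun v => Y.g v (f (e 1))) h
  simp only [zero_smul, one_smul, zero_sub, mul_zero, mul_one, map_neg, LinearMap.neg_apply, map_smul,
    LinearMap.smul_apply, smul_eq_mul, conf, h11] at h'
  have l0 : l ≠ 0 := by
    intro h0
    refine (fun h => gne 0 (h (e 0)) : ¬ ∀ y, (model s).g (e 0) y = 0) fun y => ?_
    have : f (e 0) = 0 := hY _ fun w => by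
      obtain ⟨z, rfl⟩ := f.surjective w
      rw [conf, h0, zero_mul]
    rw [f.map_eq_zero_iff.1 this, map_zero, LinearMap.zero_apply]
  have l3 : l ^ 3 = 1 := mul_right_cancel₀ l0 (by linear_combination h')
  have l1 : l = 1 := by
    have : (l - 1) * (l ^ 2 + l + 1) = 0 := by linear_combination l3
    rcases mul_eq_zero.1 this with h | h
    · linarith
    · nlinarith [sq_nonneg (2 * l + 1)]
  rw [conf, l1, one_mul]

end Real

end CrossProduct

end OctG2

namespace OctG2

/-! ## Openness of the orbit of `σ₀` -/

/-- A right inverse of the derivative at the identity of the orbit map of `σ₀`. The argument is the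
family of coefficients of a three-form on increasing triples of indices. -/
def orbitInverse (h : Fin 7 → Fin 7 → Fin 7 → ℝ) : Fin 7 → V7 :=
  ![![(2 * h 0 1 2 - 2 * h 0 3 4 - 2 * h 0 5 6 + h 1 3 5 - h 1 4 6 - h 2 3 6 - h 2 4 5) / 6,
      (-h 0 3 5 + h 0 4 6 - h 1 3 4 - h 1 5 6) / 2,
      (h 0 3 6 + h 0 4 5 - h 2 3 4 - h 2 5 6) / 2,
      (h 0 1 5 - h 0 2 6 - h 1 2 3 + h 3 5 6) / 2,
      (-h 0 1 6 - h 0 2 5 - h 1 2 4 + h 4 5 6) / 2,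
      (-h 0 1 3 + h 0 2 4 - h 1 2 5 + h 3 4 5) / 2,
      (h 0 1 4 + h 0 2 3 - h 1 2 6 + h 3 4 6) / 2],
    ![0,
      (2 * h 0 1 2 + h 0 3 4 + h 0 5 6 - 2 * h 1 3 5 + 2 * h 1 4 6 - h 2 3 6 - h 2 4 5) / 6,
      (h 1 3 6 + h 1 4 5 - h 2 3 5 + h 2 4 6) / 2,
      (-h 0 1 4 + h 0 2 3 - h 1 2 6) / 2,
      (h 0 1 3 + h 0 2 4 - h 1 2 5) / 2,
      (-h 0 1 6 + h 0 2 5 + h 1 2 4) / 2,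
      (h 0 1 5 + h 0 2 6 + h 1 2 3) / 2],
    ![0,
      0,
      (2 * h 0 1 2 + h 0 3 4 + h 0 5 6 + h 1 3 5 - h 1 4 6 + 2 * h 2 3 6 + 2 * h 2 4 5) / 6,
      (-h 0 1 3 - h 0 2 4 - h 1 2 5) / 2,
      (-h 0 1 4 + h 0 2 3 + h 1 2 6) / 2,
      (-h 0 1 5 - h 0 2 6 + h 1 2 3) / 2,
      (-h 0 1 6 + h 0 2 5 - h 1 2 4) / 2],
    ![0,
      (h 3 4 6) / 2,
      (h 3 4 5) / 2,
      (-h 0 1 2 - 2 * h 0 3 4 + h 0 5 6 - 2 * h 1 3 5 - h 1 4 6 + 2 * h 2 3 6 - h 2 4 5) / 6,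
      (h 1 3 6 - h 1 4 5 + h 2 3 5) / 2,
      (-h 0 3 6 + h 0 4 5 - h 2 3 4) / 2,
      (h 0 3 5 + h 0 4 6 - h 1 3 4) / 2],
    ![0,
      (h 3 4 5) / 2,
      (-h 3 4 6) / 2,
      (h 2 4 6) / 2,
      (-h 0 1 2 - 2 * h 0 3 4 + h 0 5 6 + h 1 3 5 + 2 * h 1 4 6 - h 2 3 6 + 2 * h 2 4 5) / 6,
      (-h 0 3 5 - h 0 4 6 - h 1 3 4) / 2,
      (-h 0 3 6 + h 0 4 5 + h 2 3 4) / 2],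
    ![0,
      (-h 4 5 6) / 2,
      (-h 3 5 6) / 2,
      (h 2 5 6) / 2,
      (h 1 5 6) / 2,
      (-h 0 1 2 + h 0 3 4 - 2 * h 0 5 6 - 2 * h 1 3 5 - h 1 4 6 - h 2 3 6 + 2 * h 2 4 5) / 6,
      (-h 1 3 6 + h 1 4 5 + h 2 3 5) / 2],
    ![0,
      (-h 3 5 6) / 2,
      (h 4 5 6) / 2,
      (h 1 5 6) / 2,
      (-h 2 5 6) / 2,
      (h 2 4 6) / 2,
      (-h 0 1 2 + h 0 3 4 - 2 * h 0 5 6 + h 1 3 5 + 2 * h 1 4 6 + 2 * h 2 3 6 - h 2 4 5) / 6]]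

set_option maxHeartbeats 1000000 in
theorem orbitInverse_smul (t : ℝ) (h : Fin 7 → Fin 7 → Fin 7 → ℝ) :
    orbitInverse (t • h) = t • orbitInverse h := by
  funext i j
  fin_cases i <;> fin_cases j <;> simp [orbitInverse] <;> ring

theorem contDiff_orbitInverse (i j : Fin 7) : ContDiff ℝ ∞ fun h => orbitInverse h i j := by
  fin_cases i <;> fin_cases j <;> simp [orbitInverse] <;> fun_prop

/-- The orbit map of `σ₀`, completed by the identity on the redundant coefficients. -/
def orbitMap (h : Fin 7 → Fin 7 → Fin 7 → ℝ) : Fin 7 → Fin 7 → Fin 7 → ℝ := fun i j k =>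
  if i < j ∧ j < k then (model (-1)).form (Pi.single i 1 + orbitInverse h i)
    (Pi.single j 1 + orbitInverse h j) (Pi.single k 1 + orbitInverse h k) else h i j k

theorem contDiff_orbitMap : ContDiff ℝ ∞ orbitMap := by
  refine contDiff_pi.2 fun i => contDiff_pi.2 fun j => contDiff_pi.2 fun k => ?_
  by_cases hl : i < j ∧ j < k
  · have := contDiff_orbitInverse
    simp only [orbitMap, if_pos hl, CrossProduct.form, model_g, model_c, modelForm, modelMul,
      Pi.add_apply, Matrix.cons_val]
    fun_prop
  · simp only [orbitMap, if_neg hl]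
    fun_prop

/-- The infinitesimal action on σ₀ reaches every three-form, consistently with 49 - 14 = 35; this is
checked on each of the 35 increasing triples of indices and is the reason why the orbit is open. -/
theorem orbitInverse_spec (h : Fin 7 → Fin 7 → Fin 7 → ℝ) {i j k : Fin 7} (hij : i < j)
    (hjk : j < k) :
    (model (-1)).form (orbitInverse h i) (Pi.single j 1) (Pi.single k 1)
      + (model (-1)).form (Pi.single i 1) (orbitInverse h j) (Pi.single k 1)
      + (model (-1)).form (Pi.single i 1) (Pi.single j 1) (orbitInverse h k) = h i j k := by
  simp only [CrossProduct.form, model_g, model_c, modelForm, modelMul]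
  fin_cases i <;> fin_cases j <;>
    first
    | exact absurd hij (by decide)
    | (fin_cases k <;>
        first
        | exact absurd hjk (by decide)
        | (simp [orbitInverse] <;> ring))

theorem CrossProduct.form_line {R V : Type*} [CommRing R] [AddCommGroup V] [Module R V]
    (X : CrossProduct R V) (x y z x' y' z' : V) (t : R) :
    X.form (x + t • x') (y + t • y') (z + t • z') =
      X.form x y z + t * (X.form x' y z + X.form x y' z + X.form x y z')
      + t ^ 2 * (X.form x' y' z + X.form x y' z' + X.form x' y z' + t * X.form x' y' z') := by
  simp only [CrossProduct.form, map_add, map_smul, LinearMap.add_apply, LinearMap.smul_apply,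
    smul_eq_mul]
  ring

theorem CrossProduct.hasDerivAt_form {V : Type*} [AddCommGroup V] [Module ℝ V]
    (X : CrossProduct ℝ V) (x y z x' y' z' : V) : HasDerivAt
      (fun t : ℝ => X.form (x + t • x') (y + t • y') (z + t • z'))
      (X.form x' y z + X.form x y' z + X.form x y z') 0 := by
  simp only [X.form_line]
  have h1 : HasDerivAt (fun t : ℝ => t * (X.form x' y z + X.form x y' z + X.form x y z'))
      (1 * (X.form x' y z + X.form x y' z + X.form x y z')) 0 :=
    (hasDerivAt_id' (0 : ℝ)).mul_const _
  have h2 : HasDerivAt (fun t : ℝ => X.form x' y' z + X.form x y' z' + X.form x' y z'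
      + t * X.form x' y' z') (1 * X.form x' y' z') 0 :=
    ((hasDerivAt_id' (0 : ℝ)).mul_const _).const_add _
  have h3 := (h1.const_add (X.form x y z)).add ((hasDerivAt_pow 2 (0 : ℝ)).mul h2)
  exact h3.congr_deriv (by simp)

theorem hasDerivAt_orbitMap (h : Fin 7 → Fin 7 → Fin 7 → ℝ) :
    HasDerivAt (fun t : ℝ => orbitMap (t • h)) h 0 := by
  refine hasDerivAt_pi.2 fun i => hasDerivAt_pi.2 fun j => hasDerivAt_pi.2 fun k => ?_
  by_cases hl : i < j ∧ j < k
  · simp only [orbitMap, if_pos hl, orbitInverse_smul, Pi.smul_apply]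
    rw [← orbitInverse_spec h hl.1 hl.2]
    exact (model (-1)).hasDerivAt_form _ _ _ _ _ _
  · simp only [orbitMap, if_neg hl, Pi.smul_apply, smul_eq_mul]
    simpa using (hasDerivAt_id' (0 : ℝ)).mul_const (h i j k)

/-- The map is smooth, so its derivative at 0 is determined by the derivatives along lines through
0, and these are the identity by the choice of `orbitInverse`. The inverse function theorem becomes
applicable. -/
theorem hasStrictFDerivAt_orbitMap : HasStrictFDerivAt orbitMap
    (ContinuousLinearEquiv.refl ℝ (Fin 7 → Fin 7 → Fin 7 → ℝ) :
      (Fin 7 → Fin 7 → Fin 7 → ℝ) →L[ℝ] (Fin 7 → Fin 7 → Fin 7 → ℝ)) 0 := by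
  have h1 : HasStrictFDerivAt orbitMap (fderiv ℝ orbitMap 0) 0 :=
    contDiff_orbitMap.contDiffAt.hasStrictFDerivAt (by simp)
  convert h1 using 1
  ext1 h
  have h2 : HasDerivAt (fun t : ℝ => t • h) h 0 := by
    simpa using (hasDerivAt_id' (0 : ℝ)).smul_const h
  have h3 : HasFDerivAt orbitMap (fderiv ℝ orbitMap 0) ((0 : ℝ) • h) := by
    rw [zero_smul]; exact h1.hasFDerivAt
  have h4 := h3.comp_hasDerivAt (0 : ℝ) h2
  exact (h4.unique (hasDerivAt_orbitMap h)).symm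

/-- Three-forms close to `σ₀` are carried to `σ₀` by a smoothly varying frame. -/
theorem exists_smooth_frame_of_form : ∃ X : (Fin 7 → Fin 7 → Fin 7 → ℝ) → Fin 7 → V7,
    ContDiffAt ℝ ∞ X (orbitMap 0) ∧ X (orbitMap 0) = (fun i => Pi.single i 1) ∧
    ∀ᶠ h in 𝓝 (orbitMap 0), ∀ i j k, i < j → j < k →
      (model (-1)).form (X h i) (X h j) (X h k) = h i j k := by
  have hd := hasStrictFDerivAt_orbitMap
  have hinv : ContDiffAt ℝ ∞ (hd.localInverse orbitMap _ 0) (orbitMap 0) :=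
    contDiff_orbitMap.contDiffAt.to_localInverse hd.hasFDerivAt (by simp)
  have h0 : orbitInverse 0 = 0 := by simpa using orbitInverse_smul 0 0
  have hI : ContDiff ℝ ∞ orbitInverse :=
    contDiff_pi.2 fun i => contDiff_pi.2 fun j => contDiff_orbitInverse i j
  refine ⟨fun h i => Pi.single i 1 + orbitInverse (hd.localInverse orbitMap _ 0 h) i, ?_, ?_, ?_⟩
  · refine contDiffAt_pi.2 fun i => contDiffAt_const.add ?_
    exact contDiffAt_pi.1 (hI.contDiffAt.comp _ hinv) i
  · funext i
    have := hd.localInverse_apply_image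
    simp only [this, h0, Pi.zero_apply, add_zero]
  · filter_upwards [hd.eventually_right_inverse] with h hh i j k hij hjk
    have := congrFun (congrFun (congrFun hh i) j) k
    simpa only [orbitMap, if_pos (And.intro hij hjk)] using this

end OctG2

namespace OctG2

/-! ## Smoothness of solutions of linear systems and of frame coefficients -/

section LinearSystem

variable {n : ℕ} {M : Type u} [TopologicalSpace M] [ChartedSpace (EuclideanSpace ℝ (Fin n)) M]

/-- The solution of a linear system with smooth coefficients is smooth where the system is
nonsingular. -/
theorem contMDiffAt_of_linear_system {p : M} {A : M → Fin 7 → V7} {b x : M → V7}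
    (hA : ∀ i, ContMDiffAt (𝓡 n) 𝓘(ℝ, V7) ∞ (fun q => A q i) p)
    (hb : ContMDiffAt (𝓡 n) 𝓘(ℝ, V7) ∞ b p) (hp : LinearIndependent ℝ (A p))
    (hx : ∀ᶠ q in 𝓝 p, ∑ i, x q i • A q i = b q) : ContMDiffAt (𝓡 n) 𝓘(ℝ, V7) ∞ x p := by
  let L : (Fin 7 → V7) →ₗ[ℝ] (V7 →L[ℝ] V7) :=
    (LinearMap.toContinuousLinearMap (𝕜 := ℝ) (E := V7) (F' := V7)).toLinearMap.comp
      (Fintype.bilinearCombination ℝ ℝ)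
  have hL : ∀ a x, L a x = ∑ i, x i • a i := fun a x => rfl
  have hAs : ContMDiffAt (𝓡 n) 𝓘(ℝ, V7 →L[ℝ] V7) ∞ (fun q => L (A q)) p := by
    have h1 : ContMDiffAt (𝓡 n) 𝓘(ℝ, Fin 7 → V7) ∞ A p := contMDiffAt_pi_space.2 hA
    exact (LinearMap.toContinuousLinearMap L).contDiff.contMDiff.contMDiffAt.comp p h1
  have hinj : Function.Injective (L (A p)) :=
    LinearMap.ker_eq_bot.1 (LinearMap.ker_eq_bot'.2 fun x hx =>
      funext fun i => Fintype.linearIndependent_iff.1 hp x hx i)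
  let e : V7 ≃L[ℝ] V7 :=
    (LinearEquiv.ofInjectiveEndo (L (A p)).toLinearMap hinj).toContinuousLinearEquiv
  have he : (e : V7 →L[ℝ] V7) = L (A p) := by ext x; rfl
  have hinv : ContMDiffAt (𝓡 n) 𝓘(ℝ, V7 →L[ℝ] V7) ∞
      (fun q => ContinuousLinearMap.inverse (L (A q))) p := by
    have h2 : ContDiffAt ℝ ∞ ContinuousLinearMap.inverse (L (A p)) := by
      rw [← he]; exact contDiffAt_map_inverse e
    exact h2.contMDiffAt.comp p hAs
  refine (hinv.clm_apply hb).congr_of_eventuallyEq ?_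
  -- `ContinuousLinearMap.inverse` has a default value off the invertible maps; these form an open
  -- set, so near p it is the true inverse.
  have hunit : ∀ᶠ q in 𝓝 p, ∃ f : V7 ≃L[ℝ] V7, (f : V7 →L[ℝ] V7) = L (A q) := by
    have h3 : Set.range ((↑) : (V7 ≃L[ℝ] V7) → V7 →L[ℝ] V7) ∈ 𝓝 (L (A p)) := by
      rw [← he]; exact e.nhds
    exact hAs.continuousAt.eventually_mem h3
  filter_upwards [hx, hunit] with q hq hf
  obtain ⟨f, hf⟩ := hf
  rw [← hq, ← hL, ← hf, ContinuousLinearMap.inverse_equiv]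
  simp

end LinearSystem

namespace RankSevenBundle

variable {n : ℕ} {M : Type u} [TopologicalSpace M] [ChartedSpace (EuclideanSpace ℝ (Fin n)) M]
  (E : RankSevenBundle n M)

/-- The preferred trivialization at a point. -/
abbrev triv (p : M) : Trivialization V7 (Bundle.TotalSpace.proj : TotalSpace V7 E.fib → M) :=
  trivializationAt V7 E.fib p

theorem mem_triv (p : M) : p ∈ (E.triv p).baseSet := mem_baseSet_trivializationAt V7 E.fib p

/-- Smoothness at a point of a (not necessarily smooth) section. -/
abbrev SmoothAt (s : ∀ q, E.fib q) (p : M) : Prop :=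
  ContMDiffAt (𝓡 n) ((𝓡 n).prod 𝓘(ℝ, V7)) ∞ (fun q => (⟨q, s q⟩ : TotalSpace V7 E.fib)) p

variable {E}

theorem smoothAt_iff {s : ∀ q, E.fib q} {p : M} :
    E.SmoothAt s p ↔ ContMDiffAt (𝓡 n) 𝓘(ℝ, V7) ∞ (fun q => (E.triv p ⟨q, s q⟩).2) p :=
  contMDiffAt_section p

theorem triv_apply {p q : M} (hq : q ∈ (E.triv p).baseSet) (v : E.fib q) :
    (E.triv p ⟨q, v⟩).2 = (E.triv p).linearEquivAt ℝ q hq v := rfl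

theorem SmoothAt.sum_smul {ι : Type*} [Fintype ι] {p : M} {s : ι → ∀ q, E.fib q}
    {a : ι → M → ℝ} (hs : ∀ i, E.SmoothAt (s i) p)
    (ha : ∀ i, ContMDiffAt (𝓡 n) 𝓘(ℝ, ℝ) ∞ (a i) p) :
    E.SmoothAt (fun q => ∑ i, a i q • s i q) p :=
  ContMDiffAt.sum_section fun i _ => (ha i).smul_section (hs i)

/-- The coefficients of a smooth section in a smooth frame are smooth. -/
theorem smoothAt_coeff {p : M} {t : Fin 7 → ∀ q, E.fib q} (ht : ∀ i, E.SmoothAt (t i) p)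
    (hp : LinearIndependent ℝ fun i => t i p) {s : ∀ q, E.fib q} (hs : E.SmoothAt s p)
    {x : M → V7} (hx : ∀ᶠ q in 𝓝 p, ∑ i, x q i • t i q = s q) :
    ContMDiffAt (𝓡 n) 𝓘(ℝ, V7) ∞ x p := by
  refine contMDiffAt_of_linear_system (A := fun q i => (E.triv p ⟨q, t i q⟩).2)
    (b := fun q => (E.triv p ⟨q, s q⟩).2) (fun i => smoothAt_iff.1 (ht i)) (smoothAt_iff.1 hs) ?_ ?_
  · exact hp.map' ((E.triv p).linearEquivAt ℝ p (E.mem_triv p)).toLinearMap (LinearEquiv.ker _)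
  · filter_upwards [hx, (E.triv p).open_baseSet.mem_nhds (E.mem_triv p)] with q hq hq'
    simp only [triv_apply hq']
    rw [← hq]
    simp

theorem SmoothAt.congr {p : M} {s t : ∀ q, E.fib q} (hs : E.SmoothAt s p)
    (h : ∀ᶠ q in 𝓝 p, t q = s q) : E.SmoothAt t p := by
  refine ContMDiffAt.congr_of_eventuallyEq hs ?_
  filter_upwards [h] with q hq
  rw [hq]

variable (E) in
/-- The local frame of the preferred trivialization at `p`. -/
def trivFrame (p : M) (i : Fin 7) (q : M) : E.fib q := (E.triv p).symm q (Pi.single i 1)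

theorem trivFrame_eq {p q : M} (hq : q ∈ (E.triv p).baseSet) (i : Fin 7) :
    E.trivFrame p i q = ((E.triv p).linearEquivAt ℝ q hq).symm (Pi.single i 1) := rfl

theorem smoothAt_trivFrame (p : M) (i : Fin 7) : E.SmoothAt (E.trivFrame p i) p := by
  rw [smoothAt_iff]
  refine (contMDiffAt_const (c := (Pi.single i 1 : V7))).congr_of_eventuallyEq ?_
  filter_upwards [(E.triv p).open_baseSet.mem_nhds (E.mem_triv p)] with q hq
  rw [triv_apply hq, trivFrame_eq hq, LinearEquiv.apply_symm_apply]

theorem linearIndependent_trivFrame {p q : M} (hq : q ∈ (E.triv p).baseSet) :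
    LinearIndependent ℝ fun i => E.trivFrame p i q := by
  have := (Pi.basisFun ℝ (Fin 7)).linearIndependent.map' _
    (LinearEquiv.ker ((E.triv p).linearEquivAt ℝ q hq).symm)
  have h : (fun i => E.trivFrame p i q) = ((E.triv p).linearEquivAt ℝ q hq).symm.toLinearMap ∘
      Pi.basisFun ℝ (Fin 7) := by
    funext i
    simp [trivFrame_eq hq]
  rw [h]
  exact this

theorem finrank_fib (q : M) : Module.finrank ℝ (E.fib q) = 7 := by
  rw [((E.triv q).linearEquivAt ℝ q (E.mem_triv q)).finrank_eq]
  simp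

instance (q : M) : FiniteDimensional ℝ (E.fib q) :=
  Module.finite_of_finrank_pos (by rw [finrank_fib]; norm_num)

/-- A section representing a smooth family of functionals with respect to a smooth family of
nondegenerate bilinear forms is smooth. -/
theorem smoothAt_of_represents {p : M} {t : Fin 7 → ∀ q, E.fib q} (ht : ∀ i, E.SmoothAt (t i) p)
    (hp : ∀ᶠ q in 𝓝 p, LinearIndependent ℝ fun i => t i q)
    (G : ∀ q, E.fib q →ₗ[ℝ] E.fib q →ₗ[ℝ] ℝ) (hG : ∀ v, (∀ w, G p v w = 0) → v = 0)
    (hGt : ∀ i j, ContMDiffAt (𝓡 n) 𝓘(ℝ, ℝ) ∞ (fun q => G q (t i q) (t j q)) p)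
    (s : ∀ q, E.fib q)
    (hs : ∀ j, ContMDiffAt (𝓡 n) 𝓘(ℝ, ℝ) ∞ (fun q => G q (s q) (t j q)) p) : E.SmoothAt s p := by
  have hb : ∀ᶠ q in 𝓝 p, ∃ y : V7, ∑ i, y i • t i q = s q := by
    filter_upwards [hp] with q hq
    let b := basisOfLinearIndependentOfCardEqFinrank hq (by rw [finrank_fib]; simp)
    refine ⟨b.repr (s q), ?_⟩
    have := b.sum_repr (s q)
    simpa [b] using this
  classical
  let x : M → V7 := fun q => if h : ∃ y : V7, ∑ i, y i • t i q = s q then h.choose else 0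
  have hx : ∀ᶠ q in 𝓝 p, ∑ i, x q i • t i q = s q := by
    filter_upwards [hb] with q hq
    simp only [x, dif_pos hq]
    exact hq.choose_spec
  have hxs : ContMDiffAt (𝓡 n) 𝓘(ℝ, V7) ∞ x p := by
    -- Pairing with the frame turns the coefficients of s into the solution of a linear system with
    -- the Gram matrix, which is nonsingular at p by nondegeneracy.
    refine contMDiffAt_of_linear_system (A := fun q i j => G q (t i q) (t j q))
      (b := fun q j => G q (s q) (t j q)) (fun i => contMDiffAt_pi_space.2 (hGt i))
      (contMDiffAt_pi_space.2 hs) ?_ ?_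
    · have h1 := hp.self_of_nhds
      let b := basisOfLinearIndependentOfCardEqFinrank h1 (by rw [finrank_fib]; simp)
      let F : E.fib p →ₗ[ℝ] V7 := LinearMap.pi fun j => (G p).flip (t j p)
      refine h1.map' F (LinearMap.ker_eq_bot'.2 fun v hv => hG v ?_)
      have : G p v = 0 := b.ext fun j => by
        have := congrFun hv j
        simpa [b, F] using this
      intro w
      rw [this, LinearMap.zero_apply]
    · filter_upwards [hx] with q hq
      funext j
      rw [← hq]
      simp
  exact (SmoothAt.sum_smul ht fun i => contMDiffAt_pi_space.1 hxs i).congr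
    (hx.mono fun q hq => hq.symm)

end RankSevenBundle

end OctG2

namespace OctG2

namespace RankSevenBundle

/-! ## Finite generation of the module of sections -/

section FiberMap

variable {n : ℕ} {M : Type u} [TopologicalSpace M] [ChartedSpace (EuclideanSpace ℝ (Fin n)) M]

/-- A smooth family of linear maps from the fibres of a bundle to a fixed vector space. -/
structure FiberMap (E : RankSevenBundle n M) (W : Type*) [NormedAddCommGroup W]
    [NormedSpace ℝ W] where
  toFun : ∀ q, E.fib q →ₗ[ℝ] W
  smooth : ContMDiff ((𝓡 n).prod 𝓘(ℝ, V7)) 𝓘(ℝ, W) ∞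
    fun v : TotalSpace V7 E.fib => toFun v.1 v.2

variable {E : RankSevenBundle n M} {W W' : Type*} [NormedAddCommGroup W] [NormedSpace ℝ W]
  [NormedAddCommGroup W'] [NormedSpace ℝ W']

/-- Composition of a family of linear maps with a linear map. -/
def FiberMap.comp [FiniteDimensional ℝ W] (A : W →ₗ[ℝ] W') (f : FiberMap E W) :
    FiberMap E W' where
  toFun q := A.comp (f.toFun q)
  smooth := by
    exact (LinearMap.toContinuousLinearMap A).contDiff.contMDiff.comp f.smooth

/-- A family is injective over a set if all of its members over this set are injective. -/
def FiberMap.InjOver (f : FiberMap E W) (K : Set M) : Prop :=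
  ∀ q ∈ K, ∀ v : E.fib q, f.toFun q v = 0 → v = 0

theorem FiberMap.smoothAt_apply (f : FiberMap E W) {s : ∀ q, E.fib q} {p : M}
    (hs : E.SmoothAt s p) : ContMDiffAt (𝓡 n) 𝓘(ℝ, W) ∞ (fun q => f.toFun q (s q)) p :=
  (f.smooth.contMDiffAt (x := ⟨p, s p⟩)).comp p hs

theorem contMDiffAt_triv_snd (p : M) (v : TotalSpace V7 E.fib) (hv : v.1 ∈ (E.triv p).baseSet) :
    ContMDiffAt ((𝓡 n).prod 𝓘(ℝ, V7)) 𝓘(ℝ, V7) ∞ (fun v => (E.triv p v).2) v :=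
  ((E.triv p).contMDiffAt_iff ((E.triv p).mem_source.2 hv)).1 contMDiffAt_id |>.2

variable [IsManifold (𝓡 n) ∞ M] [T2Space M]

-- A local trivialization times a bump function extends by zero to all of M and stays injective
-- where the bump function equals 1.
variable (E) in
theorem exists_fiberMap_injOver_nhds (p : M) :
    ∃ f : FiberMap E V7, ∃ U ∈ 𝓝 p, f.InjOver U := by
  obtain ⟨χ, -, hχ⟩ := (SmoothBumpFunction.nhds_basis_tsupport (I := 𝓡 n) p).mem_iff.1
    ((E.triv p).open_baseSet.mem_nhds (E.mem_triv p))
  refine ⟨⟨fun q => χ q • (E.triv p).linearMapAt ℝ q, fun v => ?_⟩, {q | χ q = 1},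
    χ.eventuallyEq_one, fun q hq v hv => ?_⟩
  · by_cases hv : v.1 ∈ (E.triv p).baseSet
    · have h1 : ContMDiffAt ((𝓡 n).prod 𝓘(ℝ, V7)) 𝓘(ℝ, ℝ) ∞
          (fun v : TotalSpace V7 E.fib => χ v.1) v :=
        (χ.contMDiff.contMDiffAt (x := v.1)).comp v (contMDiffAt_proj E.fib)
      refine (h1.smul (contMDiffAt_triv_snd p v hv)).congr_of_eventuallyEq ?_
      have : ∀ᶠ w : TotalSpace V7 E.fib in 𝓝 v, w.1 ∈ (E.triv p).baseSet :=
        (FiberBundle.continuous_proj V7 E.fib).continuousAt.eventually_mem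
          ((E.triv p).open_baseSet.mem_nhds hv)
      filter_upwards [this] with w hw
      change χ w.1 • (E.triv p).linearMapAt ℝ w.1 w.2 = _
      rw [Trivialization.linearMapAt_apply, if_pos hw]
      rfl
    · have h0 : v.1 ∉ tsupport χ := fun h => hv (hχ h)
      have : ∀ᶠ w : TotalSpace V7 E.fib in 𝓝 v, w.1 ∈ (tsupport χ)ᶜ :=
        (FiberBundle.continuous_proj V7 E.fib).continuousAt.eventually_mem
          ((isClosed_tsupport χ).isOpen_compl.mem_nhds h0)
      refine (contMDiffAt_const (c := (0 : V7))).congr_of_eventuallyEq ?_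
      filter_upwards [this] with w hw
      change χ w.1 • (E.triv p).linearMapAt ℝ w.1 w.2 = _
      rw [image_eq_zero_of_notMem_tsupport hw, zero_smul]
  · have hq' : q ∈ (E.triv p).baseSet := by
      refine hχ (subset_tsupport _ ?_)
      rw [Function.mem_support, hq]
      exact one_ne_zero
    have hv' : χ q • (E.triv p).linearMapAt ℝ q v = 0 := hv
    rw [hq, one_smul, Trivialization.linearMapAt_apply, if_pos hq', triv_apply hq'] at hv'
    exact (LinearEquiv.map_eq_zero_iff _).1 hv'

omit [IsManifold (𝓡 n) ∞ M] [T2Space M] in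
theorem exists_pi_fiberMap {ι : Type*} [Fintype ι] (f : ι → FiberMap E W) :
    ∃ g : FiberMap E (ι → W), ∀ q v i, g.toFun q v i = (f i).toFun q v :=
  ⟨⟨fun q => LinearMap.pi fun i => (f i).toFun q,
    contMDiff_pi_space.2 fun i => (f i).smooth⟩, fun _ _ _ => rfl⟩

omit [IsManifold (𝓡 n) ∞ M] [T2Space M] in
theorem FiberMap.InjOver.exists_fin [FiniteDimensional ℝ W] {f : FiberMap E W} {K : Set M}
    (hf : f.InjOver K) {N : ℕ} (hN : Module.finrank ℝ W ≤ N) :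
    ∃ g : FiberMap E (Fin N → ℝ), g.InjOver K := by
  obtain ⟨A, hA⟩ : ∃ A : W →ₗ[ℝ] (Fin N → ℝ), Function.Injective A :=
    finrank_le_iff_exists_linearMap.1 (by simpa using hN)
  refine ⟨f.comp A, fun q hq v hv => hf q hq v (hA ?_)⟩
  rw [map_zero]
  exact hv

-- Finitely many local maps cover the compact set, and their product is injective over it. The
-- dimension of the target still depends on the set.
variable (E) in
theorem exists_fiberMap_injOver_compact {K : Set M} (hK : IsCompact K) :
    ∃ N : ℕ, ∃ f : FiberMap E (Fin N → ℝ), f.InjOver K := by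
  choose f U hU hf using E.exists_fiberMap_injOver_nhds
  obtain ⟨t, -, ht⟩ := hK.elim_nhds_subcover U fun p _ => hU p
  obtain ⟨g, hg⟩ := exists_pi_fiberMap (ι := t) fun i => f i.1
  refine ⟨_, FiberMap.InjOver.exists_fin (f := g) (fun q hq v hv => ?_) le_rfl⟩
  obtain ⟨i, hi, hqi⟩ := Set.mem_iUnion₂.1 (ht hq)
  refine hf i q hqi v ?_
  rw [← hg q v ⟨i, hi⟩, hv]
  rfl

/-! ### Reduction of the dimension of the target -/

-- In a chart and a trivialization the family is a C¹ map on a convex subset of a space of dimension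
-- n + 7, and such maps do not raise the Hausdorff dimension.
omit [T2Space M] in
theorem FiberMap.exists_nhds_dimH_le [FiniteDimensional ℝ W] (f : FiberMap E W) (p : M) :
    ∃ U ∈ 𝓝 p, dimH ((fun v : TotalSpace V7 E.fib => f.toFun v.1 v.2) '' {v | v.1 ∈ U})
      ≤ (n + 7 : ℕ) := by
  set φ := extChartAt (𝓡 n) p with hφ
  have hV : φ.symm ⁻¹' (E.triv p).baseSet ∩ φ.target ∈ 𝓝 (φ p) := by
    refine Filter.inter_mem ?_ (extChartAt_target_mem_nhds p)
    refine (continuousAt_extChartAt_symm p).preimage_mem_nhds ?_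
    rw [← hφ, hφ, extChartAt_to_inv]
    exact (E.triv p).open_baseSet.mem_nhds (E.mem_triv p)
  obtain ⟨r, hr, hball⟩ := Metric.mem_nhds_iff.1 hV
  let B : Set (EuclideanSpace ℝ (Fin n)) := Metric.ball (φ p) r
  let h : EuclideanSpace ℝ (Fin n) × V7 → W := fun x =>
    f.toFun _ ((E.triv p).toOpenPartialHomeomorph.symm (φ.symm x.1, x.2)).2
  have hsm : ContDiffOn ℝ 1 h (B ×ˢ Set.univ) := by
    have h1 : ContMDiffOn 𝓘(ℝ, EuclideanSpace ℝ (Fin n) × V7) (𝓡 n) ∞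
        (fun x : EuclideanSpace ℝ (Fin n) × V7 => φ.symm x.1) (B ×ˢ Set.univ) :=
      (contMDiffOn_extChartAt_symm p).comp contDiff_fst.contMDiff.contMDiffOn
        fun x hx => (hball hx.1).2
    have h2 : ContMDiffOn 𝓘(ℝ, EuclideanSpace ℝ (Fin n) × V7) ((𝓡 n).prod 𝓘(ℝ, V7)) ∞
        (fun x : EuclideanSpace ℝ (Fin n) × V7 => (φ.symm x.1, x.2)) (B ×ˢ Set.univ) :=
      h1.prodMk contDiff_snd.contMDiff.contMDiffOn
    have h3 := (E.triv p).contMDiffOn_symm (IB := 𝓡 n) (n := ∞)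
    have h4 := h3.comp h2 fun x hx => (E.triv p).mem_target.2 (hball hx.1).1
    have h5 := f.smooth.comp_contMDiffOn h4
    exact (contMDiffOn_iff_contDiffOn.1 h5).of_le (by exact_mod_cast le_top)
  refine ⟨φ.source ∩ φ ⁻¹' B, ?_, ?_⟩
  · exact Filter.inter_mem (extChartAt_source_mem_nhds p)
      ((continuousAt_extChartAt p).preimage_mem_nhds (Metric.ball_mem_nhds _ hr))
  · have hsub : (fun v : TotalSpace V7 E.fib => f.toFun v.1 v.2) ''
        {v | v.1 ∈ φ.source ∩ φ ⁻¹' B} ⊆ h '' (B ×ˢ Set.univ) := by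
      rintro _ ⟨v, ⟨hv1, hv2⟩, rfl⟩
      refine ⟨(φ v.1, (E.triv p v).2), ⟨hv2, trivial⟩, ?_⟩
      have e1 : φ.symm (φ v.1) = v.1 := φ.left_inv hv1
      have hb : v.1 ∈ (E.triv p).baseSet := by
        have := (hball hv2).1
        rwa [Set.mem_preimage, e1] at this
      have e2 : (E.triv p).toOpenPartialHomeomorph.symm (v.1, (E.triv p v).2) = v := by
        have := (E.triv p).toOpenPartialHomeomorph.left_inv ((E.triv p).mem_source.2 hb)
        conv_rhs => rw [← this]
        congr 1
        exact Prod.ext ((E.triv p).coe_fst' hb).symm rfl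
      simp only [h]
      rw [e1, e2]
    calc _ ≤ dimH (h '' (B ×ˢ Set.univ)) := dimH_mono hsub
      _ ≤ dimH (B ×ˢ (Set.univ : Set V7)) :=
        hsm.dimH_image_le ((convex_ball _ _).prod convex_univ) subset_rfl
      _ ≤ dimH (Set.univ : Set (EuclideanSpace ℝ (Fin n) × V7)) := dimH_mono (Set.subset_univ _)
      _ = (n + 7 : ℕ) := by
        rw [Real.dimH_univ_eq_finrank]
        simp

omit [T2Space M] in
theorem FiberMap.dimH_range_le [SecondCountableTopology M] [FiniteDimensional ℝ W]
    (f : FiberMap E W) :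
    dimH (Set.range fun v : TotalSpace V7 E.fib => f.toFun v.1 v.2) ≤ (n + 7 : ℕ) := by
  choose U hU hd using f.exists_nhds_dimH_le
  obtain ⟨t, ht, hcov⟩ := TopologicalSpace.countable_cover_nhds hU
  have : (Set.range fun v : TotalSpace V7 E.fib => f.toFun v.1 v.2) ⊆
      ⋃ p ∈ t, (fun v : TotalSpace V7 E.fib => f.toFun v.1 v.2) '' {v | v.1 ∈ U p} := by
    rintro _ ⟨v, rfl⟩
    obtain ⟨p, hp, hv⟩ := Set.mem_iUnion₂.1 (hcov ▸ Set.mem_univ v.1)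
    exact Set.mem_iUnion₂.2 ⟨p, hp, v, hv, rfl⟩
  refine (dimH_mono this).trans ?_
  rw [dimH_bUnion ht]
  exact iSup₂_le fun p _ => hd p

-- While the target has dimension greater than n + 7, the range misses some vector ℓ. The range is
-- stable under scaling, so it meets the line of ℓ only in 0, and dividing by this line preserves
-- injectivity over K. The resulting bound is the same for all compact sets, which the gluing
-- requires.
omit [T2Space M] in
theorem FiberMap.InjOver.exists_reduced [SecondCountableTopology M] {K : Set M} (N : ℕ) :
    ∀ f : FiberMap E (Fin N → ℝ), f.InjOver K →
      ∃ g : FiberMap E (Fin (n + 7) → ℝ), g.InjOver K := by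
  induction N with
  | zero => exact fun f hf => hf.exists_fin (by simp)
  | succ N ih =>
    intro f hf
    by_cases hN : N + 1 ≤ n + 7
    · exact hf.exists_fin (by simpa using hN)
    have hd : dimH (Set.range fun v : TotalSpace V7 E.fib => f.toFun v.1 v.2)
        < Module.finrank ℝ (Fin (N + 1) → ℝ) := by
      refine f.dimH_range_le.trans_lt ?_
      rw [Module.finrank_fin_fun]
      exact_mod_cast not_le.1 hN
    obtain ⟨ℓ, hℓ⟩ := (dense_compl_of_dimH_lt_finrank hd).nonempty
    -- A point of K shows ℓ ≠ 0: the zero vector of its fibre puts 0 in the range. For empty K any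
    -- map serves.
    rcases K.eq_empty_or_nonempty with rfl | ⟨q₀, hq₀⟩
    · obtain ⟨A⟩ : Nonempty ((Fin (N + 1) → ℝ) →ₗ[ℝ] (Fin (n + 7) → ℝ)) := ⟨0⟩
      exact ⟨f.comp A, fun q hq => absurd hq (Set.notMem_empty q)⟩
    have hℓ0 : ℓ ≠ 0 := by
      rintro rfl
      exact hℓ ⟨⟨q₀, 0⟩, map_zero _⟩
    have hfr : Module.finrank ℝ ((Fin (N + 1) → ℝ) ⧸ (ℝ ∙ ℓ)) = Module.finrank ℝ (Fin N → ℝ) := by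
      have := (ℝ ∙ ℓ).finrank_quotient_add_finrank
      rw [finrank_span_singleton hℓ0] at this
      simp at this ⊢
      omega
    let A : (Fin (N + 1) → ℝ) →ₗ[ℝ] (Fin N → ℝ) :=
      (LinearEquiv.ofFinrankEq _ _ hfr).toLinearMap.comp (ℝ ∙ ℓ).mkQ
    refine ih (f.comp A) fun q hq v hv => hf q hq v ?_
    have h1 : f.toFun q v ∈ ℝ ∙ ℓ := by
      have : (LinearEquiv.ofFinrankEq _ _ hfr) ((ℝ ∙ ℓ).mkQ (f.toFun q v)) = 0 := hv
      rw [LinearEquiv.map_eq_zero_iff] at this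
      exact (Submodule.Quotient.mk_eq_zero _).1 this
    obtain ⟨a, ha⟩ := Submodule.mem_span_singleton.1 h1
    by_cases ha0 : a = 0
    · rw [← ha, ha0, zero_smul]
    · refine absurd ⟨⟨q, a⁻¹ • v⟩, ?_⟩ hℓ
      simp only [map_smul]
      rw [← ha, smul_smul, inv_mul_cancel₀ ha0, one_smul]

variable (E) in
theorem exists_fiberMap_injOver_compact_fixed [SecondCountableTopology M] {K : Set M}
    (hK : IsCompact K) : ∃ f : FiberMap E (Fin (n + 7) → ℝ), f.InjOver K := by
  obtain ⟨N, f, hf⟩ := E.exists_fiberMap_injOver_compact hK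
  exact FiberMap.InjOver.exists_reduced N f hf

/-! ### Gluing over an exhaustion -/

omit [IsManifold (𝓡 n) ∞ M] [T2Space M] in
theorem FiberMap.smooth_iff_of_nhds {f : ∀ q, E.fib q →ₗ[ℝ] W}
    (h : ∀ q : M, ∃ U ∈ 𝓝 q, ∃ g : FiberMap E W, ∀ q' ∈ U, f q' = g.toFun q') :
    ContMDiff ((𝓡 n).prod 𝓘(ℝ, V7)) 𝓘(ℝ, W) ∞ fun v : TotalSpace V7 E.fib => f v.1 v.2 := by
  intro v
  obtain ⟨U, hU, g, hg⟩ := h v.1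
  refine g.smooth.contMDiffAt.congr_of_eventuallyEq ?_
  have : ∀ᶠ w : TotalSpace V7 E.fib in 𝓝 v, w.1 ∈ U :=
    (FiberBundle.continuous_proj V7 E.fib).continuousAt.eventually_mem hU
  filter_upwards [this] with w hw
  rw [hg w.1 hw]

omit [IsManifold (𝓡 n) ∞ M] [T2Space M] in
theorem FiberMap.exists_sum_smul {ι : Type*} (s : Finset ι) (a : ι → SmoothRing n M)
    (f : ι → FiberMap E W) :
    ∃ g : FiberMap E W, ∀ q, g.toFun q = ∑ i ∈ s, a i q • (f i).toFun q := by
  refine ⟨⟨fun q => ∑ i ∈ s, a i q • (f i).toFun q, ?_⟩, fun q => rfl⟩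
  simp only [LinearMap.sum_apply, LinearMap.smul_apply]
  refine contMDiff_finsetSum fun i _ => ?_
  have h : ContMDiff ((𝓡 n).prod 𝓘(ℝ, V7)) 𝓘(ℝ, ℝ) ∞ fun v : TotalSpace V7 E.fib => a i v.1 :=
    (a i).contMDiff.comp (contMDiff_proj E.fib)
  exact h.smul (f i).smooth

/-- A bundle on a second countable manifold embeds in a trivial bundle of finite rank. -/
theorem exists_fiberMap_injOver_univ [SecondCountableTopology M] (E : RankSevenBundle n M) :
    ∃ f : FiberMap E (Fin 3 → Fin (n + 7) → ℝ), f.InjOver Set.univ := by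
  have : LocallyCompactSpace M := ChartedSpace.locallyCompactSpace (EuclideanSpace ℝ (Fin n)) M
  -- Two shifts make the sets of index 0 and 1 empty, so every point lies in some shell K (j + 2) \
  -- K (j + 1).
  let K : CompactExhaustion M := (CompactExhaustion.choice M).shiftr.shiftr
  have K1 : K 1 = ∅ := rfl
  choose F hF using fun j => E.exists_fiberMap_injOver_compact_fixed (K.isCompact j)
  -- A cutoff for the shell of index j that is nonzero at most on the three consecutive shells
  -- around it.
  have hρ : ∀ j, ∃ ρ : SmoothRing n M, (∀ x, ρ x ≠ 0 → x ∈ K (j + 3) ∧ x ∉ K j) ∧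
      ∀ x, x ∈ K (j + 2) → x ∉ K (j + 1) → ρ x = 1 := by
    intro j
    have hs : IsClosed ((interior (K (j + 3)))ᶜ ∪ K j) :=
      isOpen_interior.isClosed_compl.union (K.isCompact j).isClosed
    have ht : IsClosed (K (j + 2) \ interior (K (j + 1))) :=
      (K.isCompact (j + 2)).isClosed.sdiff isOpen_interior
    have hd : Disjoint ((interior (K (j + 3)))ᶜ ∪ K j) (K (j + 2) \ interior (K (j + 1))) := by
      rw [Set.disjoint_left]
      rintro x (hx | hx) ⟨hx2, hx3⟩
      · exact hx (K.subset_interior_succ (j + 2) hx2)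
      · exact hx3 (K.subset_interior_succ j hx)
    obtain ⟨ρ, h0, h1, -⟩ := exists_contMDiffMap_zero_one_of_isClosed (𝓡 n) (n := ⊤) hs ht hd
    refine ⟨ρ, fun x hx => ⟨?_, fun h => hx (h0 (Or.inr h))⟩, fun x hx hx' =>
      h1 ⟨hx, fun h => hx' (interior_subset h)⟩⟩
    by_contra h
    exact hx (h0 (Or.inl fun h' => h (interior_subset h')))
  choose ρ hρ0 hρ1 using hρ
  have hlt : ∀ j q, ρ j q ≠ 0 → j < K.find q := fun j q h => by
    by_contra hle
    exact (hρ0 j q h).2 (K.subset (not_lt.1 hle) (K.mem_find q))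
  -- Cutoffs whose indices differ by a nonzero multiple of 3 are nowhere simultaneously nonzero, so
  -- three copies of the target suffice. Truncating the sum at `K.find q` loses nothing by `hlt`;
  -- `hf` gives the same sum with a locally constant range.
  let f : Fin 3 → ∀ q, E.fib q →ₗ[ℝ] (Fin (n + 7) → ℝ) := fun c q =>
    ∑ j ∈ (Finset.range (K.find q)).filter (fun j : ℕ => j % 3 = (c : ℕ)), ρ j q • (F (j + 3)).toFun q
  have hf : ∀ c q i, q ∈ K i → f c q =
      ∑ j ∈ (Finset.range i).filter (fun j : ℕ => j % 3 = (c : ℕ)), ρ j q • (F (j + 3)).toFun q := by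
    intro c q i hi
    have hle : K.find q ≤ i := K.mem_iff_find_le.1 hi
    refine Finset.sum_subset (Finset.filter_subset_filter _ (Finset.range_mono hle)) ?_
    intro j hj hj'
    by_cases h0 : ρ j q = 0
    · rw [h0, zero_smul]
    · exact absurd (Finset.mem_filter.2
        ⟨Finset.mem_range.2 (hlt j q h0), (Finset.mem_filter.1 hj).2⟩) hj'
  have hsm : ∀ c, ContMDiff ((𝓡 n).prod 𝓘(ℝ, V7)) 𝓘(ℝ, Fin (n + 7) → ℝ) ∞
      fun v : TotalSpace V7 E.fib => f c v.1 v.2 := by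
    intro c
    refine FiberMap.smooth_iff_of_nhds fun q => ?_
    obtain ⟨g, hg⟩ := FiberMap.exists_sum_smul (E := E)
      ((Finset.range (K.find q + 1)).filter (fun j : ℕ => j % 3 = (c : ℕ))) ρ (fun j => F (j + 3))
    refine ⟨K (K.find q + 1), ?_, g, fun q' hq' => ?_⟩
    · exact mem_interior_iff_mem_nhds.1 (K.subset_interior_succ _ (K.mem_find q))
    · rw [hf c q' _ hq', hg]
  obtain ⟨g, hg⟩ := exists_pi_fiberMap (E := E) fun c => ⟨f c, hsm c⟩
  refine ⟨g, fun q _ v hv => ?_⟩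
  have h2 : 2 ≤ K.find q := by
    by_contra h
    have h' : q ∈ K 1 := K.mem_iff_find_le.2 (by omega)
    rw [K1] at h'
    exact h'
  obtain ⟨j, hj⟩ := Nat.exists_eq_add_of_le h2
  have hqj : q ∈ K (j + 2) := K.mem_iff_find_le.2 (by omega)
  have hqj' : q ∉ K (j + 1) := fun h => by
    have := K.mem_iff_find_le.1 h
    omega
  have hle : j + 2 ≤ j + 3 := by omega
  refine hF (j + 3) q (K.subset hle hqj) v ?_
  have h3 : f ⟨j % 3, Nat.mod_lt _ (by norm_num)⟩ q v = 0 := by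
    funext i
    have h4 := congrFun (congrFun hv ⟨j % 3, Nat.mod_lt _ (by norm_num)⟩) i
    rw [hg] at h4
    exact h4
  -- On the shell of index j only one term of its own colour survives, with coefficient 1.
  have h5 : f ⟨j % 3, Nat.mod_lt _ (by norm_num)⟩ q = (F (j + 3)).toFun q := by
    rw [hf _ q (j + 2) hqj, Finset.sum_eq_single j]
    · rw [hρ1 j q hqj hqj', one_smul]
    · intro k hk hkj
      by_cases h0 : ρ k q = 0
      · rw [h0, zero_smul]
      · exfalso
        obtain ⟨ha, hb⟩ := hρ0 k q h0
        have hc := K.mem_iff_find_le.1 ha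
        have hd := (Finset.mem_filter.1 hk).2
        have he := hlt k q h0
        simp only at hd
        omega
    · intro h
      exact (h (Finset.mem_filter.2 ⟨Finset.mem_range.2 (Nat.lt_add_of_pos_right two_pos), rfl⟩)).elim
  rw [← h5, h3]

/-- A dual basis of the module of sections of a bundle: finitely many smooth sections and smooth
families of functionals that decompose every vector. -/
theorem exists_dual_basis [SecondCountableTopology M] (E : RankSevenBundle n M) :
    ∃ (N : ℕ) (s : Fin N → E.Sections) (l : Fin N → FiberMap E ℝ),
      ∀ q (v : E.fib q), ∑ i, (l i).toFun q v • s i q = v := by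
  obtain ⟨f₀, hf₀⟩ := E.exists_fiberMap_injOver_univ
  obtain ⟨N, f, hf⟩ : ∃ N : ℕ, ∃ f : FiberMap E (Fin N → ℝ), f.InjOver Set.univ :=
    ⟨_, hf₀.exists_fin le_rfl⟩
  -- The Euclidean metric pulled back by the embedding. The sections representing the coordinate
  -- functionals then form a dual basis with them: both sides of the decomposition have the same
  -- pairing with every w.
  let G : ∀ q, E.fib q →ₗ[ℝ] E.fib q →ₗ[ℝ] ℝ := fun q =>
    ∑ i, ((LinearMap.proj i).comp (f.toFun q)).smulRight ((LinearMap.proj i).comp (f.toFun q))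
  have hG : ∀ q v w, G q v w = ∑ i, f.toFun q v i * f.toFun q w i := fun q v w => by
    simp [G, LinearMap.sum_apply]
  have hG0 : ∀ q v, (∀ w, G q v w = 0) → v = 0 := fun q v h => by
    refine hf q trivial v (funext fun i => ?_)
    have := h v
    rw [hG, Finset.sum_eq_zero_iff_of_nonneg fun i _ => mul_self_nonneg _] at this
    exact mul_self_eq_zero.1 (this i (Finset.mem_univ i))
  have hex : ∀ i q, ∃ v : E.fib q, ∀ w, G q v w = f.toFun q w i := fun i q => by
    have hinj : Function.Injective (G q) := by
      rw [← LinearMap.ker_eq_bot, LinearMap.ker_eq_bot']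
      exact fun v hv => hG0 q v fun w => by rw [hv, LinearMap.zero_apply]
    have hsurj : Function.Surjective (G q) :=
      (LinearMap.injective_iff_surjective_of_finrank_eq_finrank
        (Subspace.dual_finrank_eq (K := ℝ) (V := E.fib q)).symm).1 hinj
    obtain ⟨v, hv⟩ := hsurj ((LinearMap.proj i).comp (f.toFun q))
    exact ⟨v, fun w => by rw [hv]; rfl⟩
  choose s hs using hex
  have hfs : ∀ (i : Fin N) (p : M) (t : ∀ q, E.fib q), E.SmoothAt t p →
      ContMDiffAt (𝓡 n) 𝓘(ℝ, ℝ) ∞ (fun q => f.toFun q (t q) i) p := fun i p t ht =>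
    contMDiffAt_pi_space.1 (f.smoothAt_apply ht) i
  have hsm : ∀ i p, E.SmoothAt (s i) p := by
    intro i p
    refine smoothAt_of_represents (smoothAt_trivFrame p) ?_ G (hG0 p) (fun j k => ?_) _ fun j => ?_
    · filter_upwards [(E.triv p).open_baseSet.mem_nhds (E.mem_triv p)] with q hq
      exact linearIndependent_trivFrame hq
    · simp only [hG]
      exact contMDiffAt_finsetSum fun i _ => (hfs i p _ (smoothAt_trivFrame p j)).mul
        (hfs i p _ (smoothAt_trivFrame p k))
    · simp only [hs]
      exact hfs i p _ (smoothAt_trivFrame p j)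
  refine ⟨N, fun i => ⟨s i, hsm i⟩, fun i => f.comp (LinearMap.proj i), fun q v => ?_⟩
  rw [← sub_eq_zero]
  refine hG0 q _ fun w => ?_
  rw [map_sub, LinearMap.sub_apply, map_sum, LinearMap.sum_apply, hG q v, sub_eq_zero]
  refine Finset.sum_congr rfl fun i _ => ?_
  rw [map_smul, LinearMap.smul_apply]
  change _ • G q (s i q) w = _
  rw [hs]
  rfl

end FiberMap

end RankSevenBundle

end OctG2

namespace OctG2

/-! ## Fibres of modules over the ring of smooth functions -/

section Fibres

variable {n : ℕ} {M : Type u} [TopologicalSpace M] [ChartedSpace (EuclideanSpace ℝ (Fin n)) M]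

theorem algebraMap_smoothRing_apply (c : ℝ) (p : M) : algebraMap ℝ (SmoothRing n M) c p = c := by
  rw [Algebra.algebraMap_eq_smul_one]
  exact mul_one c

instance : Invertible (2 : SmoothRing n M) where
  invOf := algebraMap ℝ _ 2⁻¹
  invOf_mul_self := by
    rw [← map_ofNat (algebraMap ℝ (SmoothRing n M)) 2, ← map_mul, inv_mul_cancel₀ two_ne_zero,
      map_one]
  mul_invOf_self := by
    rw [← map_ofNat (algebraMap ℝ (SmoothRing n M)) 2, ← map_mul, mul_inv_cancel₀ two_ne_zero,
      map_one]

theorem invOf_two_eq : ⅟(2 : SmoothRing n M) = algebraMap ℝ _ 2⁻¹ := rfl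

theorem mem_pointIdeal {p : M} {f : SmoothRing n M} : f ∈ pointIdeal n p ↔ f p = 0 := Iff.rfl

variable (n) in
/-- A realization of the real vector space `W` as the fibre at `p` of a module over `C^∞(M)`. -/
structure FibreAt (p : M) (P : Type*) [AddCommGroup P] [Module (SmoothRing n M) P]
    (W : Type*) [AddCommGroup W] [Module ℝ W] where
  ev : P →+ W
  ev_smul : ∀ (f : SmoothRing n M) x, ev (f • x) = f p • ev x
  surjective : Function.Surjective ev
  ker_le : ∀ x, ev x = 0 → x ∈ pointIdeal n p • (⊤ : Submodule (SmoothRing n M) P)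

namespace FibreAt

variable {p : M} {P Q T : Type*} [AddCommGroup P] [Module (SmoothRing n M) P]
  [AddCommGroup Q] [Module (SmoothRing n M) Q] [AddCommGroup T] [Module (SmoothRing n M) T]
  {W W' W'' : Type*} [AddCommGroup W] [Module ℝ W] [AddCommGroup W'] [Module ℝ W']
  [AddCommGroup W''] [Module ℝ W'']

/-- The fibre of the ring itself. -/
def self (p : M) : FibreAt n p (SmoothRing n M) ℝ where
  ev := (ContMDiffMap.evalRingHom (I := 𝓡 n) (I' := 𝓘(ℝ, ℝ)) (n := ∞) (R := ℝ) p).toAddMonoidHom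
  ev_smul _ _ := rfl
  surjective c := ⟨algebraMap ℝ (SmoothRing n M) c, algebraMap_smoothRing_apply (n := n) c p⟩
  ker_le x hx := by
    rw [← mul_one x, ← smul_eq_mul]
    exact Submodule.smul_mem_smul (mem_pointIdeal.2 hx) trivial

@[simp] theorem self_ev (f : SmoothRing n M) : (self (n := n) p).ev f = f p := rfl

theorem ev_eq_zero_iff (F : FibreAt n p P W) {x : P} :
    F.ev x = 0 ↔ x ∈ pointIdeal n p • (⊤ : Submodule (SmoothRing n M) P) := by
  refine ⟨F.ker_le x, fun h => Submodule.smul_induction_on h (fun f hf y _ => ?_) fun y z hy hz => ?_⟩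
  · rw [F.ev_smul, mem_pointIdeal.1 hf, zero_smul]
  · rw [map_add, hy, hz, add_zero]

theorem ev_map_eq_zero (F : FibreAt n p P W) (F' : FibreAt n p Q W') (f : P →ₗ[SmoothRing n M] Q)
    {x : P} (hx : F.ev x = 0) : F'.ev (f x) = 0 := by
  rw [ev_eq_zero_iff] at hx ⊢
  refine Submodule.smul_induction_on hx (fun a ha y _ => ?_) fun y z hy hz => ?_
  · rw [map_smul]
    exact Submodule.smul_mem_smul ha trivial
  · rw [map_add]
    exact add_mem hy hz

theorem ev_map_congr (F : FibreAt n p P W) (F' : FibreAt n p Q W') (f : P →ₗ[SmoothRing n M] Q)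
    {x y : P} (h : F.ev x = F.ev y) : F'.ev (f x) = F'.ev (f y) := by
  rw [← sub_eq_zero, ← map_sub, ← map_sub]
  exact F.ev_map_eq_zero F' f (by rw [map_sub, h, sub_self])

/-- A lift of a vector of the fibre. -/
def lift (F : FibreAt n p P W) (w : W) : P := Function.surjInv F.surjective w

@[simp] theorem ev_lift (F : FibreAt n p P W) (w : W) : F.ev (F.lift w) = w :=
  Function.surjInv_eq F.surjective w

theorem ev_lift_smul (F : FibreAt n p P W) (c : ℝ) (w : W) :
    F.ev (F.lift (c • w)) = F.ev (algebraMap ℝ (SmoothRing n M) c • F.lift w) := by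
  rw [F.ev_smul, algebraMap_smoothRing_apply, ev_lift, ev_lift]

/-- The linear map of fibres induced by a linear map of modules. -/
def map (F : FibreAt n p P W) (F' : FibreAt n p Q W') (f : P →ₗ[SmoothRing n M] Q) : W →ₗ[ℝ] W' where
  toFun w := F'.ev (f (F.lift w))
  map_add' v w := by
    rw [← map_add, ← map_add]
    exact F.ev_map_congr F' f (by simp)
  map_smul' c w := by
    rw [F.ev_map_congr F' f (F.ev_lift_smul c w), map_smul, F'.ev_smul,
      algebraMap_smoothRing_apply]
    rfl

theorem map_ev (F : FibreAt n p P W) (F' : FibreAt n p Q W') (f : P →ₗ[SmoothRing n M] Q) (x : P) :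
    F.map F' f (F.ev x) = F'.ev (f x) :=
  F.ev_map_congr F' f (by simp)

/-- The bilinear map of fibres induced by a bilinear map of modules. -/
def map₂ (F : FibreAt n p P W) (F' : FibreAt n p Q W') (F'' : FibreAt n p T W'')
    (B : P →ₗ[SmoothRing n M] Q →ₗ[SmoothRing n M] T) : W →ₗ[ℝ] W' →ₗ[ℝ] W'' where
  toFun w := F'.map F'' (B (F.lift w))
  map_add' v w := by
    ext w'
    obtain ⟨y, rfl⟩ := F'.surjective w'
    simp only [LinearMap.add_apply, map_ev]
    rw [← map_add, ← LinearMap.add_apply, ← map_add]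
    exact F.ev_map_congr F'' (B.flip y) (by simp)
  map_smul' c w := by
    ext w'
    obtain ⟨y, rfl⟩ := F'.surjective w'
    have h := F.ev_map_congr F'' (B.flip y) (F.ev_lift_smul c w)
    simp only [LinearMap.flip_apply] at h
    simp only [LinearMap.smul_apply, map_ev, RingHom.id_apply]
    rw [h, map_smul, LinearMap.smul_apply, F''.ev_smul, algebraMap_smoothRing_apply]

theorem map₂_ev (F : FibreAt n p P W) (F' : FibreAt n p Q W') (F'' : FibreAt n p T W'')
    (B : P →ₗ[SmoothRing n M] Q →ₗ[SmoothRing n M] T) (x : P) (y : Q) :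
    F.map₂ F' F'' B (F.ev x) (F'.ev y) = F''.ev (B x y) := by
  change F'.map F'' (B (F.lift (F.ev x))) (F'.ev y) = _
  rw [map_ev]
  exact F.ev_map_congr F'' (B.flip y) (by simp)

/-- The cross product on the fibre induced by a cross product on a module. -/
def cross (F : FibreAt n p P W) (X : CrossProduct (SmoothRing n M) P) : CrossProduct ℝ W where
  g := F.map₂ F (self p) X.g
  c := F.map₂ F F X.c
  symm v w := by
    obtain ⟨x, rfl⟩ := F.surjective v
    obtain ⟨y, rfl⟩ := F.surjective w
    rw [map₂_ev, map₂_ev, X.symm]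
  self v := by
    obtain ⟨x, rfl⟩ := F.surjective v
    rw [map₂_ev, X.self, map_zero]
  skew v w z := by
    obtain ⟨x, rfl⟩ := F.surjective v
    obtain ⟨y, rfl⟩ := F.surjective w
    obtain ⟨z, rfl⟩ := F.surjective z
    rw [map₂_ev, map₂_ev, map₂_ev, map₂_ev, X.skew, map_neg]
  double v w := by
    obtain ⟨x, rfl⟩ := F.surjective v
    obtain ⟨y, rfl⟩ := F.surjective w
    rw [map₂_ev, map₂_ev, map₂_ev, map₂_ev, X.double, map_sub, F.ev_smul, F.ev_smul]
    rfl

theorem cross_g (F : FibreAt n p P W) (X : CrossProduct (SmoothRing n M) P) (x y : P) :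
    (F.cross X).g (F.ev x) (F.ev y) = X.g x y p := F.map₂_ev F (self p) X.g x y

theorem cross_c (F : FibreAt n p P W) (X : CrossProduct (SmoothRing n M) P) (x y : P) :
    (F.cross X).c (F.ev x) (F.ev y) = F.ev (X.c x y) := F.map₂_ev F F X.c x y

theorem cross_form (F : FibreAt n p P W) (X : CrossProduct (SmoothRing n M) P) (x y z : P) :
    (F.cross X).form (F.ev x) (F.ev y) (F.ev z) = X.form x y z p := by
  rw [CrossProduct.form, cross_c, cross_g]
  rfl

theorem _root_.OctG2.exists_dual_basis_of_projective (R P : Type*) [CommRing R] [AddCommGroup P]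
    [Module R P] [Module.Finite R P] [Module.Projective R P] :
    ∃ (N : ℕ) (m : Fin N → P) (l : P →ₗ[R] (Fin N → R)), ∀ x, ∑ i, l x i • m i = x := by
  obtain ⟨N, f, hf⟩ := Module.Finite.exists_fin' R P
  obtain ⟨l, hl⟩ := Module.projective_lifting_property f LinearMap.id hf
  refine ⟨N, fun i => f (Pi.single i 1), l, fun x => ?_⟩
  conv_rhs => rw [← LinearMap.id_apply (R := R) x, ← hl, LinearMap.comp_apply,
    LinearMap.pi_apply_eq_sum_univ f (l x)]
  refine Finset.sum_congr rfl fun i _ => ?_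
  change _ • f _ = _ • f _
  congr 2
  funext j
  simp [Pi.single_apply, eq_comm]

/-- Each coordinate functional of a dual basis has the form g(y, ·). An element whose value at p is
in the radical therefore has all its coordinates zero at p. -/
theorem cross_nondegenerate [Module.Finite (SmoothRing n M) P]
    [Module.Projective (SmoothRing n M) P] (F : FibreAt n p P W)
    (X : CrossProduct (SmoothRing n M) P) (hX : Function.Surjective X.g) (w : W)
    (hw : ∀ w', (F.cross X).g w w' = 0) : w = 0 := by
  obtain ⟨x, rfl⟩ := F.surjective w
  obtain ⟨N, m, l, hl⟩ := exists_dual_basis_of_projective (SmoothRing n M) P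
  rw [← hl x, map_sum]
  refine Finset.sum_eq_zero fun i _ => ?_
  obtain ⟨y, hy⟩ := hX ((LinearMap.proj i).comp l)
  have h : l x i p = 0 := by
    have h1 : l x i = X.g y x := by rw [hy]; rfl
    rw [h1, X.symm, ← F.cross_g X, hw]
  rw [F.ev_smul, h, zero_smul]

/-- The dimension of the fibre is the rank of the module. -/
theorem finrank_eq [Module.Finite (SmoothRing n M) P] [Module.Projective (SmoothRing n M) P]
    (F : FibreAt n p P W) : ∃ 𝔭 : PrimeSpectrum (SmoothRing n M),
      Module.finrank ℝ W = Module.rankAtStalk P 𝔭 := by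
  let ε : SmoothRing n M →+* ℝ :=
    ContMDiffMap.evalRingHom (I := 𝓡 n) (I' := 𝓘(ℝ, ℝ)) (n := ∞) (R := ℝ) p
  let _ : Algebra (SmoothRing n M) ℝ := ε.toAlgebra
  let _ : Module (SmoothRing n M) W := Module.compHom W ε
  have : IsScalarTower (SmoothRing n M) ℝ W := ⟨fun f c w => mul_smul (f p) c w⟩
  let f : P →ₗ[SmoothRing n M] W :=
    { toFun := F.ev, map_add' := map_add F.ev, map_smul' := F.ev_smul }
  -- Every tensor is of the form 1 ⊗ x, because evaluation at p is onto ℝ; so W is the base change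
  -- of P along evaluation.
  have hf : Function.Bijective (f.liftBaseChange ℝ) := by
    have h1 : ∀ z : TensorProduct (SmoothRing n M) ℝ P, ∃ x : P, z = 1 ⊗ₜ x := by
      intro z
      induction z with
      | zero => exact ⟨0, (TensorProduct.tmul_zero _ _).symm⟩
      | tmul c x =>
        refine ⟨algebraMap ℝ (SmoothRing n M) c • x, ?_⟩
        rw [← TensorProduct.smul_tmul, Algebra.smul_def, mul_one]
        exact congrArg (· ⊗ₜ[SmoothRing n M] x) (algebraMap_smoothRing_apply (n := n) c p).symm
      | add y z hy hz =>
        obtain ⟨a, rfl⟩ := hy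
        obtain ⟨b, rfl⟩ := hz
        exact ⟨a + b, (TensorProduct.tmul_add _ _ _).symm⟩
    constructor
    · rw [injective_iff_map_eq_zero]
      intro z hz
      obtain ⟨x, rfl⟩ := h1 z
      rw [LinearMap.liftBaseChange_tmul, one_smul] at hz
      refine Submodule.smul_induction_on (F.ker_le x hz) (fun a ha y _ => ?_) fun y z hy hz => ?_
      · rw [← TensorProduct.smul_tmul, Algebra.smul_def, mul_one]
        have : algebraMap (SmoothRing n M) ℝ a = 0 := ha
        rw [this, TensorProduct.zero_tmul]
      · rw [TensorProduct.tmul_add, hy, hz, add_zero]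
    · intro w
      obtain ⟨x, rfl⟩ := F.surjective w
      exact ⟨1 ⊗ₜ x, by rw [LinearMap.liftBaseChange_tmul, one_smul]; rfl⟩
  let e := LinearEquiv.ofBijective _ hf
  -- The prime obtained by pulling back this one is the vanishing ideal of p.
  let 𝔮 : PrimeSpectrum ℝ := ⟨⊥, Ideal.isPrime_bot⟩
  refine ⟨𝔮.comap (algebraMap (SmoothRing n M) ℝ), ?_⟩
  rw [← Module.rankAtStalk_baseChange (S := ℝ) 𝔮, Module.rankAtStalk_eq_of_equiv e,
    Module.rankAtStalk_eq_finrank_of_free]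
  rfl

end FibreAt

/-! ### Connectedness: idempotents and constancy of the rank -/

section Connected

variable [ConnectedSpace M]

/-- The values are 0 and 1, so the zero set is open and closed. -/
theorem eq_zero_or_one_of_idempotent (f : SmoothRing n M) (hf : f * f = f) : f = 0 ∨ f = 1 := by
  have h : ∀ p, f p = 0 ∨ f p = 1 := fun p => by
    have h1 : f p * f p = f p := congrArg (fun g : SmoothRing n M => g p) hf
    rcases eq_or_ne (f p) 0 with h0 | h0
    · exact Or.inl h0
    · exact Or.inr (mul_left_cancel₀ h0 (by rw [h1, mul_one]))
  have hc : IsClopen {p : M | f p = 0} := by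
    refine ⟨isClosed_eq f.contMDiff.continuous continuous_const, ?_⟩
    have : {p : M | f p = 0} = {p : M | f p ≠ 1} := by
      ext p
      rcases h p with h | h <;> simp [h]
    rw [this]
    exact isOpen_ne_fun f.contMDiff.continuous continuous_const
  rcases isClopen_iff.1 hc with h0 | h0
  · right
    ext p
    exact (h p).resolve_left fun hp => by
      have : p ∈ {p : M | f p = 0} := hp
      rw [h0] at this
      exact this
  · left
    ext p
    have : p ∈ {p : M | f p = 0} := by rw [h0]; trivial
    exact this

instance : Nontrivial (SmoothRing n M) :=
  ⟨0, 1, fun h => zero_ne_one (α := ℝ)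
    (congrArg (fun g : SmoothRing n M => g (Classical.arbitrary M)) h)⟩

instance : PreconnectedSpace (PrimeSpectrum (SmoothRing n M)) := by
  rw [preconnectedSpace_iff_clopen]
  intro s hs
  obtain ⟨e, he, rfl⟩ := PrimeSpectrum.isClopen_iff.1 hs
  rcases eq_zero_or_one_of_idempotent e he with rfl | rfl
  · left; simp
  · right; simp

theorem rankAtStalk_const (P : Type*) [AddCommGroup P] [Module (SmoothRing n M) P]
    [Module.Finite (SmoothRing n M) P] [Module.Projective (SmoothRing n M) P]
    (𝔭 𝔮 : PrimeSpectrum (SmoothRing n M)) :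
    Module.rankAtStalk P 𝔭 = Module.rankAtStalk P 𝔮 := by
  have := Module.finitePresentation_of_projective (SmoothRing n M) P
  exact (Module.isLocallyConstant_rankAtStalk (R := SmoothRing n M)
    (M := P)).apply_eq_of_isPreconnected isPreconnected_univ trivial trivial

/-- The spectrum of C^∞(M) has primes other than the vanishing ideals of points. Since it is
connected, the dimension of one fibre controls the rank at all of them. -/
theorem FibreAt.rankAtStalk_eq {p : M} {P W : Type*} [AddCommGroup P]
    [Module (SmoothRing n M) P] [AddCommGroup W] [Module ℝ W]
    [Module.Finite (SmoothRing n M) P] [Module.Projective (SmoothRing n M) P]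
    (F : FibreAt n p P W) (𝔭 : PrimeSpectrum (SmoothRing n M)) :
    Module.rankAtStalk P 𝔭 = Module.finrank ℝ W := by
  obtain ⟨𝔮, h⟩ := F.finrank_eq
  rw [h]
  exact rankAtStalk_const P 𝔭 𝔮

end Connected

end Fibres

end OctG2

namespace OctG2

/-! ## Octonion algebras and cross products -/

namespace OctonionAlgebra

section Decomposition

variable {R : Type u} [CommRing R] [Invertible (2 : R)] {C C' : OctonionAlgebra R}
  (h1 : C.norm 1 = 1) (h1' : C'.norm 1 = 1)

include h1 in
theorem sub_smul_one_mem (x : C.carrier) : x - (⅟(2 : R) * C.bilin 1 x) • (1 : C.carrier) ∈ C.imag := by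
  rw [mem_imag, map_sub, map_smul, bilin_self, h1, smul_eq_mul]
  linear_combination - C.bilin 1 x * invOf_mul_self (2 : R)

/-- The decomposition of an octonion algebra into scalars and the orthogonal complement of `1`. -/
def decomp : C.carrier ≃ₗ[R] R × C.imag where
  toFun x := (⅟2 * C.bilin 1 x, ⟨_, sub_smul_one_mem h1 x⟩)
  map_add' x y := Prod.ext (by simp [mul_add]) (Subtype.ext <| by
    simp only [map_add, mul_add, add_smul, Prod.snd_add, Submodule.coe_add]; abel)
  map_smul' r x := Prod.ext (by simp [mul_left_comm]) (Subtype.ext <| by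
    simp only [map_smul, smul_eq_mul, mul_left_comm _ r, mul_smul, RingHom.id_apply, Prod.smul_snd,
      Submodule.coe_smul, smul_sub])
  invFun z := z.1 • (1 : C.carrier) + z.2.1
  left_inv x := add_sub_cancel _ _
  right_inv z := by
    have h2 : ⅟2 * C.bilin 1 (z.1 • (1 : C.carrier) + z.2.1) = z.1 := by
      rw [map_add, map_smul, bilin_self, h1, C.mem_imag.1 z.2.2, smul_eq_mul]
      linear_combination z.1 * invOf_mul_self (2 : R)
    refine Prod.ext h2 (Subtype.ext ?_)
    change z.1 • (1 : C.carrier) + z.2.1 - _ • (1 : C.carrier) = z.2.1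
    rw [h2, add_sub_cancel_left]

theorem decomp_symm_apply (a : R) (v : C.imag) :
    (decomp h1).symm (a, v) = a • (1 : C.carrier) + v.1 := rfl

theorem exists_decomp (x : C.carrier) :
    ∃ (a : R) (v : C.imag), x = (decomp h1).symm (a, v) :=
  ⟨_, _, ((decomp h1).symm_apply_apply x).symm⟩

/-- The product of C is the one defined on `Octonion`, so passing to the cross product loses no
information. -/
theorem decomp_symm_mul (a b : R) (v w : C.imag) :
    (decomp h1).symm (a, v) * (decomp h1).symm (b, w) =
      (decomp h1).symm (a * b - (cross h1).g v w, a • w + b • v + (cross h1).c v w) := by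
  rw [mul_comm a b]
  simp only [decomp_symm_apply, Submodule.coe_add, Submodule.coe_smul, cross_c, cross_g, add_mul,
    mul_add, smul_mul_assoc, mul_smul_comm, one_mul, mul_one, sub_smul, mul_smul, smul_add]
  abel

theorem bilin_decomp_symm (a b : R) (v w : C.imag) :
    C.bilin ((decomp h1).symm (a, v)) ((decomp h1).symm (b, w)) =
      2 * (a * b + (cross h1).g v w) := by
  simp only [decomp_symm_apply, map_add, LinearMap.add_apply, map_smul, LinearMap.smul_apply,
    bilin_self, h1, bilin_one_imag, C.mem_imag.1 w.2, smul_eq_mul, cross_g, imagForm_apply]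
  linear_combination (- C.bilin v.1 w.1) * mul_invOf_self (2 : R)

theorem norm_decomp_symm (a : R) (v : C.imag) :
    C.norm ((decomp h1).symm (a, v)) = a * a + (cross h1).g v v := by
  have h := bilin_decomp_symm h1 a a v v
  rw [bilin_self] at h
  linear_combination ⅟2 * h - (C.norm ((decomp h1).symm (a, v)) - (a * a + (cross h1).g v v)) *
    invOf_mul_self (2 : R)

/-- An isomorphism of the orthogonal complements of `1` that preserves the cross products extends to
an isomorphism of octonion algebras. -/
def homOfImag (f : C.imag ≃ₗ[R] C'.imag)
    (hg : ∀ x y, (cross h1').g (f x) (f y) = (cross h1).g x y)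
    (hc : ∀ x y, (cross h1').c (f x) (f y) = f ((cross h1).c x y)) : C ⟶ C' where
  toEquiv := decomp h1 ≪≫ₗ (LinearEquiv.refl R R).prodCongr f ≪≫ₗ (decomp h1').symm
  map_mul x y := by
    obtain ⟨a, v, rfl⟩ := exists_decomp h1 x
    obtain ⟨b, w, rfl⟩ := exists_decomp h1 y
    rw [decomp_symm_mul]
    simp only [LinearEquiv.trans_apply, LinearEquiv.apply_symm_apply, LinearEquiv.prodCongr_apply,
      LinearEquiv.refl_apply, decomp_symm_mul, hg, hc, map_add, map_smul]
  map_one := by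
    have : (1 : C.carrier) = (decomp h1).symm (1, 0) := by simp [decomp_symm_apply]
    rw [this]
    simp only [LinearEquiv.trans_apply, LinearEquiv.apply_symm_apply, LinearEquiv.prodCongr_apply,
      LinearEquiv.refl_apply, map_zero]
    simp [decomp_symm_apply]
  map_bilin x y := by
    obtain ⟨a, v, rfl⟩ := exists_decomp h1 x
    obtain ⟨b, w, rfl⟩ := exists_decomp h1 y
    simp only [LinearEquiv.trans_apply, LinearEquiv.apply_symm_apply, LinearEquiv.prodCongr_apply,
      LinearEquiv.refl_apply, bilin_decomp_symm, hg]

theorem homOfImag_apply (f : C.imag ≃ₗ[R] C'.imag)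
    (hg : ∀ x y, (cross h1').g (f x) (f y) = (cross h1).g x y)
    (hc : ∀ x y, (cross h1').c (f x) (f y) = f ((cross h1).c x y)) (x : C.imag) :
    (homOfImag h1 h1' f hg hc).toEquiv x.1 = (f x).1 := by
  have h : x.1 = (decomp h1).symm (0, x) := by simp [decomp_symm_apply]
  rw [h]
  simp only [homOfImag, LinearEquiv.trans_apply, LinearEquiv.apply_symm_apply,
    LinearEquiv.prodCongr_apply, LinearEquiv.refl_apply]
  simp [decomp_symm_apply]

include h1 in
theorem hom_ext_of_imag {f g : C ⟶ C'} (h : ∀ x : C.imag, f.toEquiv x.1 = g.toEquiv x.1) :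
    f = g := by
  refine Hom.ext (LinearEquiv.ext fun x => ?_)
  obtain ⟨a, v, rfl⟩ := exists_decomp h1 x
  rw [decomp_symm_apply, map_add, map_add, map_smul, map_smul, f.map_one, g.map_one, h]

/-- The perfect pairing on the orthogonal complement of `1`. -/
theorem cross_g_bijective : Function.Bijective (cross h1).g := by
  constructor
  · rw [injective_iff_map_eq_zero]
    intro x hx
    refine Subtype.ext (C.eq_of_bilin fun z => ?_)
    obtain ⟨b, w, rfl⟩ := exists_decomp h1 z
    have h : (x : C.carrier) = (decomp h1).symm (0, x) := by simp [decomp_symm_apply]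
    rw [h, bilin_decomp_symm, hx]
    simp
  · intro l
    obtain ⟨x, hx⟩ := C.nondegenerate.2
      ((l.comp (LinearMap.snd R R C.imag)).comp (decomp h1).toLinearMap)
    obtain ⟨a, v, rfl⟩ := exists_decomp h1 x
    -- On the imaginary part b is 2g, whence the factor 2.
    refine ⟨(2 : R) • v, LinearMap.ext fun w => ?_⟩
    have h := LinearMap.congr_fun hx ((decomp h1).symm (0, w))
    have h' := bilin_decomp_symm h1 a 0 v w
    simp only [LinearMap.comp_apply, LinearEquiv.coe_coe, LinearEquiv.apply_symm_apply,
      LinearMap.snd_apply] at h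
    rw [bilin] at h'
    rw [← h, h', map_smul, LinearMap.smul_apply, smul_eq_mul]
    ring

include h1 in
theorem finite_imag : Module.Finite R C.imag :=
  Module.Finite.of_surjective ((LinearMap.snd R R C.imag).comp (decomp h1).toLinearMap)
    fun v => ⟨(decomp h1).symm (0, v), by simp⟩

include h1 in
theorem projective_imag : Module.Projective R C.imag :=
  Module.Projective.of_split C.imag.subtype ((LinearMap.snd R R C.imag).comp (decomp h1).toLinearMap)
    (LinearMap.ext fun v => by
      have h : (v : C.carrier) = (decomp h1).symm (0, v) := by simp [decomp_symm_apply]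
      simp only [LinearMap.comp_apply, Submodule.subtype_apply, LinearEquiv.coe_coe]
      rw [h, LinearEquiv.apply_symm_apply]
      rfl)

include h1 in
theorem rankAtStalk_imag [Nontrivial R] (𝔭 : PrimeSpectrum R) :
    Module.rankAtStalk C.imag 𝔭 = 7 := by
  have := finite_imag h1
  have := projective_imag h1
  have h := C.rank_eq 𝔭
  rw [Module.rankAtStalk_eq_of_equiv (decomp h1), Module.rankAtStalk_prod,
    Pi.add_apply, Module.rankAtStalk_self] at h
  simp only [Pi.one_apply] at h
  omega

end Decomposition

section OfCross

variable {R : Type u} [CommRing R] [Invertible (2 : R)] [Nontrivial R] {P : Type u}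
  [AddCommGroup P] [Module R P] [Module.Finite R P] [Module.Projective R P]
  (hP : ∀ 𝔭 : PrimeSpectrum R, Module.rankAtStalk P 𝔭 = 7) (X : CrossProduct R P)
  (hX : Function.Bijective X.g)

/-- The octonion algebra of a cross product. -/
def ofCross : OctonionAlgebra R where
  carrier := X.Octonion
  finite := inferInstanceAs (Module.Finite R (R × P))
  projective := inferInstanceAs (Module.Projective R (R × P))
  rank_eq 𝔭 := by
    change Module.rankAtStalk (R × P) 𝔭 = 8
    rw [Module.rankAtStalk_prod, Pi.add_apply, Module.rankAtStalk_self, hP]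
    rfl
  norm := CrossProduct.Octonion.norm X
  nondegenerate := CrossProduct.Octonion.norm_polar_bijective X hX
  norm_mul := CrossProduct.Octonion.norm_mul X

theorem norm_one_ofCross : (ofCross hP X hX).norm 1 = 1 := by
  change (1 : R) * 1 + X.g 0 0 = 1
  simp

theorem bilin_ofCross (x y : X.Octonion) :
    (ofCross hP X hX).bilin x y = 2 * (x.1 * y.1 + X.g x.2 y.2) :=
  CrossProduct.Octonion.norm_polar X x y

theorem mem_imag_ofCross (x : X.Octonion) : x ∈ (ofCross hP X hX).imag ↔ x.1 = 0 := by
  refine (mem_imag (ofCross hP X hX)).trans ?_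
  have h : (ofCross hP X hX).bilin 1 x = 2 * (1 * x.1 + X.g 0 x.2) := bilin_ofCross hP X hX 1 x
  rw [h, map_zero, LinearMap.zero_apply, add_zero, one_mul]
  exact ⟨fun h => by simpa using congrArg (⅟(2 : R) * ·) h, fun h => by rw [h, mul_zero]⟩

/-- The module of a cross product is the orthogonal complement of `1` in its octonion algebra. -/
def imagOfCross : P ≃ₗ[R] (ofCross hP X hX).imag where
  toFun v := ⟨CrossProduct.Octonion.mk 0 v, (mem_imag_ofCross hP X hX _).2 rfl⟩
  map_add' _ _ := Subtype.ext
    (CrossProduct.Octonion.ext (X := X) (add_zero (0 : R)).symm rfl)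
  map_smul' r _ := Subtype.ext
    (CrossProduct.Octonion.ext (X := X) (mul_zero r).symm rfl)
  invFun x := (x.1 : X.Octonion).2
  left_inv _ := rfl
  right_inv x := Subtype.ext (CrossProduct.Octonion.ext (X := X)
    ((mem_imag_ofCross hP X hX x.1).1 x.2).symm rfl)

theorem cross_g_imagOfCross (v w : P) :
    (cross (norm_one_ofCross hP X hX)).g (imagOfCross hP X hX v) (imagOfCross hP X hX w) =
      X.g v w := by
  rw [cross_g, imagForm_apply]
  have h := bilin_ofCross hP X hX (CrossProduct.Octonion.mk 0 v) (CrossProduct.Octonion.mk 0 w)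
  refine (congrArg (⅟(2 : R) * ·) h).trans ?_
  simp

theorem cross_c_imagOfCross (v w : P) :
    (cross (norm_one_ofCross hP X hX)).c (imagOfCross hP X hX v) (imagOfCross hP X hX w) =
      imagOfCross hP X hX (X.c v w) := by
  refine Subtype.ext ?_
  rw [cross_c, ← cross_g (norm_one_ofCross hP X hX), cross_g_imagOfCross]
  refine CrossProduct.Octonion.ext (X := X) ?_ ?_
  · change (0 : R) * 0 - X.g v w + X.g v w * 1 = 0
    ring
  · change (0 : R) • w + (0 : R) • v + X.c v w + X.g v w • (0 : P) = X.c v w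
    simp

end OfCross

section Manifold

variable {n : ℕ} {M : Type u} [TopologicalSpace M] [ChartedSpace (EuclideanSpace ℝ (Fin n)) M]
  [ConnectedSpace M] (C : OctonionAlgebra (SmoothRing n M))

/-- Since 1·1 = 1, the value is idempotent, hence 0 or 1. If it were 0, then q(x) = q(x·1) = 0 for
all x, and nondegeneracy would give C = 0 against rank 8. -/
theorem norm_one : C.norm 1 = 1 := by
  have h : C.norm 1 * C.norm 1 = C.norm 1 := by rw [← C.norm_mul, one_mul]
  refine (eq_zero_or_one_of_idempotent _ h).resolve_left fun h0 => ?_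
  have hn : ∀ x, C.norm x = 0 := fun x => by
    have := C.norm_mul x 1
    rwa [mul_one, h0, mul_zero] at this
  have : Subsingleton C.carrier := ⟨fun x y => C.eq_of_bilin fun z => by
    rw [bilin_apply, bilin_apply]; simp only [hn]⟩
  have h8 := C.rank_eq (Classical.arbitrary _)
  rw [Module.rankAtStalk_eq_zero_of_subsingleton] at h8
  exact absurd h8 (by simp)

end Manifold

end OctonionAlgebra

/-! ## The module of sections of a bundle -/

namespace RankSevenBundle

variable {n : ℕ} {M : Type u} [TopologicalSpace M] [ChartedSpace (EuclideanSpace ℝ (Fin n)) M]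
  {E : RankSevenBundle n M}

theorem sections_sum_apply {ι : Type*} (t : Finset ι) (s : ι → E.Sections) (p : M) :
    (∑ i ∈ t, s i) p = ∑ i ∈ t, s i p := by
  classical
  induction t using Finset.induction_on with
  | empty => rfl
  | insert i t hi ih => rw [Finset.sum_insert hi, Finset.sum_insert hi, ← ih]; rfl

/-- The linear functional on sections defined by a smooth family of functionals. -/
def FiberMap.toLinear (l : FiberMap E ℝ) : E.Sections →ₗ[SmoothRing n M] SmoothRing n M where
  toFun s := ⟨fun p => l.toFun p (s p), fun p => l.smoothAt_apply (s.contMDiff p)⟩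
  map_add' s t := by ext p; exact (l.toFun p).map_add _ _
  map_smul' f s := by ext p; exact (l.toFun p).map_smul _ _

theorem FiberMap.toLinear_apply (l : FiberMap E ℝ) (s : E.Sections) (p : M) :
    l.toLinear s p = l.toFun p (s p) := rfl

variable [IsManifold (𝓡 n) ∞ M] [T2Space M] [SecondCountableTopology M]

variable (E) in
theorem exists_sections_dual_basis : ∃ (N : ℕ) (s : Fin N → E.Sections) (l : Fin N → FiberMap E ℝ),
    (∀ q (v : E.fib q), ∑ i, (l i).toFun q v • s i q = v) ∧
      ∀ t : E.Sections, ∑ i, (l i).toLinear t • s i = t := by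
  obtain ⟨N, s, l, h⟩ := E.exists_dual_basis
  refine ⟨N, s, l, h, fun t => ?_⟩
  ext p
  rw [sections_sum_apply]
  exact h p (t p)

instance : Module.Finite (SmoothRing n M) E.Sections := by
  obtain ⟨N, s, l, -, h⟩ := E.exists_sections_dual_basis
  refine Module.Finite.of_surjective (Fintype.linearCombination (SmoothRing n M) s) fun t =>
    ⟨fun i => (l i).toLinear t, ?_⟩
  rw [Fintype.linearCombination_apply, h]

instance : Module.Projective (SmoothRing n M) E.Sections := by
  obtain ⟨N, s, l, -, h⟩ := E.exists_sections_dual_basis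
  refine Module.Projective.of_split (LinearMap.pi fun i => (l i).toLinear)
    (Fintype.linearCombination (SmoothRing n M) s) (LinearMap.ext fun t => ?_)
  rw [LinearMap.comp_apply, Fintype.linearCombination_apply]
  exact h t

variable (E) in
/-- The fibre of a bundle at `p` is the fibre at `p` of its module of sections. -/
def evalAt (p : M) : FibreAt n p E.Sections (E.fib p) where
  ev := ⟨⟨fun s => s p, rfl⟩, fun _ _ => rfl⟩
  ev_smul _ _ := rfl
  surjective v := by
    obtain ⟨N, s, l, h, -⟩ := E.exists_sections_dual_basis
    refine ⟨∑ i, algebraMap ℝ (SmoothRing n M) ((l i).toFun p v) • s i, ?_⟩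
    change (∑ i, algebraMap ℝ (SmoothRing n M) ((l i).toFun p v) • s i) p = v
    rw [sections_sum_apply]
    conv_rhs => rw [← h p v]
    refine Finset.sum_congr rfl fun i _ => ?_
    rw [smul_apply, algebraMap_smoothRing_apply]
  ker_le t ht := by
    obtain ⟨N, s, l, -, h⟩ := E.exists_sections_dual_basis
    rw [← h t]
    -- The coefficients of t at p depend only on the value of t at p, hence vanish there.
    refine sum_mem fun i _ => Submodule.smul_mem_smul ?_ trivial
    rw [mem_pointIdeal, FiberMap.toLinear_apply]
    exact (congrArg _ (show t p = 0 from ht)).trans (map_zero _)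

@[simp] theorem evalAt_ev (p : M) (s : E.Sections) : (E.evalAt p).ev s = s p := rfl

theorem exists_section (p : M) (v : E.fib p) : ∃ s : E.Sections, s p = v :=
  (E.evalAt p).surjective v

theorem rankAtStalk_sections [ConnectedSpace M] (𝔭 : PrimeSpectrum (SmoothRing n M)) :
    Module.rankAtStalk E.Sections 𝔭 = 7 := by
  rw [(E.evalAt (Classical.arbitrary M)).rankAtStalk_eq, finrank_fib]

/-- A linear isomorphism between modules of sections comes from a bundle isomorphism. -/
theorem exists_iso_mapSections {E' : RankSevenBundle n M}
    (f : E.Sections ≃ₗ[SmoothRing n M] E'.Sections) :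
    ∃ φ : Iso E E', φ.mapSections = f.toLinearMap := by
  have key : ∀ (E E' : RankSevenBundle n M) (f : E.Sections ≃ₗ[SmoothRing n M] E'.Sections),
      ContMDiff ((𝓡 n).prod 𝓘(ℝ, V7)) ((𝓡 n).prod 𝓘(ℝ, V7)) ∞
        fun v : TotalSpace V7 E.fib => (⟨v.1, (E.evalAt v.1).map (E'.evalAt v.1) f.toLinearMap v.2⟩ :
          TotalSpace V7 E'.fib) := by
    intro E E' f v
    obtain ⟨N, s, l, h, -⟩ := E.exists_sections_dual_basis
    -- The fibre maps are finite combinations of fixed smooth sections with smooth functionals as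
    -- coefficients, which makes the map of total spaces smooth.
    have h1 : ∀ q (w : E.fib q), (E.evalAt q).map (E'.evalAt q) f.toLinearMap w =
        ∑ i, (l i).toFun q w • f (s i) q := by
      intro q w
      conv_lhs => rw [← h q w, map_sum]
      refine Finset.sum_congr rfl fun i _ => ?_
      rw [map_smul, ← evalAt_ev, FibreAt.map_ev]
      rfl
    rw [contMDiffAt_totalSpace]
    refine ⟨contMDiffAt_proj E.fib, ?_⟩
    have h2 : ContMDiffAt ((𝓡 n).prod 𝓘(ℝ, V7)) 𝓘(ℝ, V7) ∞ (fun w : TotalSpace V7 E.fib =>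
        ∑ i, (l i).toFun w.1 w.2 • (E'.triv v.1 ⟨w.1, f (s i) w.1⟩).2) v := by
      refine contMDiffAt_finsetSum fun i _ => ((l i).smooth.contMDiffAt).smul ?_
      exact (smoothAt_iff.1 ((f (s i)).contMDiff v.1)).comp v (contMDiffAt_proj E.fib)
    refine h2.congr_of_eventuallyEq ?_
    have h3 : ∀ᶠ w : TotalSpace V7 E.fib in 𝓝 v, w.1 ∈ (E'.triv v.1).baseSet :=
      (FiberBundle.continuous_proj V7 E.fib).continuousAt.eventually_mem
        ((E'.triv v.1).open_baseSet.mem_nhds (E'.mem_triv v.1))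
    filter_upwards [h3] with w hw
    simp only [h1, triv_apply hw]
    change (E'.triv v.1 ⟨w.1, _⟩).2 = _
    rw [triv_apply hw, map_sum]
    simp
  have h2 : ∀ (E E' : RankSevenBundle n M) (f : E.Sections ≃ₗ[SmoothRing n M] E'.Sections) p
      (v : E.fib p), (E'.evalAt p).map (E.evalAt p) f.symm.toLinearMap
        ((E.evalAt p).map (E'.evalAt p) f.toLinearMap v) = v := by
    intro E E' f p v
    obtain ⟨s, rfl⟩ := (E.evalAt p).surjective v
    rw [FibreAt.map_ev, FibreAt.map_ev]
    simp
  refine ⟨⟨fun p => LinearEquiv.ofLinearMap ((E.evalAt p).map (E'.evalAt p) f.toLinearMap)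
    ((E'.evalAt p).map (E.evalAt p) f.symm.toLinearMap) (LinearMap.ext fun v => h2 E' E f.symm p v)
    (LinearMap.ext fun v => h2 E E' f p v), key E E' f, key E' E f.symm⟩, ?_⟩
  refine LinearMap.ext fun s => ?_
  ext p
  exact (E.evalAt p).map_ev (E'.evalAt p) f.toLinearMap s

end RankSevenBundle

end OctG2

namespace OctG2

/-! ## The bundle of a finitely generated projective module of rank seven -/

namespace ModuleBundle

variable {n : ℕ} {M : Type u} [TopologicalSpace M] [ChartedSpace (EuclideanSpace ℝ (Fin n)) M]
  {P : Type*} [AddCommGroup P] [Module (SmoothRing n M) P] {N : ℕ}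
  (l : P →ₗ[SmoothRing n M] (Fin N → SmoothRing n M))

/-- The values at `p` of the coordinates of an element of the module. -/
def evalVec (x : P) (p : M) : Fin N → ℝ := fun i => l x i p

theorem evalVec_add (x y : P) (p : M) : evalVec l (x + y) p = evalVec l x p + evalVec l y p := by
  funext i
  rw [evalVec, map_add]
  rfl

theorem evalVec_smul (f : SmoothRing n M) (x : P) (p : M) :
    evalVec l (f • x) p = f p • evalVec l x p := by
  funext i
  rw [evalVec, map_smul]
  rfl

theorem contMDiff_evalVec (x : P) : ContMDiff (𝓡 n) 𝓘(ℝ, Fin N → ℝ) ∞ (evalVec l x) :=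
  contMDiff_pi_space.2 fun i => (l x i).contMDiff

/-- The space of values at `p`. -/
def valueSpace (p : M) : Submodule ℝ (Fin N → ℝ) where
  carrier := Set.range fun x => evalVec l x p
  add_mem' := by
    rintro _ _ ⟨x, rfl⟩ ⟨y, rfl⟩
    exact ⟨x + y, evalVec_add l x y p⟩
  zero_mem' := ⟨0, by funext i; simp only [evalVec, map_zero]; rfl⟩
  smul_mem' c := by
    rintro _ ⟨x, rfl⟩
    refine ⟨algebraMap ℝ (SmoothRing n M) c • x, ?_⟩
    simp only [evalVec_smul, algebraMap_smoothRing_apply]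

theorem evalVec_mem (x : P) (p : M) : evalVec l x p ∈ valueSpace l p := ⟨x, rfl⟩

theorem exists_evalVec {p : M} (v : valueSpace l p) : ∃ x, evalVec l x p = v.1 := v.2

/-- The fibre of the bundle. -/
abbrev Fib (p : M) : Type u := ULift.{u} (valueSpace l p)

/-- The points over which a linear map to `ℝ⁷` is injective on the fibres. -/
def base (ρ : (Fin N → ℝ) →ₗ[ℝ] V7) : Set M := {q | ∀ v ∈ valueSpace l q, ρ v = 0 → v = 0}

variable {l} (hl : ∀ p, Module.finrank ℝ (valueSpace l p) = 7)

include hl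

theorem exists_equiv {ρ : (Fin N → ℝ) →ₗ[ℝ] V7} {q : M} (hq : q ∈ base l ρ) :
    ∃ e : valueSpace l q ≃ₗ[ℝ] V7, ∀ v, e v = ρ v.1 := by
  have hinj : Function.Injective (ρ.domRestrict (valueSpace l q)) := by
    rw [injective_iff_map_eq_zero]
    exact fun v hv => Subtype.ext (hq v.1 v.2 hv)
  exact ⟨LinearEquiv.ofBijective _ ⟨hinj,
    (LinearMap.injective_iff_surjective_of_finrank_eq_finrank (by rw [hl]; simp)).1 hinj⟩,
    fun _ => rfl⟩

open Classical in
/-- The inverse of a linear map to `ℝ⁷` on a fibre on which it is injective. -/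
def inverse (ρ : (Fin N → ℝ) →ₗ[ℝ] V7) (q : M) : V7 →ₗ[ℝ] valueSpace l q :=
  if h : q ∈ base l ρ then (exists_equiv hl h).choose.symm.toLinearMap else 0

theorem inverse_apply {ρ : (Fin N → ℝ) →ₗ[ℝ] V7} {q : M} (hq : q ∈ base l ρ)
    (v : valueSpace l q) : inverse hl ρ q (ρ v.1) = v := by
  rw [inverse, dif_pos hq, ← (exists_equiv hl hq).choose_spec v]
  exact (exists_equiv hl hq).choose.symm_apply_apply v

theorem apply_inverse {ρ : (Fin N → ℝ) →ₗ[ℝ] V7} {q : M} (hq : q ∈ base l ρ) (v : V7) :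
    ρ (inverse hl ρ q v).1 = v := by
  rw [inverse, dif_pos hq, ← (exists_equiv hl hq).choose_spec]
  exact (exists_equiv hl hq).choose.apply_symm_apply v

/-- Near a point of the base set there is a smooth frame coming from the module. -/
theorem exists_local_frame {ρ : (Fin N → ℝ) →ₗ[ℝ] V7} {p : M} (hp : p ∈ base l ρ) :
    ∃ x : Fin 7 → P, (∀ i, ContMDiff (𝓡 n) 𝓘(ℝ, V7) ∞ fun q => ρ (evalVec l (x i) q)) ∧
      LinearIndependent ℝ (fun i => ρ (evalVec l (x i) p)) ∧
      ∀ᶠ q in 𝓝 p, q ∈ base l ρ ∧ ∀ v ∈ valueSpace l q, ∃ c : V7,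
        v = ∑ i, c i • evalVec l (x i) q := by
  obtain ⟨e, he⟩ := exists_equiv hl hp
  choose x hx using fun i : Fin 7 => exists_evalVec l (e.symm (Pi.single i 1))
  have hsm : ∀ i, ContMDiff (𝓡 n) 𝓘(ℝ, V7) ∞ fun q => ρ (evalVec l (x i) q) := fun i =>
    (LinearMap.toContinuousLinearMap ρ).contDiff.contMDiff.comp (contMDiff_evalVec l (x i))
  have hind : LinearIndependent ℝ (fun i => ρ (evalVec l (x i) p)) := by
    have : (fun i => ρ (evalVec l (x i) p)) = Pi.basisFun ℝ (Fin 7) := by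
      funext i
      rw [hx, ← he, LinearEquiv.apply_symm_apply, Pi.basisFun_apply]
    rw [this]
    exact (Pi.basisFun ℝ (Fin 7)).linearIndependent
  refine ⟨x, hsm, hind, ?_⟩
  have hev : ∀ᶠ q in 𝓝 p, LinearIndependent ℝ (fun i => ρ (evalVec l (x i) q)) := by
    have hc : Continuous fun q => fun i => ρ (evalVec l (x i) q) :=
      continuous_pi fun i => (hsm i).continuous
    exact hc.continuousAt.eventually_mem
      (isOpen_setOfPred_linearIndependent.mem_nhds hind)
  filter_upwards [hev] with q hq
  have hspan : ∀ v ∈ valueSpace l q, ∃ c : V7, v = ∑ i, c i • evalVec l (x i) q := by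
    intro v hv
    have hi : LinearIndependent ℝ fun i => (⟨_, evalVec_mem l (x i) q⟩ : valueSpace l q) :=
      LinearIndependent.of_comp (ρ ∘ₗ (valueSpace l q).subtype) hq
    let b := basisOfLinearIndependentOfCardEqFinrank hi (by rw [hl]; simp)
    refine ⟨b.repr ⟨v, hv⟩, ?_⟩
    have h := congrArg Subtype.val (b.sum_repr ⟨v, hv⟩)
    refine h.symm.trans ?_
    simp [b]
  refine ⟨fun v hv h0 => ?_, hspan⟩
  obtain ⟨c, rfl⟩ := hspan v hv
  rw [map_sum] at h0
  simp only [map_smul] at h0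
  exact Finset.sum_eq_zero fun i _ => by
    rw [Fintype.linearIndependent_iff.1 hq c h0 i, zero_smul]

/-- This rests on the constant fibre dimension: seven values with independent images at p keep
independent images nearby, and therefore span the nearby fibres. -/
theorem isOpen_base (ρ : (Fin N → ℝ) →ₗ[ℝ] V7) : IsOpen (base l ρ) := by
  refine isOpen_iff_mem_nhds.2 fun p hp => ?_
  obtain ⟨x, -, -, h⟩ := exists_local_frame hl hp
  exact h.mono fun q hq => hq.1

/-- A section is smooth if its image under an injective linear map is smooth. -/
theorem contMDiffAt_of_comp {ρ : (Fin N → ℝ) →ₗ[ℝ] V7} {p : M} (hp : p ∈ base l ρ)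
    {s : M → Fin N → ℝ} (hs : ∀ q, s q ∈ valueSpace l q)
    (h : ContMDiffAt (𝓡 n) 𝓘(ℝ, V7) ∞ (fun q => ρ (s q)) p) :
    ContMDiffAt (𝓡 n) 𝓘(ℝ, Fin N → ℝ) ∞ s p := by
  obtain ⟨x, hx, hi, hev⟩ := exists_local_frame hl hp
  have hc : ∀ᶠ q in 𝓝 p, ∃ c : V7, s q = ∑ i, c i • evalVec l (x i) q :=
    hev.mono fun q hq => hq.2 _ (hs q)
  classical
  let c : M → V7 := fun q =>
    if h : ∃ c : V7, s q = ∑ i, c i • evalVec l (x i) q then h.choose else 0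
  have hc' : ∀ᶠ q in 𝓝 p, s q = ∑ i, c q i • evalVec l (x i) q := by
    filter_upwards [hc] with q hq
    simp only [c, dif_pos hq]
    exact hq.choose_spec
  have hcs : ContMDiffAt (𝓡 n) 𝓘(ℝ, V7) ∞ c p := by
    refine contMDiffAt_of_linear_system (fun i => (hx i).contMDiffAt) h hi ?_
    filter_upwards [hc'] with q hq
    rw [hq, map_sum]
    simp only [map_smul]
  refine ContMDiffAt.congr_of_eventuallyEq ?_ hc'
  exact contMDiffAt_finsetSum fun i _ => (contMDiffAt_pi_space.1 hcs i).smul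
    (contMDiff_evalVec l (x i)).contMDiffAt

/-- The pretrivialization defined by a linear map to `ℝ⁷`. -/
def pretriv (ρ : (Fin N → ℝ) →ₗ[ℝ] V7) :
    Pretrivialization V7 (Bundle.TotalSpace.proj : TotalSpace V7 (Fib l) → M) where
  toFun z := (z.1, ρ z.2.down.1)
  invFun z := ⟨z.1, ⟨inverse hl ρ z.1 z.2⟩⟩
  source := Bundle.TotalSpace.proj ⁻¹' base l ρ
  target := base l ρ ×ˢ Set.univ
  map_source' _ hz := ⟨hz, trivial⟩
  map_target' _ hz := hz.1
  left_inv' := by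
    rintro ⟨q, ⟨v⟩⟩ hz
    exact congrArg (fun w => (⟨q, ⟨w⟩⟩ : TotalSpace V7 (Fib l))) (inverse_apply hl hz v)
  right_inv' := by
    rintro ⟨q, v⟩ hz
    exact Prod.ext rfl (apply_inverse hl hz.1 v)
  open_target := (isOpen_base hl ρ).prod isOpen_univ
  baseSet := base l ρ
  open_baseSet := isOpen_base hl ρ
  source_eq := rfl
  target_eq := rfl
  proj_toFun _ _ := rfl

theorem pretriv_symm {ρ : (Fin N → ℝ) →ₗ[ℝ] V7} {q : M} (hq : q ∈ base l ρ) (v : V7) :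
    (pretriv hl ρ).symm q v = ⟨inverse hl ρ q v⟩ :=
  Pretrivialization.symm_apply (pretriv hl ρ) hq v

theorem exists_mem_base (p : M) : ∃ ρ : (Fin N → ℝ) →ₗ[ℝ] V7, p ∈ base l ρ := by
  have e : valueSpace l p ≃ₗ[ℝ] V7 := LinearEquiv.ofFinrankEq _ _ (by rw [hl]; simp)
  obtain ⟨ρ, hρ⟩ := LinearMap.exists_extend e.toLinearMap
  refine ⟨ρ, fun v hv h0 => ?_⟩
  have h : e ⟨v, hv⟩ = ρ v := (LinearMap.congr_fun hρ ⟨v, hv⟩).symm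
  rw [h0] at h
  exact congrArg Subtype.val ((LinearEquiv.map_eq_zero_iff e).1 h)

/-- A linear map to `ℝ⁷` that is injective on the fibre at `p`. -/
def projAt (p : M) : (Fin N → ℝ) →ₗ[ℝ] V7 := (exists_mem_base hl p).choose

theorem mem_base_projAt (p : M) : p ∈ base l (projAt hl p) := (exists_mem_base hl p).choose_spec

/-- The columns of the transition function are the images under ρ' of the sections that ρ maps to
constant basis vectors; these are smooth by `contMDiffAt_of_comp`. -/
theorem exists_coordChange (ρ ρ' : (Fin N → ℝ) →ₗ[ℝ] V7) :
    ∃ f : M → V7 →L[ℝ] V7, ContMDiffOn (𝓡 n) 𝓘(ℝ, V7 →L[ℝ] V7) ∞ f (base l ρ ∩ base l ρ') ∧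
      ∀ q ∈ base l ρ ∩ base l ρ', ∀ v, f q v = (pretriv hl ρ' ⟨q, (pretriv hl ρ).symm q v⟩).2 := by
  refine ⟨fun q => LinearMap.toContinuousLinearMap
    (ρ' ∘ₗ (valueSpace l q).subtype ∘ₗ inverse hl ρ q), fun p hp => ?_, fun q hq v => ?_⟩
  · refine ContMDiffAt.contMDiffWithinAt ?_
    have h : (fun q => LinearMap.toContinuousLinearMap
        (ρ' ∘ₗ (valueSpace l q).subtype ∘ₗ inverse hl ρ q)) = fun q =>
        ∑ i : Fin 7, ContinuousLinearMap.smulRightL ℝ V7 V7 (ContinuousLinearMap.proj i)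
          (ρ' (inverse hl ρ q (Pi.single i 1)).1) := by
      funext q
      refine ContinuousLinearMap.coe_injective (LinearMap.pi_ext' fun j => LinearMap.ext_ring ?_)
      simp [Pi.single_apply]
    rw [h]
    refine contMDiffAt_finsetSum fun i _ => ?_
    have h1 : ContMDiffAt (𝓡 n) 𝓘(ℝ, V7) ∞
        (fun q => ρ' (inverse hl ρ q (Pi.single i 1)).1) p := by
      refine (LinearMap.toContinuousLinearMap ρ').contDiff.contMDiff.contMDiffAt.comp p ?_
      refine contMDiffAt_of_comp hl hp.1 (fun q => (inverse hl ρ q (Pi.single i 1)).2) ?_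
      refine (contMDiffAt_const (c := (Pi.single i 1 : V7))).congr_of_eventuallyEq ?_
      filter_upwards [(isOpen_base hl ρ).mem_nhds hp.1] with q hq
      exact apply_inverse hl hq _
    exact (ContinuousLinearMap.contDiff _).contMDiff.contMDiffAt.comp p h1
  · rw [pretriv_symm hl hq.1]
    rfl

/-- The prebundle of a finitely generated projective module. -/
def prebundle : VectorPrebundle ℝ V7 (Fib l) where
  pretrivializationAtlas := Set.range (pretriv hl)
  pretrivialization_linear' := by
    rintro _ ⟨ρ, rfl⟩
    exact ⟨fun q _ => ⟨fun v w => ρ.map_add _ _, fun c v => ρ.map_smul _ _⟩⟩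
  pretrivializationAt p := pretriv hl (projAt hl p)
  mem_base_pretrivializationAt := mem_base_projAt hl
  pretrivialization_mem_atlas p := ⟨_, rfl⟩
  exists_coordChange := by
    rintro _ ⟨ρ, rfl⟩ _ ⟨ρ', rfl⟩
    obtain ⟨f, hf, h⟩ := exists_coordChange hl ρ ρ'
    exact ⟨f, hf.continuousOn, h⟩
  totalSpaceMk_isInducing p := by
    obtain ⟨e, he⟩ := exists_equiv hl (mem_base_projAt hl p)
    have h : (pretriv hl (projAt hl p)) ∘ (TotalSpace.mk p : Fib l p → TotalSpace V7 (Fib l)) =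
        Prod.mk p ∘ e.toContinuousLinearEquiv ∘ (Homeomorph.ulift : Fib l p ≃ₜ valueSpace l p) := by
      funext v
      exact Prod.ext rfl (he v.down).symm
    rw [h]
    exact (isEmbedding_prodMkRight p).isInducing.comp
      (e.toContinuousLinearEquiv.toHomeomorph.isInducing.comp Homeomorph.ulift.isInducing)

instance : (prebundle hl).IsContMDiff (𝓡 n) ∞ where
  exists_contMDiffCoordChange := by
    rintro _ ⟨ρ, rfl⟩ _ ⟨ρ', rfl⟩
    exact exists_coordChange hl ρ ρ'

/-- The bundle of a finitely generated projective module of rank seven. -/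
def bundle : RankSevenBundle n M :=
  letI := (prebundle hl).totalSpaceTopology
  letI := (prebundle hl).toFiberBundle
  haveI := (prebundle hl).toVectorBundle
  { fib := Fib l
    smoothBundle := (prebundle hl).contMDiffVectorBundle (𝓡 n) }

/-- The smoothness of a section of the bundle. -/
theorem smoothAt_bundle_iff (s : ∀ q, (bundle hl).fib q) (p : M) :
    (bundle hl).SmoothAt s p ↔ ContMDiffAt (𝓡 n) 𝓘(ℝ, Fin N → ℝ) ∞
      (fun q => ((s q : Fib l q).down : Fin N → ℝ)) p := by
  rw [RankSevenBundle.smoothAt_iff]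
  change ContMDiffAt (𝓡 n) 𝓘(ℝ, V7) ∞
    (fun q => projAt hl p ((s q : Fib l q).down : Fin N → ℝ)) p ↔ _
  refine ⟨contMDiffAt_of_comp hl (mem_base_projAt hl p) fun q => (s q : Fib l q).down.2, fun h => ?_⟩
  exact (LinearMap.toContinuousLinearMap (projAt hl p)).contDiff.contMDiff.contMDiffAt.comp p h

/-- The coordinates of a section of the bundle. -/
def coord (s : (bundle hl).Sections) (i : Fin N) : SmoothRing n M :=
  ⟨fun q => (s q : Fib l q).down.1 i, fun p => contMDiffAt_pi_space.1
    ((smoothAt_bundle_iff hl s p).1 (s.contMDiff p)) i⟩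

/-- A finitely generated projective module is the module of sections of its bundle. -/
def sectionsEquiv (m : Fin N → P) (hm : ∀ x, ∑ i, l x i • m i = x) :
    P ≃ₗ[SmoothRing n M] (bundle hl).Sections where
  toFun x := ⟨fun q => (⟨⟨_, evalVec_mem l x q⟩⟩ : Fib l q), fun p =>
    (smoothAt_bundle_iff hl _ p).2 (contMDiff_evalVec l x p)⟩
  map_add' x y := by
    ext p
    exact ULift.down_injective (Subtype.ext (evalVec_add l x y p))
  map_smul' f x := by
    ext p
    exact ULift.down_injective (Subtype.ext (evalVec_smul l f x p))
  invFun s := ∑ i, coord hl s i • m i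
  left_inv x := by
    conv_rhs => rw [← hm x]
    rfl
  right_inv s := by
    ext p
    refine ULift.down_injective (Subtype.ext ?_)
    obtain ⟨y, hy⟩ := exists_evalVec l (s p : Fib l p).down
    have h : ∀ f : Fin N → SmoothRing n M, (∀ i, f i p = l y i p) →
        evalVec l (∑ i, f i • m i) p = evalVec l y p := by
      intro f hf
      have hsum : ∀ g : Fin N → SmoothRing n M,
          evalVec l (∑ i, g i • m i) p = ∑ i, g i p • evalVec l (m i) p := by
        intro g
        funext j
        simp only [evalVec, map_sum, map_smul, Finset.sum_apply, Pi.smul_apply, smul_eq_mul]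
        exact map_sum (ContMDiffMap.evalRingHom (I := 𝓡 n) (I' := 𝓘(ℝ, ℝ)) (n := ∞) (R := ℝ) p) _ _
      conv_rhs => rw [← hm y]
      rw [hsum, hsum]
      simp only [hf]
    exact (h (coord hl s) fun i => (congrFun hy i).symm).trans hy

end ModuleBundle

/-- Every finitely generated projective module of rank seven over `C^∞(M)` is the module of sections
of a bundle. -/
theorem exists_bundle {n : ℕ} {M : Type u} [TopologicalSpace M]
    [ChartedSpace (EuclideanSpace ℝ (Fin n)) M] [ConnectedSpace M]
    (P : Type*) [AddCommGroup P] [Module (SmoothRing n M) P] [Module.Finite (SmoothRing n M) P]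
    [Module.Projective (SmoothRing n M) P]
    (hP : ∀ 𝔭 : PrimeSpectrum (SmoothRing n M), Module.rankAtStalk P 𝔭 = 7) :
    ∃ E : RankSevenBundle n M, Nonempty (P ≃ₗ[SmoothRing n M] E.Sections) := by
  obtain ⟨N, m, l, hm⟩ := exists_dual_basis_of_projective (SmoothRing n M) P
  have hl : ∀ p, Module.finrank ℝ (ModuleBundle.valueSpace l p) = 7 := fun p => by
    -- The space of values at p realizes P / I_p P, so its dimension is the rank of P.
    let F : FibreAt n p P (ModuleBundle.valueSpace l p) :=
      { ev := ⟨⟨fun x => ⟨_, ModuleBundle.evalVec_mem l x p⟩, Subtype.ext (by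
          funext i; simp only [ModuleBundle.evalVec, map_zero]; rfl)⟩,
          fun x y => Subtype.ext (ModuleBundle.evalVec_add l x y p)⟩
        ev_smul := fun f x => Subtype.ext (ModuleBundle.evalVec_smul l f x p)
        surjective := fun v => by
          obtain ⟨x, hx⟩ := ModuleBundle.exists_evalVec l v
          exact ⟨x, Subtype.ext hx⟩
        ker_le := fun x hx => by
          rw [← hm x]
          refine sum_mem fun i _ => Submodule.smul_mem_smul ?_ trivial
          exact mem_pointIdeal.2 (congrFun (congrArg Subtype.val hx) i) }
    rw [← F.rankAtStalk_eq (Classical.arbitrary _), hP]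
  exact ⟨_, ⟨ModuleBundle.sectionsEquiv hl m hm⟩⟩

end OctG2

namespace OctG2

/-! ## Smooth families of cross products -/

namespace CrossProduct

variable {W : Type*} [AddCommGroup W] [Module ℝ W]

/-- A frame carrying the model three-form to the three-form of a cross product. -/
def IsFrame (s : ℤˣ) (Y : CrossProduct ℝ W) (u : V7 ≃ₗ[ℝ] W) : Prop :=
  ∀ x y z, Y.form (u x) (u y) (u z) = (model s).form x y z

/-- Nondegeneracy of the bilinear form of a cross product. -/
def Nondegenerate (Y : CrossProduct ℝ W) : Prop := ∀ w, (∀ w', Y.g w w' = 0) → w = 0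

variable {s : ℤˣ} {Y Y' : CrossProduct ℝ W} {u : V7 ≃ₗ[ℝ] W}

theorem IsFrame.map_g (h : Y.IsFrame s u) (hY : Y.Nondegenerate) (x y : V7) :
    Y.g (u x) (u y) = (model s).g x y := g_eq_of_form s Y hY u h x y

theorem IsFrame.map_c (h : Y.IsFrame s u) (hY : Y.Nondegenerate) (x y : V7) :
    Y.c (u x) (u y) = u ((model s).c x y) :=
  (CrossProduct.map_c (model s) Y hY u h (h.map_g hY) x y).symm

theorem isFrame_transport (s : ℤˣ) (u : V7 ≃ₗ[ℝ] W) : ((model s).transport u).IsFrame s u :=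
  fun x y z => by simp [transport_form]

theorem nondegenerate_transport (s : ℤˣ) (u : V7 ≃ₗ[ℝ] W) :
    ((model s).transport u).Nondegenerate := fun w hw => by
  have h : u.symm w = 0 := model_nondegenerate s _ fun y => by simpa using hw (u y)
  simpa using congrArg u h

end CrossProduct

namespace RankSevenBundle

variable {n : ℕ} {M : Type u} [TopologicalSpace M] [ChartedSpace (EuclideanSpace ℝ (Fin n)) M]
  {E : RankSevenBundle n M}

theorem eventually_linearIndependent {p : M} {t : Fin 7 → ∀ q, E.fib q}
    (ht : ∀ i, E.SmoothAt (t i) p) (hp : LinearIndependent ℝ fun i => t i p) :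
    ∀ᶠ q in 𝓝 p, LinearIndependent ℝ fun i => t i q := by
  have hc : ContinuousAt (fun q => fun i => (E.triv p ⟨q, t i q⟩).2) p :=
    continuousAt_pi.2 fun i => (smoothAt_iff.1 (ht i)).continuousAt
  have h0 : LinearIndependent ℝ fun i => (E.triv p ⟨p, t i p⟩).2 :=
    hp.map' ((E.triv p).linearEquivAt ℝ p (E.mem_triv p)).toLinearMap (LinearEquiv.ker _)
  filter_upwards [hc.eventually_mem (isOpen_setOfPred_linearIndependent.mem_nhds h0),
    (E.triv p).open_baseSet.mem_nhds (E.mem_triv p)] with q hq hq'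
  exact LinearIndependent.of_comp ((E.triv p).linearEquivAt ℝ q hq').toLinearMap hq

/-- A family of cross products on the fibres of a bundle that has smooth local frames. -/
structure IsSmoothModel (s : ℤˣ) (Y : ∀ p, CrossProduct ℝ (E.fib p)) : Prop where
  nondegenerate : ∀ p, (Y p).Nondegenerate
  exists_frame : ∀ p, ∃ u : ∀ q, V7 ≃ₗ[ℝ] E.fib q, (∀ x, E.SmoothAt (fun q => u q x) p) ∧
    ∀ᶠ q in 𝓝 p, (Y q).IsFrame s (u q)

namespace IsSmoothModel

variable {s : ℤˣ} {Y : ∀ p, CrossProduct ℝ (E.fib p)} (hY : IsSmoothModel s Y)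

theorem _root_.OctG2.linearEquiv_eq_sum {W : Type*} [AddCommGroup W] [Module ℝ W]
    (u : V7 →ₗ[ℝ] W) (x : V7) : u x = ∑ i, x i • u (Pi.single i 1) := by
  rw [LinearMap.pi_apply_eq_sum_univ u x]
  refine Finset.sum_congr rfl fun i _ => ?_
  congr 2
  funext j
  simp [Pi.single_apply, eq_comm]

theorem smoothAt_frame_symm {p : M} {u : ∀ q, V7 ≃ₗ[ℝ] E.fib q}
    (hu : ∀ x, E.SmoothAt (fun q => u q x) p) {t : ∀ q, E.fib q} (ht : E.SmoothAt t p) :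
    ContMDiffAt (𝓡 n) 𝓘(ℝ, V7) ∞ (fun q => (u q).symm (t q)) p := by
  refine smoothAt_coeff (t := fun i q => u q (Pi.single i 1)) (fun i => hu _) ?_ ht ?_
  · have := (Pi.basisFun ℝ (Fin 7)).linearIndependent.map' (u p).toLinearMap (LinearEquiv.ker _)
    have h : (fun i => u p (Pi.single i 1)) =
        (u p).toLinearMap ∘ Pi.basisFun ℝ (Fin 7) := by
      funext i
      simp
    rw [h]
    exact this
  · refine Filter.Eventually.of_forall fun q => ?_
    have := linearEquiv_eq_sum (u q).toLinearMap ((u q).symm (t q))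
    simp only [LinearEquiv.coe_coe, LinearEquiv.apply_symm_apply] at this
    exact this.symm

theorem smoothAt_frame_apply {p : M} {u : ∀ q, V7 ≃ₗ[ℝ] E.fib q}
    (hu : ∀ x, E.SmoothAt (fun q => u q x) p) {x : M → V7}
    (hx : ContMDiffAt (𝓡 n) 𝓘(ℝ, V7) ∞ x p) : E.SmoothAt (fun q => u q (x q)) p := by
  refine SmoothAt.congr (SmoothAt.sum_smul (fun i => hu (Pi.single i 1))
    (fun i => contMDiffAt_pi_space.1 hx i)) (Filter.Eventually.of_forall fun q => ?_)
  exact linearEquiv_eq_sum (u q).toLinearMap (x q)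

theorem _root_.OctG2.contMDiffAt_bilinear {p : M} {W : Type*} [NormedAddCommGroup W]
    [NormedSpace ℝ W] (B : V7 →ₗ[ℝ] V7 →ₗ[ℝ] W) {x y : M → V7}
    (hx : ContMDiffAt (𝓡 n) 𝓘(ℝ, V7) ∞ x p) (hy : ContMDiffAt (𝓡 n) 𝓘(ℝ, V7) ∞ y p) :
    ContMDiffAt (𝓡 n) 𝓘(ℝ, W) ∞ (fun q => B (x q) (y q)) p := by
  have h : (fun q => B (x q) (y q)) = fun q => ∑ i, ∑ j,
      (x q i * y q j) • B (Pi.single i 1) (Pi.single j 1) := by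
    funext q
    rw [linearEquiv_eq_sum B (x q), LinearMap.sum_apply]
    refine Finset.sum_congr rfl fun i _ => ?_
    rw [LinearMap.smul_apply, linearEquiv_eq_sum _ (y q), Finset.smul_sum]
    simp only [smul_smul]
  rw [h]
  exact contMDiffAt_finsetSum fun i _ => contMDiffAt_finsetSum fun j _ =>
    ((contMDiffAt_pi_space.1 hx i).mul (contMDiffAt_pi_space.1 hy j)).smul contMDiffAt_const

include hY

/-- `IsFrame` is a condition on the three-form only, but by `IsFrame.map_g` it fixes the metric too.
In the given smooth frame the metric thus has the constant coefficients of the model. -/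
theorem smoothAt_g {p : M} {t t' : ∀ q, E.fib q} (ht : E.SmoothAt t p) (ht' : E.SmoothAt t' p) :
    ContMDiffAt (𝓡 n) 𝓘(ℝ, ℝ) ∞ (fun q => (Y q).g (t q) (t' q)) p := by
  obtain ⟨u, hu, hf⟩ := hY.exists_frame p
  refine (contMDiffAt_bilinear (model s).g (smoothAt_frame_symm hu ht)
    (smoothAt_frame_symm hu ht')).congr_of_eventuallyEq ?_
  filter_upwards [hf] with q hq
  rw [← hq.map_g (hY.nondegenerate q)]
  simp

theorem smoothAt_c {p : M} {t t' : ∀ q, E.fib q} (ht : E.SmoothAt t p) (ht' : E.SmoothAt t' p) :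
    E.SmoothAt (fun q => (Y q).c (t q) (t' q)) p := by
  obtain ⟨u, hu, hf⟩ := hY.exists_frame p
  refine (smoothAt_frame_apply hu (contMDiffAt_bilinear (model s).c (smoothAt_frame_symm hu ht)
    (smoothAt_frame_symm hu ht'))).congr ?_
  filter_upwards [hf] with q hq
  rw [← hq.map_c (hY.nondegenerate q)]
  simp

/-- The cross product of sections. -/
def cross : CrossProduct (SmoothRing n M) E.Sections where
  g := LinearMap.mk₂ _
    (fun t t' => (⟨fun q => (Y q).g (t q) (t' q), fun p =>
      hY.smoothAt_g (t.contMDiff p) (t'.contMDiff p)⟩ : SmoothRing n M))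
    (fun t t' r => by ext q; exact congrArg (· (r q)) ((Y q).g.map_add (t q) (t' q)))
    (fun a t t' => by ext q; exact congrArg (· (t' q)) ((Y q).g.map_smul (a q) (t q)))
    (fun t t' r => by ext q; exact ((Y q).g (t q)).map_add _ _)
    (fun a t t' => by ext q; exact ((Y q).g (t q)).map_smul _ _)
  c := LinearMap.mk₂ _
    (fun t t' => (⟨fun q => (Y q).c (t q) (t' q), fun p =>
      hY.smoothAt_c (t.contMDiff p) (t'.contMDiff p)⟩ : E.Sections))
    (fun t t' r => by ext q; exact congrArg (· (r q)) ((Y q).c.map_add (t q) (t' q)))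
    (fun a t t' => by ext q; exact congrArg (· (t' q)) ((Y q).c.map_smul (a q) (t q)))
    (fun t t' r => by ext q; exact ((Y q).c (t q)).map_add _ _)
    (fun a t t' => by ext q; exact ((Y q).c (t q)).map_smul _ _)
  symm t t' := by ext q; exact (Y q).symm _ _
  self t := by ext q; exact (Y q).self _
  skew t t' r := by ext q; exact (Y q).skew _ _ _
  double t t' := by ext q; exact (Y q).double _ _

theorem cross_g_apply (t t' : E.Sections) (p : M) : hY.cross.g t t' p = (Y p).g (t p) (t' p) := rfl

theorem cross_form_apply (t t' r : E.Sections) (p : M) :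
    hY.cross.form t t' r p = (Y p).form (t p) (t' p) (r p) := rfl

variable [IsManifold (𝓡 n) ∞ M] [T2Space M] [SecondCountableTopology M]

/-- A functional on sections descends to every fibre, where nondegeneracy represents it by a vector;
`smoothAt_of_represents` shows that these vectors form a smooth section. -/
theorem cross_g_bijective : Function.Bijective hY.cross.g := by
  constructor
  · rw [injective_iff_map_eq_zero]
    intro t ht
    ext p
    refine hY.nondegenerate p _ fun w => ?_
    obtain ⟨r, rfl⟩ := exists_section p w
    rw [← hY.cross_g_apply, ht]
    rfl
  · intro ℓ
    let L : ∀ q, E.fib q →ₗ[ℝ] ℝ := fun q => (E.evalAt q).map (FibreAt.self q) ℓ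
    have hL : ∀ (r : E.Sections) q, L q (r q) = ℓ r q := fun r q =>
      (E.evalAt q).map_ev (FibreAt.self q) ℓ r
    have hex : ∀ q, ∃ v : E.fib q, ∀ w, (Y q).g v w = L q w := fun q => by
      have hinj : Function.Injective (Y q).g := by
        rw [injective_iff_map_eq_zero]
        exact fun v hv => hY.nondegenerate q v fun w => by rw [hv, LinearMap.zero_apply]
      obtain ⟨v, hv⟩ := (LinearMap.injective_iff_surjective_of_finrank_eq_finrank
        (Subspace.dual_finrank_eq (K := ℝ) (V := E.fib q)).symm).1 hinj (L q)
      exact ⟨v, fun w => by rw [hv]⟩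
    choose v hv using hex
    have hsm : ∀ p, E.SmoothAt v p := by
      intro p
      choose t ht using fun i : Fin 7 => exists_section p (E.trivFrame p i p)
      have ht1 : ∀ i, E.SmoothAt (t i) p := fun i => (t i).contMDiff p
      have ht2 : LinearIndependent ℝ fun i => t i p := by
        simp only [ht]
        exact linearIndependent_trivFrame (E.mem_triv p)
      refine smoothAt_of_represents ht1 (eventually_linearIndependent ht1 ht2) (fun q => (Y q).g)
        (hY.nondegenerate p) (fun i j => hY.smoothAt_g (ht1 i) (ht1 j)) v fun j => ?_
      simp only [hv, hL]
      exact (ℓ (t j)).contMDiff p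
    refine ⟨⟨v, hsm⟩, LinearMap.ext fun r => ?_⟩
    ext p
    rw [← hL]
    exact hv p (r p)

end IsSmoothModel

end RankSevenBundle

/-! ## Alternating forms on `ℝ⁷` -/

/-- Sorting a triple of distinct indices changes the values of both forms by the same sign. -/
theorem alternating_ext {f g : V7 [⋀^Fin 3]→ₗ[ℝ] ℝ}
    (h : ∀ i j k : Fin 7, i < j → j < k → f ![Pi.single i 1, Pi.single j 1, Pi.single k 1] =
      g ![Pi.single i 1, Pi.single j 1, Pi.single k 1]) : f = g := by
  refine Module.Basis.ext_alternating (Pi.basisFun ℝ (Fin 7)) fun v hv => ?_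
  have hσ : StrictMono (v ∘ Tuple.sort v) :=
    (Tuple.monotone_sort v).strictMono_of_injective (hv.comp (Tuple.sort v).injective)
  have h1 : f (fun i => Pi.basisFun ℝ (Fin 7) ((v ∘ Tuple.sort v) i)) =
      g (fun i => Pi.basisFun ℝ (Fin 7) ((v ∘ Tuple.sort v) i)) := by
    have h2 : (fun i => Pi.basisFun ℝ (Fin 7) ((v ∘ Tuple.sort v) i)) =
        ![Pi.single ((v ∘ Tuple.sort v) 0) 1, Pi.single ((v ∘ Tuple.sort v) 1) 1,
          Pi.single ((v ∘ Tuple.sort v) 2) 1] := by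
      funext i
      fin_cases i <;> simp
    rw [h2]
    exact h _ _ _ (hσ (by decide)) (hσ (by decide))
  have h3 := f.map_perm (fun i => Pi.basisFun ℝ (Fin 7) (v i)) (Tuple.sort v)
  have h4 := g.map_perm (fun i => Pi.basisFun ℝ (Fin 7) (v i)) (Tuple.sort v)
  have h5 : Equiv.Perm.sign (Tuple.sort v) • f (fun i => Pi.basisFun ℝ (Fin 7) (v i)) =
      Equiv.Perm.sign (Tuple.sort v) • g (fun i => Pi.basisFun ℝ (Fin 7) (v i)) :=
    h3.symm.trans (h1.trans h4)
  exact smul_left_cancel _ h5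

end OctG2

/-! ### The fibrewise cross products of formal structures -/

namespace OctG2

theorem mem_G2_iff {g : V7 ≃ₗ[ℝ] V7} :
    g ∈ G2 ↔ ∀ x y z, (model 1).form (g x) (g y) (g z) = (model 1).form x y z := by
  constructor
  · intro h x y z
    have h1 := DFunLike.congr_fun (show phi0.compLinearMap g.toLinearMap = phi0 from h) ![x, y, z]
    rw [AlternatingMap.compLinearMap_apply, ← model_one_form, ← model_one_form] at h1
    exact h1
  · intro h
    refine AlternatingMap.ext fun v => ?_
    rw [AlternatingMap.compLinearMap_apply, ← model_one_form, ← model_one_form]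
    exact h _ _ _

variable {n : ℕ} {M : Type u} [TopologicalSpace M] [ChartedSpace (EuclideanSpace ℝ (Fin n)) M]

namespace FormalG2Structure

variable (P : FormalG2Structure n M)

theorem exists_mem_frames (p : M) : ∃ u, u ∈ P.frames p := by
  obtain ⟨U, -, hp, u, hu, -⟩ := P.exists_local_frame p
  exact ⟨u p, hu p hp⟩

/-- The cross product on the fibre at `p`. -/
def fibreCross (p : M) : CrossProduct ℝ (P.bundle.fib p) :=
  (model 1).transport (P.exists_mem_frames p).choose

/-- The fibres of a reduction are full orbits of the stabilizer of φ₀, so they contain every frame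
that induces the same three-form. In particular the frame chosen in `fibreCross` is immaterial. -/
theorem mem_frames_iff {p : M} {u : V7 ≃ₗ[ℝ] P.bundle.fib p} :
    u ∈ P.frames p ↔ (P.fibreCross p).IsFrame 1 u := by
  have h0 := CrossProduct.isFrame_transport 1 (P.exists_mem_frames p).choose
  rw [P.orbit p _ (P.exists_mem_frames p).choose_spec u]
  constructor
  · rintro ⟨g, hg, rfl⟩ x y z
    exact (h0 _ _ _).trans (mem_G2_iff.1 hg x y z)
  · intro h
    refine ⟨u.trans (P.exists_mem_frames p).choose.symm, mem_G2_iff.2 fun x y z => ?_, ?_⟩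
    · have := h x y z
      rw [fibreCross, CrossProduct.transport_form] at this
      exact this
    · ext x
      simp

theorem isSmoothModel : RankSevenBundle.IsSmoothModel 1 P.fibreCross where
  nondegenerate p := CrossProduct.nondegenerate_transport _ _
  exists_frame p := by
    obtain ⟨U, hU, hp, u, hu, hs⟩ := P.exists_local_frame p
    refine ⟨u, fun x => (hs x).contMDiffAt (hU.mem_nhds hp), ?_⟩
    filter_upwards [hU.mem_nhds hp] with q hq
    exact P.mem_frames_iff.1 (hu q hq)

theorem form_eq {p : M} {u : V7 ≃ₗ[ℝ] P.bundle.fib p} (hu : u ∈ P.frames p)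
    (s : Fin 3 → P.bundle.Sections) :
    P.isSmoothModel.cross.form (s 0) (s 1) (s 2) p = phi0 fun i => u.symm (s i p) := by
  rw [← model_one_form, ← P.mem_frames_iff.1 hu]
  simp only [LinearEquiv.apply_symm_apply]
  rfl

end FormalG2Structure

namespace FormalSplitG2Structure

variable (S : FormalSplitG2Structure n M)

/-- The cross product on the fibre at `p`. -/
def fibreCross (p : M) : CrossProduct ℝ (S.bundle.fib p) :=
  (model (-1)).transport (S.exists_frame p).choose

theorem form_apply (s : Fin 3 → S.bundle.Sections) (p : M) :
    S.form s p = (S.fibreCross p).form (s 0 p) (s 1 p) (s 2 p) := by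
  rw [(S.exists_frame p).choose_spec, fibreCross, CrossProduct.transport_form, ← model_neg_one_form]

theorem orbitMap_zero (i j k : Fin 7) : orbitMap 0 i j k = if i < j ∧ j < k then
    (model (-1)).form (Pi.single i 1) (Pi.single j 1) (Pi.single k 1) else 0 := by
  have h0 : orbitInverse 0 = 0 := by simpa using orbitInverse_smul 0 0
  simp only [orbitMap, h0, Pi.zero_apply, add_zero]

/-- A frame whose form has the components of a moved model frame is obtained from it. -/
theorem exists_equiv_of_components {W : Type*} [AddCommGroup W] [Module ℝ W]
    (hW : Module.finrank ℝ W = 7) (u₀ : V7 ≃ₗ[ℝ] W) {A : Fin 7 → V7} {t : Fin 7 → W}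
    (hA : LinearIndependent ℝ A) (ht : LinearIndependent ℝ t)
    (h : ∀ i j k, i < j → j < k → (model (-1)).form (A i) (A j) (A k) =
      ((model (-1)).transport u₀).form (t i) (t j) (t k)) :
    ∃ u : V7 ≃ₗ[ℝ] W, (∀ i, u (A i) = t i) ∧ ((model (-1)).transport u₀).IsFrame (-1) u := by
  have : FiniteDimensional ℝ W := Module.finite_of_finrank_pos (by omega)
  let a := basisOfLinearIndependentOfCardEqFinrank hA (by simp)
  let b := basisOfLinearIndependentOfCardEqFinrank ht (by simp [hW])
  have ha : ∀ i, a.equivFun.symm (Pi.single i 1) = A i := fun i => by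
    simp [Module.Basis.equivFun_symm_apply, Pi.single_apply, a]
  have hb : ∀ i, b.equivFun.symm (Pi.single i 1) = t i := fun i => by
    simp [Module.Basis.equivFun_symm_apply, Pi.single_apply, b]
  refine ⟨a.equivFun.trans b.equivFun.symm, fun i => ?_, fun x y z => ?_⟩
  · rw [← ha, LinearEquiv.trans_apply, LinearEquiv.apply_symm_apply, hb]
  · have key : sigma0.compLinearMap (u₀.symm.toLinearMap ∘ₗ b.equivFun.symm.toLinearMap) =
        sigma0.compLinearMap a.equivFun.symm.toLinearMap := by
      refine alternating_ext fun i j k hij hjk => ?_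
      simp only [AlternatingMap.compLinearMap_apply, ← model_neg_one_form]
      have := h i j k hij hjk
      rw [CrossProduct.transport_form] at this
      simp only [Matrix.cons_val, LinearMap.comp_apply, LinearEquiv.coe_coe, ha, hb]
      exact this.symm
    have h1 := DFunLike.congr_fun key ![a.equivFun x, a.equivFun y, a.equivFun z]
    simp only [AlternatingMap.compLinearMap_apply, ← model_neg_one_form, Matrix.cons_val,
      LinearMap.comp_apply, LinearEquiv.coe_coe, LinearEquiv.symm_apply_apply] at h1
    rw [CrossProduct.transport_form]
    exact h1

variable [IsManifold (𝓡 n) ∞ M] [T2Space M] [SecondCountableTopology M]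

/-- The frame at p extends to smooth sections t. The coefficients T of the form in t are smooth and
agree at p with those of σ₀, so openness of the orbit gives smooth vectors X of ℝ⁷ on which σ₀ has
the coefficients T. The map sending X to t is then a frame that depends smoothly on the point. -/
theorem isSmoothModel : RankSevenBundle.IsSmoothModel (-1) S.fibreCross where
  nondegenerate p := CrossProduct.nondegenerate_transport _ _
  exists_frame p := by
    let u₀ := fun q => (S.exists_frame q).choose
    choose t ht using fun i : Fin 7 => RankSevenBundle.exists_section p (u₀ p (Pi.single i 1))
    have ht1 : ∀ i, S.bundle.SmoothAt (t i) p := fun i => (t i).contMDiff p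
    have ht2 : LinearIndependent ℝ fun i => t i p := by
      have h : (fun i => t i p) = (u₀ p).toLinearMap ∘ Pi.basisFun ℝ (Fin 7) := by
        funext i
        simp [ht]
      rw [h]
      exact (Pi.basisFun ℝ (Fin 7)).linearIndependent.map' _ (LinearEquiv.ker _)
    let T : M → Fin 7 → Fin 7 → Fin 7 → ℝ := fun q i j k =>
      if i < j ∧ j < k then S.form ![t i, t j, t k] q else 0
    have hT : ContMDiff (𝓡 n) 𝓘(ℝ, Fin 7 → Fin 7 → Fin 7 → ℝ) ∞ T := by
      refine contMDiff_pi_space.2 fun i => contMDiff_pi_space.2 fun j => contMDiff_pi_space.2 fun k => ?_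
      by_cases h : i < j ∧ j < k
      · simp only [T, if_pos h]
        exact (S.form ![t i, t j, t k]).contMDiff
      · simp only [T, if_neg h]
        exact contMDiff_const
    have hTp : T p = orbitMap 0 := by
      funext i j k
      rw [orbitMap_zero]
      by_cases h : i < j ∧ j < k
      · simp only [T, if_pos h]
        rw [form_apply, fibreCross, CrossProduct.transport_form]
        simp only [Matrix.cons_val, ht, u₀, LinearEquiv.symm_apply_apply]
      · simp only [T, if_neg h]
    obtain ⟨X, hX, hX0, hXf⟩ := exists_smooth_frame_of_form
    have hXT : ContMDiffAt (𝓡 n) 𝓘(ℝ, Fin 7 → V7) ∞ (fun q => X (T q)) p := by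
      rw [← hTp] at hX
      exact hX.contMDiffAt.comp p hT.contMDiffAt
    have hXT0 : LinearIndependent ℝ (X (T p)) := by
      have h : X (T p) = Pi.basisFun ℝ (Fin 7) := by
        rw [hTp, hX0]
        funext i
        simp
      rw [h]
      exact (Pi.basisFun ℝ (Fin 7)).linearIndependent
    have e1 := RankSevenBundle.eventually_linearIndependent ht1 ht2
    have e2 : ∀ᶠ q in 𝓝 p, LinearIndependent ℝ (X (T q)) :=
      hXT.continuousAt.eventually_mem (isOpen_setOfPred_linearIndependent.mem_nhds hXT0)
    have e3 : ∀ᶠ q in 𝓝 p, ∀ i j k, i < j → j < k →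
        (model (-1)).form (X (T q) i) (X (T q) j) (X (T q) k) = T q i j k := by
      rw [← hTp] at hXf
      exact hT.continuous.continuousAt.eventually hXf
    -- Away from p the given pointwise frame serves as a default value.
    have hex : ∀ q, ∃ u : V7 ≃ₗ[ℝ] S.bundle.fib q, LinearIndependent ℝ (fun i => t i q) →
        LinearIndependent ℝ (X (T q)) → (∀ i j k, i < j → j < k →
          (model (-1)).form (X (T q) i) (X (T q) j) (X (T q) k) = T q i j k) →
        (∀ i, u (X (T q) i) = t i q) ∧ (S.fibreCross q).IsFrame (-1) u := by
      intro q
      by_cases h : LinearIndependent ℝ (fun i => t i q) ∧ LinearIndependent ℝ (X (T q)) ∧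
        ∀ i j k, i < j → j < k →
          (model (-1)).form (X (T q) i) (X (T q) j) (X (T q) k) = T q i j k
      · obtain ⟨u, hu⟩ := exists_equiv_of_components (RankSevenBundle.finrank_fib q) (u₀ q) h.2.1 h.1
          fun i j k hij hjk => by
            rw [h.2.2 i j k hij hjk]
            simp only [T, if_pos (And.intro hij hjk)]
            exact S.form_apply _ _
        exact ⟨u, fun _ _ _ => hu⟩
      · exact ⟨u₀ q, fun h1 h2 h3 => (h ⟨h1, h2, h3⟩).elim⟩
    choose u hu using hex
    refine ⟨u, fun x => ?_, ?_⟩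
    -- The coordinates of the fixed vector x in the moving basis X are smooth, and the frame maps x
    -- to the combination of the sections t with these coordinates.
    · have hc : ∀ q, ∃ c : V7, LinearIndependent ℝ (X (T q)) → ∑ i, c i • X (T q) i = x := by
        intro q
        by_cases h : LinearIndependent ℝ (X (T q))
        · let a := basisOfLinearIndependentOfCardEqFinrank h (by simp)
          refine ⟨a.repr x, fun _ => ?_⟩
          have := a.sum_repr x
          simpa [a] using this
        · exact ⟨0, fun h' => (h h').elim⟩
      choose c hc using hc
      have hcs : ContMDiffAt (𝓡 n) 𝓘(ℝ, V7) ∞ c p :=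
        contMDiffAt_of_linear_system (A := fun q => X (T q)) (b := fun _ => x)
          (fun i => contMDiffAt_pi_space.1 hXT i) contMDiffAt_const hXT0 (e2.mono fun q hq => hc q hq)
      refine (RankSevenBundle.SmoothAt.sum_smul ht1
        (fun i => contMDiffAt_pi_space.1 hcs i)).congr ?_
      filter_upwards [e1, e2, e3] with q h1 h2 h3
      conv_lhs => rw [← hc q h2, map_sum]
      simp only [map_smul, (hu q h1 h2 h3).1]
    · filter_upwards [e1, e2, e3] with q h1 h2 h3
      exact (hu q h1 h2 h3).2

theorem form_eq (s : Fin 3 → S.bundle.Sections) :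
    S.isSmoothModel.cross.form (s 0) (s 1) (s 2) = S.form s := by
  ext p
  rw [form_apply]
  rfl

end FormalSplitG2Structure

end OctG2

namespace OctG2

/-! ## Local normal form of cross products on modules of sections -/

/-- The function x^(-1/2), cut off so that its support stays within a/2 of a and hence away from 0.
Being smooth on all of ℝ, it normalizes global sections without leaving C^∞(M). -/
theorem exists_smooth_rsqrt {a : ℝ} (ha : 0 < a) :
    ∃ ψ : ℝ → ℝ, ContDiff ℝ ∞ ψ ∧ ∀ᶠ x in 𝓝 a, ψ x * ψ x * x = 1 := by
  let χ : ContDiffBump a := ⟨a / 4, a / 2, by positivity, by linarith⟩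
  refine ⟨fun x => χ x * (√x)⁻¹, contDiff_iff_contDiffAt.2 fun x => ?_, ?_⟩
  · rcases lt_or_ge 0 x with hx | hx
    · exact χ.contDiff.contDiffAt.mul
        ((Real.contDiffAt_sqrt hx.ne').inv (Real.sqrt_pos.2 hx).ne')
    · have h : x ∉ tsupport χ := by
        rw [χ.tsupport_eq, Metric.mem_closedBall, Real.dist_eq, not_le]
        have : (a : ℝ) / 2 < |x - a| := by
          rw [abs_of_nonpos (by linarith)]; linarith
        exact this
      refine (contDiffAt_const (c := (0 : ℝ))).congr_of_eventuallyEq ?_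
      filter_upwards [(isClosed_tsupport χ).isOpen_compl.mem_nhds h] with y hy
      rw [image_eq_zero_of_notMem_tsupport hy, zero_mul]
  · filter_upwards [χ.eventuallyEq_one, lt_mem_nhds ha] with x h1 hx
    rw [h1, Pi.one_apply, one_mul, ← mul_inv, Real.mul_self_sqrt hx.le, inv_mul_cancel₀ hx.ne']

section

variable {n : ℕ} {M : Type u} [TopologicalSpace M] [ChartedSpace (EuclideanSpace ℝ (Fin n)) M]

theorem exists_normalizer (f : SmoothRing n M) (p : M) (s : ℤˣ) (h : 0 < ((s : ℤ) : ℝ) * f p) :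
    ∃ r : SmoothRing n M, ∀ᶠ q in 𝓝 p, r q * r q * f q = (s : ℤ) := by
  obtain ⟨ψ, hψ, he⟩ := exists_smooth_rsqrt h
  have hc : ContMDiff (𝓡 n) 𝓘(ℝ, ℝ) ∞ fun q => ((s : ℤ) : ℝ) * f q :=
    contMDiff_const.mul f.contMDiff
  refine ⟨⟨fun q => ψ (((s : ℤ) : ℝ) * f q), hψ.contMDiff.comp hc⟩, ?_⟩
  filter_upwards [hc.continuous.continuousAt.eventually he] with q hq
  change ψ _ * ψ _ * f q = _
  have hs : ((s : ℤ) : ℝ) * ((s : ℤ) : ℝ) = 1 := by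
    rw [← Int.cast_mul, ← Units.val_mul, Int.units_mul_self]; simp
  linear_combination ((s : ℤ) : ℝ) * hq - ψ (((s : ℤ) : ℝ) * f q) * ψ (((s : ℤ) : ℝ) * f q) * f q * hs

end

namespace CrossProduct

variable {W : Type*} [AddCommGroup W] [Module ℝ W] {Y : CrossProduct ℝ W}

/-- The product of two orthogonal vectors of negative length has positive length, so g cannot be
negative definite. -/
theorem exists_positive [FiniteDimensional ℝ W] (hY : Y.Nondegenerate)
    (hW : Module.finrank ℝ W = 7) : ∃ a, 0 < Y.g a a := by
  obtain ⟨x, -, hx⟩ := Y.exists_nonisotropic hY (ι := Empty) (fun i => i.elim) (fun i => i.elim)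
    (fun i => i.elim) (by simp [hW])
  obtain ⟨y, hxy, hy⟩ := Y.exists_nonisotropic hY (ι := Unit) (fun _ => x) (fun _ => hx)
    (fun i j h => (h rfl).elim) (by simp [hW])
  rcases lt_or_gt_of_ne hx with hx' | hx'
  · rcases lt_or_gt_of_ne hy with hy' | hy'
    · refine ⟨Y.c x y, ?_⟩
      rw [Y.g_c_c, hxy (), zero_mul, sub_zero]
      exact mul_pos_of_neg_of_neg hx' hy'
    · exact ⟨y, hy'⟩
  · exact ⟨x, hx'⟩

theorem g_c_self (Y : CrossProduct ℝ W) (a b : W) : Y.g a (Y.c a b) = 0 := by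
  rw [Y.symm, Y.g_c_left]

theorem g_c_self' (Y : CrossProduct ℝ W) (a b : W) : Y.g b (Y.c a b) = 0 := by
  rw [Y.symm, Y.g_c_right]

theorem exists_orthogonal [FiniteDimensional ℝ W] (hY : Y.Nondegenerate)
    (hW : Module.finrank ℝ W = 7) {a b : W} (ha : Y.g a a ≠ 0) (hb : Y.g b b ≠ 0)
    (hab : Y.g a b = 0) :
    ∃ d, Y.g a d = 0 ∧ Y.g b d = 0 ∧ Y.g (Y.c a b) d = 0 ∧ Y.g d d ≠ 0 := by
  have hc : Y.g (Y.c a b) (Y.c a b) ≠ 0 := by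
    rw [Y.g_c_c, hab, zero_mul, sub_zero]
    exact mul_ne_zero ha hb
  obtain ⟨d, h, hd⟩ := Y.exists_nonisotropic hY ![a, b, Y.c a b]
    (by intro i; fin_cases i; exacts [ha, hb, hc])
    (by
      intro i j hij
      have hba : Y.g b a = 0 := by rw [Y.symm, hab]
      fin_cases i <;> fin_cases j <;>
        first
          | exact (hij rfl).elim
          | exact hab
          | exact hba
          | exact Y.g_c_self a b
          | exact Y.g_c_self' a b
          | exact Y.g_c_left a b
          | exact Y.g_c_right a b)
    (by simp [hW])
  exact ⟨d, h 0, h 1, h 2, hd⟩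

/-- If b and d are both negative, with d orthogonal to a, b and c(a, b), then c(b, d) is positive,
and cyclicity of the three-form makes it orthogonal to a. -/
theorem exists_positive_orthogonal [FiniteDimensional ℝ W] (hY : Y.Nondegenerate)
    (hW : Module.finrank ℝ W = 7) {a : W} (ha : 0 < Y.g a a) :
    ∃ b, 0 < Y.g b b ∧ Y.g a b = 0 := by
  obtain ⟨b, hab, hb⟩ := Y.exists_nonisotropic hY (ι := Unit) (fun _ => a) (fun _ => ha.ne')
    (fun i j h => (h rfl).elim) (by simp [hW])
  have hab := hab ()
  obtain ⟨d, had, hbd, hcd, hd⟩ := exists_orthogonal hY hW ha.ne' hb hab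
  rcases lt_or_gt_of_ne hb with hb' | hb'
  · rcases lt_or_gt_of_ne hd with hd' | hd'
    · refine ⟨Y.c b d, ?_, ?_⟩
      · rw [Y.g_c_c, hbd, zero_mul, sub_zero]
        exact mul_pos_of_neg_of_neg hb' hd'
      · have h := Y.form_cyclic a b d
        rw [form, form, hcd] at h
        rw [Y.symm, ← h]
    · exact ⟨d, hd', had⟩
  · exact ⟨b, hb', hab⟩

end CrossProduct

section Normalize

variable {n : ℕ} {M : Type u} [TopologicalSpace M] [ChartedSpace (EuclideanSpace ℝ (Fin n)) M]
  [IsManifold (𝓡 n) ∞ M] [T2Space M] [SecondCountableTopology M]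
  {E : RankSevenBundle n M} (X : CrossProduct (SmoothRing n M) E.Sections)

open RankSevenBundle

/-- The cross product on the fibre at `q` of a cross product of sections. -/
abbrev fibreCross (q : M) : CrossProduct ℝ (E.fib q) := (E.evalAt q).cross X

variable {X} in
theorem nondegenerate_fibreCross (hX : Function.Surjective X.g) (q : M) :
    (fibreCross X q).Nondegenerate := (E.evalAt q).cross_nondegenerate X hX

theorem fibreCross_g (x y : E.Sections) (q : M) :
    (fibreCross X q).g (x q) (y q) = X.g x y q := (E.evalAt q).cross_g X x y

theorem fibreCross_c (x y : E.Sections) (q : M) :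
    (fibreCross X q).c (x q) (y q) = X.c x y q := (E.evalAt q).cross_c X x y

theorem fibreCross_form (x y z : E.Sections) (q : M) :
    (fibreCross X q).form (x q) (y q) (z q) = X.form x y z q := (E.evalAt q).cross_form X x y z

theorem exists_normalized (x : E.Sections) (p : M) (s : ℤˣ)
    (h : 0 < ((s : ℤ) : ℝ) * (fibreCross X p).g (x p) (x p)) :
    ∃ r : SmoothRing n M, ∀ᶠ q in 𝓝 p, (fibreCross X q).g ((r • x) q) ((r • x) q) = (s : ℤ) := by
  rw [fibreCross_g] at h
  obtain ⟨r, hr⟩ := exists_normalizer _ p s h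
  refine ⟨r, hr.mono fun q hq => ?_⟩
  rw [RankSevenBundle.smul_apply, map_smul, map_smul, LinearMap.smul_apply, fibreCross_g, ← hq]
  simp only [smul_eq_mul]
  ring

variable {X} in
/-- Near every point there are global sections generating an adapted frame. -/
theorem exists_isTriple (hX : Function.Surjective X.g) (p : M) :
    ∃ (s : ℤˣ) (a b d : E.Sections), ∀ᶠ q in 𝓝 p,
      (fibreCross X q).IsTriple s (a q) (b q) (d q) := by
  have hY := nondegenerate_fibreCross hX p
  have hW := finrank_fib (E := E) p
  obtain ⟨a₀, ha₀⟩ := CrossProduct.exists_positive hY hW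
  obtain ⟨a', rfl⟩ := exists_section p a₀
  obtain ⟨r, hr⟩ := exists_normalized X a' p 1 (by simpa using ha₀)
  set a := r • a' with ha
  simp only [Units.val_one, Int.cast_one] at hr
  obtain ⟨b₀, hb₀, hab₀⟩ := CrossProduct.exists_positive_orthogonal hY hW
    (a := a p) (by rw [hr.self_of_nhds]; exact one_pos)
  obtain ⟨b'', rfl⟩ := exists_section p b₀
  -- One Gram–Schmidt step with global sections: it is exact near p, where a has length 1, and
  -- leaves the value at p unchanged.
  let b' := b'' - X.g a b'' • a
  have hb' : ∀ q, b' q = b'' q - (fibreCross X q).g (a q) (b'' q) • a q := fun q => by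
    rw [fibreCross_g]; rfl
  have hb'p : b' p = b'' p := by rw [hb', hab₀, zero_smul, sub_zero]
  obtain ⟨r', hr'⟩ := exists_normalized X b' p 1 (by rw [hb'p]; simpa using hb₀)
  set b := r' • b' with hb
  simp only [Units.val_one, Int.cast_one] at hr'
  have hab : ∀ᶠ q in 𝓝 p, (fibreCross X q).g (a q) (b q) = 0 := by
    filter_upwards [hr] with q hq
    rw [hb, RankSevenBundle.smul_apply r' b' q, map_smul, hb', map_sub, map_smul, hq]
    simp
  obtain ⟨d₀, had₀, hbd₀, hcd₀, hd₀⟩ := CrossProduct.exists_orthogonal hY hW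
    (a := a p) (b := b p) (by rw [hr.self_of_nhds]; exact one_ne_zero)
    (by rw [hr'.self_of_nhds]; exact one_ne_zero) hab.self_of_nhds
  obtain ⟨d'', rfl⟩ := exists_section p d₀
  let d' := d'' - X.g a d'' • a - X.g b d'' • b - X.g (X.c a b) d'' • X.c a b
  have hd' : ∀ q, d' q = d'' q - (fibreCross X q).g (a q) (d'' q) • a q -
      (fibreCross X q).g (b q) (d'' q) • b q -
      (fibreCross X q).g ((fibreCross X q).c (a q) (b q)) (d'' q) •
        (fibreCross X q).c (a q) (b q) := fun q => by
    rw [fibreCross_c, fibreCross_g, fibreCross_g, fibreCross_g]; rfl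
  have hd'p : d' p = d'' p := by
    rw [hd', had₀, hbd₀, hcd₀]
    simp only [zero_smul, sub_zero]
  -- The sign of the cross product near p is the sign of the length of the third vector.
  obtain ⟨s, hs⟩ : ∃ s : ℤˣ, 0 < ((s : ℤ) : ℝ) * (fibreCross X p).g (d'' p) (d'' p) := by
    rcases lt_or_gt_of_ne hd₀ with h | h
    · exact ⟨-1, by simpa using h⟩
    · exact ⟨1, by simpa using h⟩
  obtain ⟨r'', hr''⟩ := exists_normalized X d' p s (by rw [hd'p]; exact hs)
  refine ⟨s, a, b, r'' • d', ?_⟩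
  filter_upwards [hr, hr', hab, hr''] with q haa hbb hab hdd
  have hba : (fibreCross X q).g (b q) (a q) = 0 := by rw [CrossProduct.symm, hab]
  have hcc : (fibreCross X q).g ((fibreCross X q).c (a q) (b q)) ((fibreCross X q).c (a q) (b q)) =
      1 := by rw [CrossProduct.g_c_c, haa, hbb, hab]; norm_num
  refine ⟨haa, hbb, hdd, hab, ?_, ?_, ?_⟩
  · rw [RankSevenBundle.smul_apply r'' d' q, map_smul, hd']
    simp only [map_sub, map_smul, haa, hab, CrossProduct.g_c_self, smul_eq_mul]
    ring
  · rw [RankSevenBundle.smul_apply r'' d' q, map_smul, hd']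
    simp only [map_sub, map_smul, hbb, hba, CrossProduct.g_c_self', smul_eq_mul]
    ring
  · rw [RankSevenBundle.smul_apply r'' d' q, map_smul, hd']
    simp only [map_sub, map_smul, hcc, CrossProduct.g_c_left, CrossProduct.g_c_right, smul_eq_mul]
    ring

/-- A cross product of sections that is modelled on the cross product of sign `s`. -/
structure IsModelled (s : ℤˣ) : Prop where
  exists_frame : ∀ p, ∃ U : Set M, IsOpen U ∧ p ∈ U ∧ ∃ (t : Fin 7 → E.Sections)
    (u : ∀ q, V7 ≃ₗ[ℝ] E.fib q), ∀ q ∈ U, (∀ x, u q x = ∑ i, x i • t i q) ∧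
      (fibreCross X q).IsFrame s (u q)

variable {X} in
theorem exists_local_modelled (hX : Function.Surjective X.g) (p : M) :
    ∃ (s : ℤˣ) (U : Set M), IsOpen U ∧ p ∈ U ∧ ∃ (t : Fin 7 → E.Sections)
    (u : ∀ q, V7 ≃ₗ[ℝ] E.fib q), ∀ q ∈ U, (∀ x, u q x = ∑ i, x i • t i q) ∧
      (fibreCross X q).IsFrame s (u q) := by
  obtain ⟨s, a, b, d, h⟩ := exists_isTriple hX p
  obtain ⟨U, hU, hUo, hp⟩ := eventually_nhds_iff.1 h
  have ht : ∀ q i, (fibreCross X q).tripleFrame (a q) (b q) (d q) i = (![a, b, X.c a b, d, X.c a d,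
      X.c b d, X.c a (X.c b d)] : Fin 7 → E.Sections) i q := by
    intro q i
    simp only [CrossProduct.tripleFrame, fibreCross_c]
    fin_cases i <;> rfl
  have hex : ∀ q, ∃ u : V7 ≃ₗ[ℝ] E.fib q, q ∈ U → (∀ x, u x = ∑ i, x i • (![a, b, X.c a b, d,
      X.c a d, X.c b d, X.c a (X.c b d)] : Fin 7 → E.Sections) i q) ∧
      (fibreCross X q).IsFrame s u := by
    intro q
    by_cases hq : q ∈ U
    · obtain ⟨u, hu, hg, hc⟩ := (hU q hq).exists_equiv (finrank_fib q)
      refine ⟨u, fun _ => ⟨fun x => ?_, fun x y z => ?_⟩⟩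
      · simp only [hu, ht]
      · rw [CrossProduct.form, hc, hg]; rfl
    · exact ⟨LinearEquiv.ofFinrankEq _ _ (by rw [finrank_fib]; simp), fun h => (hq h).elim⟩
  choose u hu using hex
  exact ⟨s, U, hUo, hp, _, u, hu⟩

/-- Frames of both signs cannot coexist. -/
theorem _root_.OctG2.CrossProduct.IsFrame.sign_unique {W : Type*} [AddCommGroup W] [Module ℝ W]
    {Y : CrossProduct ℝ W} (hY : Y.Nondegenerate) {u u' : V7 ≃ₗ[ℝ] W} (h : Y.IsFrame 1 u)
    (h' : Y.IsFrame (-1) u') : False := by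
  -- This basis vector has length -1 in the indefinite model, while the frame of sign 1 expresses
  -- the same length as a sum of squares.
  have h1 := h'.map_g hY (Pi.single 3 1) (Pi.single 3 1)
  obtain ⟨x, hx⟩ := u.surjective (u' (Pi.single 3 1))
  rw [← hx, h.map_g hY, model_g_single, model_g] at h1
  simp only [modelForm, diagSign, Matrix.cons_val, Units.val_one, Units.val_neg, Int.cast_one,
    Int.cast_neg, Pi.single_eq_same] at h1
  nlinarith [mul_self_nonneg (x 0), mul_self_nonneg (x 1), mul_self_nonneg (x 2),
    mul_self_nonneg (x 3), mul_self_nonneg (x 4), mul_self_nonneg (x 5), mul_self_nonneg (x 6)]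

-- The points admitting frames of sign 1 and those admitting frames of sign -1 form disjoint open
-- sets covering M, so connectedness leaves one of them.
variable {X} in
theorem exists_isModelled [ConnectedSpace M] (hX : Function.Surjective X.g) :
    ∃ s, IsModelled X s := by
  let A : ℤˣ → Set M := fun s => {q | ∃ u, (fibreCross X q).IsFrame s u}
  have hA : ∀ s, IsOpen (A s) := by
    intro s
    refine isOpen_iff_mem_nhds.2 fun p hp => ?_
    obtain ⟨s', U, hU, hpU, t, u, hu⟩ := exists_local_modelled hX p
    have hs : s' = s := by
      obtain ⟨v, hv⟩ := hp
      have h2 := (hu p hpU).2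
      have hY := nondegenerate_fibreCross hX p
      rcases Int.units_eq_one_or s with rfl | rfl <;> rcases Int.units_eq_one_or s' with rfl | rfl
      · rfl
      · exact (CrossProduct.IsFrame.sign_unique hY hv h2).elim
      · exact (CrossProduct.IsFrame.sign_unique hY h2 hv).elim
      · rfl
    subst hs
    exact Filter.mem_of_superset (hU.mem_nhds hpU) fun q hq => ⟨u q, (hu q hq).2⟩
  have hcompl : A 1 = (A (-1))ᶜ := by
    ext q
    constructor
    · rintro ⟨u, hu⟩ ⟨u', hu'⟩
      exact CrossProduct.IsFrame.sign_unique (nondegenerate_fibreCross hX q) hu hu'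
    · intro hq
      obtain ⟨s', U, hU, hqU, t, u, hu⟩ := exists_local_modelled hX q
      rcases Int.units_eq_one_or s' with rfl | rfl
      · exact ⟨_, (hu q hqU).2⟩
      · exact (hq ⟨_, (hu q hqU).2⟩).elim
  have hclopen : IsClopen (A (-1)) := ⟨⟨by rw [← hcompl]; exact hA 1⟩, hA _⟩
  have key : ∀ s, (∀ q, q ∈ A (-s) → False) → IsModelled X s := fun s hs => ⟨fun p => by
    obtain ⟨s', U, hU, hpU, t, u, hu⟩ := exists_local_modelled hX p
    have hss : s' = s := by
      by_contra hne
      rw [Int.units_ne_iff_eq_neg.1 hne] at hu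
      exact hs p ⟨_, (hu p hpU).2⟩
    subst hss
    exact ⟨U, hU, hpU, t, u, hu⟩⟩
  rcases isClopen_iff.1 hclopen with h | h
  · exact ⟨1, key 1 fun q hq => by rw [h] at hq; exact hq⟩
  · refine ⟨-1, key (-1) fun q hq => ?_⟩
    rw [neg_neg, hcompl, h] at hq
    exact hq trivial

end Normalize

end OctG2

namespace OctG2

/-! ## Isomorphisms of octonion algebras -/

namespace OctonionAlgebra

section

variable {R : Type u} [CommRing R] {C C' : OctonionAlgebra R}

/-- Every morphism of octonion algebras is an isomorphism. -/
def Hom.toIso (φ : C ⟶ C') : C ≅ C' where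
  hom := φ
  inv :=
    { toEquiv := φ.toEquiv.symm
      map_mul := fun x y => φ.toEquiv.injective (by simp [φ.map_mul])
      map_one := φ.toEquiv.injective (by simp [φ.map_one])
      map_bilin := fun x y => by rw [← φ.map_bilin]; simp }
  hom_inv_id := Hom.ext (LinearEquiv.ext fun x => φ.toEquiv.symm_apply_apply x)
  inv_hom_id := Hom.ext (LinearEquiv.ext fun x => φ.toEquiv.apply_symm_apply x)

theorem Hom.mem_imag_iff (φ : C ⟶ C') (x : C.carrier) : φ.toEquiv x ∈ C'.imag ↔ x ∈ C.imag := by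
  rw [mem_imag, mem_imag, ← φ.map_one, φ.map_bilin]

/-- The restriction of a morphism to the orthogonal complements of `1`. -/
def Hom.imagEquiv (φ : C ⟶ C') : C.imag ≃ₗ[R] C'.imag where
  toFun x := ⟨φ.toEquiv x.1, (φ.mem_imag_iff x.1).2 x.2⟩
  map_add' x y := Subtype.ext (map_add φ.toEquiv x.1 y.1)
  map_smul' r x := Subtype.ext (map_smul φ.toEquiv r x.1)
  invFun y := ⟨φ.toEquiv.symm y.1, (φ.mem_imag_iff _).1 (by
    rw [LinearEquiv.apply_symm_apply]; exact y.2)⟩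
  left_inv x := Subtype.ext (φ.toEquiv.symm_apply_apply x.1)
  right_inv y := Subtype.ext (φ.toEquiv.apply_symm_apply y.1)

theorem Hom.cross_form [Invertible (2 : R)] (h1 : C.norm 1 = 1) (h1' : C'.norm 1 = 1)
    (φ : C ⟶ C') (x y z : C.imag) :
    (cross h1').form (φ.imagEquiv x) (φ.imagEquiv y) (φ.imagEquiv z) = (cross h1).form x y z := by
  rw [OctonionAlgebra.cross_form, OctonionAlgebra.cross_form, ← φ.map_bilin, φ.map_mul]
  rfl

end

end OctonionAlgebra

section

variable {n : ℕ} {M : Type u} [TopologicalSpace M] [ChartedSpace (EuclideanSpace ℝ (Fin n)) M]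

theorem map_mem_smul_top {P Q : Type*} [AddCommGroup P] [Module (SmoothRing n M) P]
    [AddCommGroup Q] [Module (SmoothRing n M) Q] (I : Ideal (SmoothRing n M))
    (f : P →ₗ[SmoothRing n M] Q) {x : P} (hx : x ∈ I • (⊤ : Submodule (SmoothRing n M) P)) :
    f x ∈ I • (⊤ : Submodule (SmoothRing n M) Q) := by
  refine Submodule.smul_induction_on hx (fun a ha y _ => ?_) fun y z hy hz => ?_
  · rw [map_smul]
    exact Submodule.smul_mem_smul ha trivial
  · rw [map_add]
    exact add_mem hy hz

namespace FibreAt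

variable {p : M} {P Q : Type*} [AddCommGroup P] [Module (SmoothRing n M) P]
  [AddCommGroup Q] [Module (SmoothRing n M) Q] {W W' : Type*} [AddCommGroup W] [Module ℝ W]
  [AddCommGroup W'] [Module ℝ W']

/-- Transport of a fibre along an isomorphism of modules. -/
def congr (F : FibreAt n p P W) (e : P ≃ₗ[SmoothRing n M] Q) : FibreAt n p Q W where
  ev := F.ev.comp e.symm.toLinearMap.toAddMonoidHom
  ev_smul a x := by
    change F.ev (e.symm (a • x)) = a p • F.ev (e.symm x)
    rw [map_smul, F.ev_smul]
  surjective w := by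
    obtain ⟨x, rfl⟩ := F.surjective w
    exact ⟨e x, congrArg F.ev (e.symm_apply_apply x)⟩
  ker_le x hx := by
    have := map_mem_smul_top _ e.toLinearMap (F.ker_le (e.symm x) hx)
    simpa using this

theorem congr_ev (F : FibreAt n p P W) (e : P ≃ₗ[SmoothRing n M] Q) (x : P) :
    (F.congr e).ev (e x) = F.ev x := congrArg F.ev (e.symm_apply_apply x)

/-- The fibre of a product. -/
def prod (F : FibreAt n p P W) (F' : FibreAt n p Q W') : FibreAt n p (P × Q) (W × W') where
  ev := F.ev.prodMap F'.ev
  ev_smul a x := Prod.ext (F.ev_smul a x.1) (F'.ev_smul a x.2)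
  surjective w := by
    obtain ⟨x, hx⟩ := F.surjective w.1
    obtain ⟨y, hy⟩ := F'.surjective w.2
    exact ⟨(x, y), Prod.ext hx hy⟩
  ker_le x hx := by
    have h1 := map_mem_smul_top _ (LinearMap.inl (SmoothRing n M) P Q)
      (F.ker_le x.1 (congrArg Prod.fst hx))
    have h2 := map_mem_smul_top _ (LinearMap.inr (SmoothRing n M) P Q)
      (F'.ker_le x.2 (congrArg Prod.snd hx))
    have h := add_mem h1 h2
    simpa using h

end FibreAt

/-! ### Cross products of sections and the morphisms of their octonion algebras -/

variable [IsManifold (𝓡 n) ∞ M] [T2Space M] [SecondCountableTopology M]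

open RankSevenBundle

variable {E E' : RankSevenBundle n M}

/-- A cross product of sections with perfect pairing that has a frame at every point. -/
structure IsRegular (X : CrossProduct (SmoothRing n M) E.Sections) : Prop where
  bijective : Function.Bijective X.g
  exists_frame : ∀ p, ∃ s u, (fibreCross X p).IsFrame s u

/-- An isomorphism of modules that preserves the trilinear forms preserves the bilinear forms and
the cross products. -/
theorem IsRegular.map_g_and_c {X : CrossProduct (SmoothRing n M) E.Sections} (hX : IsRegular X)
    {Q : Type*} [AddCommGroup Q] [Module (SmoothRing n M) Q] [Module.Finite (SmoothRing n M) Q]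
    [Module.Projective (SmoothRing n M) Q] {X' : CrossProduct (SmoothRing n M) Q}
    (hX' : Function.Surjective X'.g) (f : E.Sections ≃ₗ[SmoothRing n M] Q)
    (hf : ∀ x y z, X'.form (f x) (f y) (f z) = X.form x y z) :
    (∀ x y, X'.g (f x) (f y) = X.g x y) ∧ ∀ x y, X'.c (f x) (f y) = f (X.c x y) := by
  have key : ∀ p (x y : E.Sections), X'.g (f x) (f y) p = X.g x y p := by
    intro p x y
    obtain ⟨s, u, hu⟩ := hX.exists_frame p
    -- Through f the fibre of E at p is also the fibre of Q. Both cross products then live on one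
    -- space and share the frame u, and a frame determines the metric.
    let F' := (E.evalAt p).congr f
    have hu' : (F'.cross X').IsFrame s u := by
      intro a b c
      obtain ⟨a', ha⟩ := exists_section p (u a)
      obtain ⟨b', hb⟩ := exists_section p (u b)
      obtain ⟨c', hc⟩ := exists_section p (u c)
      have ev : ∀ t : E.Sections, t p = F'.ev (f t) := fun t => ((E.evalAt p).congr_ev f t).symm
      have h := hu a b c
      rw [← ha, ← hb, ← hc, fibreCross_form] at h
      rw [← ha, ← hb, ← hc, ev, ev, ev, F'.cross_form, hf, h]
    have h1 := hu.map_g (nondegenerate_fibreCross hX.bijective.2 p) (u.symm (x p)) (u.symm (y p))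
    have h2 := hu'.map_g (F'.cross_nondegenerate X' hX') (u.symm (x p)) (u.symm (y p))
    rw [LinearEquiv.apply_symm_apply, LinearEquiv.apply_symm_apply] at h1 h2
    rw [fibreCross_g] at h1
    rw [h1, ← h2, ← F'.cross_g]
    congr 2
    · exact (E.evalAt p).congr_ev f x
    · exact (E.evalAt p).congr_ev f y
  have hg : ∀ x y, X'.g (f x) (f y) = X.g x y := fun x y => by
    ext p
    exact key p x y
  have hinj : Function.Injective X'.g := by
    rw [injective_iff_map_eq_zero]
    intro x hx
    obtain ⟨x, rfl⟩ := f.surjective x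
    rw [LinearEquiv.map_eq_zero_iff, ← map_eq_zero_iff X.g hX.bijective.1]
    refine LinearMap.ext fun y => ?_
    rw [← hg, hx]
    rfl
  refine ⟨hg, fun x y => (CrossProduct.map_c X X' (fun w hw => ?_) f hf hg x y).symm⟩
  exact (map_eq_zero_iff X'.g hinj).1 (LinearMap.ext fun y => by rw [hw]; rfl)

/-- A frame is carried to a frame by an isomorphism of bundles that preserves the trilinear forms. -/
theorem isFrame_map {X : CrossProduct (SmoothRing n M) E.Sections}
    {X' : CrossProduct (SmoothRing n M) E'.Sections} (φ : RankSevenBundle.Iso E E')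
    (hf : ∀ x y z, X'.form (φ.mapSections x) (φ.mapSections y) (φ.mapSections z) = X.form x y z)
    {p : M} {s : ℤˣ} {u : V7 ≃ₗ[ℝ] E.fib p} :
    (fibreCross X' p).IsFrame s (u.trans (φ.toEquiv p)) ↔ (fibreCross X p).IsFrame s u := by
  have key : ∀ a b c, (fibreCross X' p).form (φ.toEquiv p (u a)) (φ.toEquiv p (u b))
      (φ.toEquiv p (u c)) = (fibreCross X p).form (u a) (u b) (u c) := by
    intro a b c
    obtain ⟨a', ha⟩ := exists_section p (u a)
    obtain ⟨b', hb⟩ := exists_section p (u b)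
    obtain ⟨c', hc⟩ := exists_section p (u c)
    rw [← ha, ← hb, ← hc, fibreCross_form, ← hf, ← fibreCross_form]
    rfl
  exact forall_congr' fun a => forall_congr' fun b => forall_congr' fun c => by
    rw [← key]; rfl

namespace RankSevenBundle

namespace IsSmoothModel

variable {s : ℤˣ} {Y : ∀ p, CrossProduct ℝ (E.fib p)} (hY : IsSmoothModel s Y)

include hY

theorem isFrame_fibreCross_iff {p : M} {s' : ℤˣ} {u : V7 ≃ₗ[ℝ] E.fib p} :
    (fibreCross hY.cross p).IsFrame s' u ↔ (Y p).IsFrame s' u := by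
  have key : ∀ v w z, (fibreCross hY.cross p).form v w z = (Y p).form v w z := by
    intro v w z
    obtain ⟨v, rfl⟩ := exists_section p v
    obtain ⟨w, rfl⟩ := exists_section p w
    obtain ⟨z, rfl⟩ := exists_section p z
    rw [fibreCross_form, cross_form_apply]
  simp only [CrossProduct.IsFrame, key]

theorem isRegular : IsRegular hY.cross where
  bijective := hY.cross_g_bijective
  exists_frame p := by
    obtain ⟨u, -, hu⟩ := hY.exists_frame p
    exact ⟨s, u p, hY.isFrame_fibreCross_iff.2 hu.self_of_nhds⟩

end IsSmoothModel

/-- The isomorphism of modules of sections induced by a bundle isomorphism. -/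
def Iso.sectionsEquiv (φ : Iso E E') : E.Sections ≃ₗ[SmoothRing n M] E'.Sections where
  toLinearMap := φ.mapSections
  invFun s := ⟨fun p => (φ.toEquiv p).symm (s p), φ.smooth_symm.comp s.contMDiff⟩
  left_inv s := by ext p; exact (φ.toEquiv p).symm_apply_apply (s p)
  right_inv s := by ext p; exact (φ.toEquiv p).apply_symm_apply (s p)

theorem Iso.ext_of_mapSections {φ ψ : Iso E E'} (h : ∀ x, φ.mapSections x = ψ.mapSections x) :
    φ = ψ := by
  refine Iso.ext (funext fun p => LinearEquiv.ext fun v => ?_)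
  obtain ⟨x, rfl⟩ := exists_section p v
  exact congrArg (fun t : E'.Sections => t p) (h x)

end RankSevenBundle

variable [ConnectedSpace M]

open OctonionAlgebra

/-- The octonion algebra of a cross product of sections. -/
def oct (X : CrossProduct (SmoothRing n M) E.Sections) (hX : IsRegular X) :
    OctonionAlgebra (SmoothRing n M) :=
  ofCross rankAtStalk_sections X hX.bijective

section Oct

variable {X : CrossProduct (SmoothRing n M) E.Sections} (hX : IsRegular X)
  {X' : CrossProduct (SmoothRing n M) E'.Sections} (hX' : IsRegular X')

/-- The sections are the orthogonal complement of `1`. -/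
def octImag : E.Sections ≃ₗ[SmoothRing n M] (oct X hX).imag :=
  imagOfCross rankAtStalk_sections X hX.bijective

theorem cross_form_octImag (x y z : E.Sections) :
    (cross (oct X hX).norm_one).form (octImag hX x) (octImag hX y) (octImag hX z) =
      X.form x y z := by
  rw [CrossProduct.form, CrossProduct.form]
  have h1 := cross_c_imagOfCross rankAtStalk_sections X hX.bijective x y
  have h2 := cross_g_imagOfCross rankAtStalk_sections X hX.bijective (X.c x y) z
  rw [← h2, ← h1]
  rfl

variable {hX hX'} in
theorem oct_hom_ext {C : OctonionAlgebra (SmoothRing n M)} {φ ψ : oct X hX ⟶ C}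
    (h : ∀ x, φ.toEquiv (octImag hX x).1 = ψ.toEquiv (octImag hX x).1) : φ = ψ := by
  refine hom_ext_of_imag (oct X hX).norm_one fun x => ?_
  obtain ⟨x, rfl⟩ := (octImag hX).surjective x
  exact h x

/-- As the three-form determines g and c, preserving it is all that is needed for an extension to
the algebras. -/
theorem exists_oct_hom {C : OctonionAlgebra (SmoothRing n M)}
    (f : E.Sections ≃ₗ[SmoothRing n M] C.imag)
    (hf : ∀ x y z, (cross C.norm_one).form (f x) (f y) (f z) = X.form x y z) :
    ∃ φ : oct X hX ⟶ C, ∀ x, φ.toEquiv (octImag hX x).1 = (f x).1 := by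
  have := finite_imag C.norm_one
  have := projective_imag C.norm_one
  obtain ⟨hg, hc⟩ := hX.map_g_and_c (cross_g_bijective C.norm_one).2 f hf
  refine ⟨homOfImag (oct X hX).norm_one C.norm_one ((octImag hX).symm ≪≫ₗ f) (fun x y => ?_)
    fun x y => ?_, fun x => ?_⟩
  · obtain ⟨x, rfl⟩ := (octImag hX).surjective x
    obtain ⟨y, rfl⟩ := (octImag hX).surjective y
    simp only [LinearEquiv.trans_apply, LinearEquiv.symm_apply_apply, hg]
    exact (cross_g_imagOfCross rankAtStalk_sections X hX.bijective x y).symm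
  · obtain ⟨x, rfl⟩ := (octImag hX).surjective x
    obtain ⟨y, rfl⟩ := (octImag hX).surjective y
    have h : (cross (oct X hX).norm_one).c (octImag hX x) (octImag hX y) = octImag hX (X.c x y) :=
      cross_c_imagOfCross rankAtStalk_sections X hX.bijective x y
    simp only [LinearEquiv.trans_apply, h, LinearEquiv.symm_apply_apply, hc]
  · rw [homOfImag_apply]
    simp

/-- The morphism of octonion algebras of an isomorphism that preserves the trilinear forms. -/
theorem exists_octMap (f : E.Sections ≃ₗ[SmoothRing n M] E'.Sections)
    (hf : ∀ x y z, X'.form (f x) (f y) (f z) = X.form x y z) :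
    ∃ φ : oct X hX ⟶ oct X' hX', ∀ x, φ.toEquiv (octImag hX x).1 = (octImag hX' (f x)).1 :=
  exists_oct_hom hX (f ≪≫ₗ octImag hX') fun x y z => by
    simp only [LinearEquiv.trans_apply, cross_form_octImag, hf]

/-- The morphism of octonion algebras of an isomorphism that preserves the trilinear forms. -/
def octMap (f : E.Sections ≃ₗ[SmoothRing n M] E'.Sections)
    (hf : ∀ x y z, X'.form (f x) (f y) (f z) = X.form x y z) : oct X hX ⟶ oct X' hX' :=
  (exists_octMap hX hX' f hf).choose

theorem octMap_apply (f : E.Sections ≃ₗ[SmoothRing n M] E'.Sections)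
    (hf : ∀ x y z, X'.form (f x) (f y) (f z) = X.form x y z) (x : E.Sections) :
    (octMap hX hX' f hf).toEquiv (octImag hX x).1 = (octImag hX' (f x)).1 :=
  (exists_octMap hX hX' f hf).choose_spec x

/-- Converse of `exists_octMap`: a morphism preserves 1 and b, hence the imaginary parts, and
together with the product the three-forms. -/
theorem exists_equiv_of_octHom (φ : oct X hX ⟶ oct X' hX') :
    ∃ f : E.Sections ≃ₗ[SmoothRing n M] E'.Sections,
      (∀ x y z, X'.form (f x) (f y) (f z) = X.form x y z) ∧
        ∀ x, φ.toEquiv (octImag hX x).1 = (octImag hX' (f x)).1 := by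
  let f := octImag hX ≪≫ₗ φ.imagEquiv ≪≫ₗ (octImag hX').symm
  have h : ∀ x, octImag hX' (f x) = φ.imagEquiv (octImag hX x) := fun x => by simp [f]
  refine ⟨f, fun x y z => ?_, fun x => ?_⟩
  · rw [← cross_form_octImag hX', h, h, h, φ.cross_form (oct X hX).norm_one, cross_form_octImag]
  · rw [h]
    rfl

end Oct

end

end OctG2

namespace OctG2

variable {n : ℕ} {M : Type u} [TopologicalSpace M] [ChartedSpace (EuclideanSpace ℝ (Fin n)) M]
  [IsManifold (𝓡 n) ∞ M] [T2Space M] [SecondCountableTopology M]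

open RankSevenBundle OctonionAlgebra

/-! ## The octonion algebra of a formal structure -/

namespace FormalG2Structure

variable {P P' : FormalG2Structure n M}

/-- The cross product of sections of a `G₂`-structure. -/
abbrev cross (P : FormalG2Structure n M) : CrossProduct (SmoothRing n M) P.bundle.Sections :=
  P.isSmoothModel.cross

theorem mem_frames_iff_cross {p : M} {u : V7 ≃ₗ[ℝ] P.bundle.fib p} :
    u ∈ P.frames p ↔ (OctG2.fibreCross P.cross p).IsFrame 1 u :=
  P.mem_frames_iff.trans P.isSmoothModel.isFrame_fibreCross_iff.symm

omit [IsManifold (𝓡 n) ∞ M] [T2Space M] [SecondCountableTopology M] in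
theorem Hom.map_form (φ : P ⟶ P') (x y z : P.bundle.Sections) :
    P'.cross.form (φ.toIso.mapSections x) (φ.toIso.mapSections y) (φ.toIso.mapSections z) =
      P.cross.form x y z := by
  ext p
  obtain ⟨u, hu⟩ := P.exists_mem_frames p
  have hu' : u.trans (φ.toIso.toEquiv p) ∈ P'.frames p := by
    rw [φ.map_frames p]
    exact ⟨u, hu, rfl⟩
  have h1 := P.form_eq hu ![x, y, z]
  have h2 := P'.form_eq hu' fun i => φ.toIso.mapSections (![x, y, z] i)
  refine h2.trans (Eq.trans ?_ h1.symm)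
  congr 1
  funext i
  exact congrArg u.symm ((φ.toIso.toEquiv p).symm_apply_apply _)

/-- An isomorphism of bundles that preserves the three-forms preserves the reductions. -/
def homOfIso (φ : RankSevenBundle.Iso P.bundle P'.bundle)
    (hf : ∀ x y z, P'.cross.form (φ.mapSections x) (φ.mapSections y) (φ.mapSections z) =
      P.cross.form x y z) : P ⟶ P' where
  toIso := φ
  map_frames p := by
    ext u
    constructor
    · intro hu
      have hu' : u = (u.trans (φ.toEquiv p).symm).trans (φ.toEquiv p) := by
        ext x
        simp
      refine ⟨u.trans (φ.toEquiv p).symm, ?_, hu'.symm⟩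
      rw [mem_frames_iff_cross, hu'] at hu
      exact mem_frames_iff_cross.2 ((isFrame_map φ hf).1 hu)
    · rintro ⟨u, hu, rfl⟩
      exact mem_frames_iff_cross.2 ((isFrame_map φ hf).2 (mem_frames_iff_cross.1 hu))

theorem exists_isFrame (P : FormalG2Structure n M) (p : M) :
    ∃ u, (OctG2.fibreCross P.cross p).IsFrame 1 u :=
  (P.exists_mem_frames p).imp fun _ hu => mem_frames_iff_cross.1 hu

variable [ConnectedSpace M]

/-- The functor sending a `G₂`-structure to its octonion algebra. -/
def toOct : FormalG2Structure n M ⥤ OctonionAlgebra (SmoothRing n M) where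
  obj P := oct P.cross P.isSmoothModel.isRegular
  map {P P'} φ := octMap P.isSmoothModel.isRegular P'.isSmoothModel.isRegular
    φ.toIso.sectionsEquiv φ.map_form
  map_id P := oct_hom_ext fun x => octMap_apply _ _ _ _ x
  map_comp {P P' P''} φ ψ := oct_hom_ext fun x => by
    refine (octMap_apply _ _ _ _ x).trans (Eq.symm ?_)
    refine (congrArg (octMap P'.isSmoothModel.isRegular P''.isSmoothModel.isRegular
      ψ.toIso.sectionsEquiv ψ.map_form).toEquiv (octMap_apply _ _ _ _ x)).trans ?_
    exact octMap_apply _ _ _ _ _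

end FormalG2Structure

namespace FormalSplitG2Structure

variable {S S' : FormalSplitG2Structure n M}

/-- The cross product of sections of a split `G₂`-structure. -/
abbrev cross (S : FormalSplitG2Structure n M) : CrossProduct (SmoothRing n M) S.bundle.Sections :=
  S.isSmoothModel.cross

theorem cross_form (x y z : S.bundle.Sections) : S.cross.form x y z = S.form ![x, y, z] :=
  S.form_eq ![x, y, z]

theorem Hom.map_cross_form (φ : S ⟶ S') (x y z : S.bundle.Sections) :
    S'.cross.form (φ.toEquiv x) (φ.toEquiv y) (φ.toEquiv z) = S.cross.form x y z := by
  rw [cross_form, cross_form, φ.map_form, AlternatingMap.compLinearMap_apply]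
  congr 1
  funext i
  fin_cases i <;> exact φ.toEquiv.symm_apply_apply _

/-- A linear isomorphism that preserves the trilinear forms of the cross products. -/
def homOfEquiv (f : S.bundle.Sections ≃ₗ[SmoothRing n M] S'.bundle.Sections)
    (hf : ∀ x y z, S'.cross.form (f x) (f y) (f z) = S.cross.form x y z) : S ⟶ S' where
  toEquiv := f
  map_form := by
    refine AlternatingMap.ext fun s => ?_
    have h := hf (f.symm (s 0)) (f.symm (s 1)) (f.symm (s 2))
    rw [LinearEquiv.apply_symm_apply, LinearEquiv.apply_symm_apply, LinearEquiv.apply_symm_apply,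
      S'.form_eq] at h
    rw [h]
    exact S.form_eq fun i => f.symm (s i)

theorem exists_isFrame (S : FormalSplitG2Structure n M) (p : M) :
    ∃ u, (OctG2.fibreCross S.cross p).IsFrame (-1) u := by
  obtain ⟨u, -, hu⟩ := S.isSmoothModel.exists_frame p
  exact ⟨u p, S.isSmoothModel.isFrame_fibreCross_iff.2 hu.self_of_nhds⟩

variable [ConnectedSpace M]

/-- The functor sending a split `G₂`-structure to its octonion algebra. -/
def toOct : FormalSplitG2Structure n M ⥤ OctonionAlgebra (SmoothRing n M) where
  obj S := oct S.cross S.isSmoothModel.isRegular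
  map {S S'} φ := octMap S.isSmoothModel.isRegular S'.isSmoothModel.isRegular
    φ.toEquiv φ.map_cross_form
  map_id S := oct_hom_ext fun x => octMap_apply _ _ _ _ x
  map_comp {S S' S''} φ ψ := oct_hom_ext fun x => by
    refine (octMap_apply _ _ _ _ x).trans (Eq.symm ?_)
    refine (congrArg (octMap S'.isSmoothModel.isRegular S''.isSmoothModel.isRegular
      ψ.toEquiv ψ.map_cross_form).toEquiv (octMap_apply _ _ _ _ x)).trans ?_
    exact octMap_apply _ _ _ _ _

end FormalSplitG2Structure

/-! ### Full faithfulness of the functor to octonion algebras -/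

variable [ConnectedSpace M]

theorem octMap_injective {E E' : RankSevenBundle n M}
    {X : CrossProduct (SmoothRing n M) E.Sections} {hX : IsRegular X}
    {X' : CrossProduct (SmoothRing n M) E'.Sections} {hX' : IsRegular X'}
    (f f' : E.Sections ≃ₗ[SmoothRing n M] E'.Sections)
    (hf : ∀ x y z, X'.form (f x) (f y) (f z) = X.form x y z)
    (hf' : ∀ x y z, X'.form (f' x) (f' y) (f' z) = X.form x y z)
    (h : octMap hX hX' f hf = octMap hX hX' f' hf') : f = f' := by
  refine LinearEquiv.ext fun x => (octImag hX').injective (Subtype.ext ?_)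
  rw [← octMap_apply hX hX' f hf, ← octMap_apply hX hX' f' hf', h]

namespace FormalG2Structure

instance : (toOct (n := n) (M := M)).Faithful where
  map_injective {_ _ φ ψ} h := FormalG2Structure.Hom.ext (Iso.ext_of_mapSections fun x =>
    DFunLike.congr_fun (octMap_injective φ.toIso.sectionsEquiv ψ.toIso.sectionsEquiv
      φ.map_form ψ.map_form h) x)

/-- Restriction to imaginary parts gives a linear isomorphism of sections, which comes from a bundle
isomorphism; preserving three-forms, it carries one reduction onto the other. -/
instance : (toOct (n := n) (M := M)).Full where
  map_surjective {P P'} ψ := by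
    obtain ⟨f, hf, hfx⟩ := exists_equiv_of_octHom P.isSmoothModel.isRegular
      P'.isSmoothModel.isRegular ψ
    obtain ⟨φ, hφ⟩ := exists_iso_mapSections f
    have hφx : ∀ x, φ.mapSections x = f x := fun x => DFunLike.congr_fun hφ x
    let χ : P ⟶ P' := homOfIso φ fun x y z => by
      rw [hφx, hφx, hφx]
      exact hf x y z
    refine ⟨χ, oct_hom_ext (hX := P.isSmoothModel.isRegular) fun x => ?_⟩
    refine (octMap_apply P.isSmoothModel.isRegular P'.isSmoothModel.isRegular
      χ.toIso.sectionsEquiv χ.map_form x).trans (Eq.trans ?_ (hfx x).symm)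
    exact congrArg (fun t => (octImag P'.isSmoothModel.isRegular t).1) (hφx x)

end FormalG2Structure

namespace FormalSplitG2Structure

instance : (toOct (n := n) (M := M)).Faithful where
  map_injective {_ _ φ ψ} h := FormalSplitG2Structure.Hom.ext
    (octMap_injective φ.toEquiv ψ.toEquiv φ.map_cross_form ψ.map_cross_form h)

instance : (toOct (n := n) (M := M)).Full where
  map_surjective {S S'} ψ := by
    obtain ⟨f, hf, hfx⟩ := exists_equiv_of_octHom S.isSmoothModel.isRegular
      S'.isSmoothModel.isRegular ψ
    let χ : S ⟶ S' := homOfEquiv f hf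
    exact ⟨χ, oct_hom_ext (hX := S.isSmoothModel.isRegular) fun x =>
      (octMap_apply S.isSmoothModel.isRegular S'.isSmoothModel.isRegular χ.toEquiv
        χ.map_cross_form x).trans (hfx x).symm⟩

end FormalSplitG2Structure

/-- Isomorphic octonion algebras come from cross products with frames of the same sign. -/
theorem sign_eq_of_octHom {E E' : RankSevenBundle n M}
    {X : CrossProduct (SmoothRing n M) E.Sections} (hX : IsRegular X)
    {X' : CrossProduct (SmoothRing n M) E'.Sections} (hX' : IsRegular X')
    (ψ : oct X hX ⟶ oct X' hX') {p : M} {u : V7 ≃ₗ[ℝ] E.fib p} {u' : V7 ≃ₗ[ℝ] E'.fib p}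
    {s s' : ℤˣ} (hu : (fibreCross X p).IsFrame s u) (hu' : (fibreCross X' p).IsFrame s' u') :
    s = s' := by
  obtain ⟨f, hf, -⟩ := exists_equiv_of_octHom hX hX' ψ
  obtain ⟨φ, hφ⟩ := exists_iso_mapSections f
  have hφx : ∀ x, φ.mapSections x = f x := fun x => DFunLike.congr_fun hφ x
  have h := (isFrame_map φ (X := X) (X' := X') fun x y z => by
    rw [hφx, hφx, hφx]
    exact hf x y z).2 hu
  have hY := nondegenerate_fibreCross hX'.bijective.2 p
  rcases Int.units_eq_one_or s with rfl | rfl <;> rcases Int.units_eq_one_or s' with rfl | rfl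
  · rfl
  · exact (h.sign_unique hY hu').elim
  · exact (hu'.sign_unique hY h).elim
  · rfl

/-- The functor sending a formal structure to its octonion algebra. -/
def toOct : FormalStructure n M ⥤ OctonionAlgebra (SmoothRing n M) :=
  Functor.sum' (A := FormalG2Structure n M) (B := FormalSplitG2Structure n M)
    FormalG2Structure.toOct FormalSplitG2Structure.toOct

theorem one_ne_neg_one_units : (1 : ℤˣ) ≠ -1 := by decide

instance : (toOct (n := n) (M := M)).Faithful where
  map_injective {A B} f g h := by
    rcases A with P | S <;> rcases B with P' | S'
    · exact ULift.ext _ _ (FormalG2Structure.toOct.map_injective h)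
    · exact PEmpty.elim f
    · exact PEmpty.elim f
    · exact ULift.ext _ _ (FormalSplitG2Structure.toOct.map_injective h)

/-- Besides fullness on the summands, there must be no morphism between algebras coming from
different summands. The sign of a frame at any one point of M excludes it. -/
instance : (toOct (n := n) (M := M)).Full where
  map_surjective {A B} ψ := by
    obtain ⟨p⟩ : Nonempty M := inferInstance
    rcases A with P | S <;> rcases B with P' | S'
    · obtain ⟨φ, hφ⟩ := FormalG2Structure.toOct.map_surjective ψ
      exact ⟨ULift.up φ, hφ⟩
    · obtain ⟨u, hu⟩ := P.exists_isFrame p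
      obtain ⟨u', hu'⟩ := S'.exists_isFrame p
      exact (one_ne_neg_one_units (sign_eq_of_octHom P.isSmoothModel.isRegular
        S'.isSmoothModel.isRegular ψ hu hu')).elim
    · obtain ⟨u, hu⟩ := S.exists_isFrame p
      obtain ⟨u', hu'⟩ := P'.exists_isFrame p
      exact (one_ne_neg_one_units (sign_eq_of_octHom S.isSmoothModel.isRegular
        P'.isSmoothModel.isRegular ψ hu hu').symm).elim
    · obtain ⟨φ, hφ⟩ := FormalSplitG2Structure.toOct.map_surjective ψ
      exact ⟨ULift.up φ, hφ⟩

/-- The sections of a formal structure are the orthogonal complement of `1`. -/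
def sectionsIso : formalSections (n := n) (M := M) ≅ toOct ⋙ imagFunctor :=
  NatIso.ofComponents
    (fun A => match A with
      | Sum.inl P => (octImag P.isSmoothModel.isRegular).toModuleIso
      | Sum.inr S => (octImag S.isSmoothModel.isRegular).toModuleIso)
    fun {A B} f => by
      rcases A with P | S <;> rcases B with P' | S'
      · ext x
        exact Subtype.ext (octMap_apply P.isSmoothModel.isRegular P'.isSmoothModel.isRegular
          f.down.toIso.sectionsEquiv f.down.map_form x).symm
      · exact PEmpty.elim f
      · exact PEmpty.elim f
      · ext x
        exact Subtype.ext (octMap_apply S.isSmoothModel.isRegular S'.isSmoothModel.isRegular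
          f.down.toEquiv f.down.map_cross_form x).symm

end OctG2

namespace OctG2

/-! ## Essential surjectivity -/

namespace CrossProduct

variable {R V W : Type*} [CommRing R] [AddCommGroup V] [Module R V] [AddCommGroup W] [Module R W]
  (X : CrossProduct R V)

theorem transport_g_bijective (hX : Function.Bijective X.g) (f : V ≃ₗ[R] W) :
    Function.Bijective (X.transport f).g :=
  (f.symm.dualMap.bijective.comp hX).comp f.symm.bijective

theorem form_self_right (x y : V) : X.form x y y = 0 := X.g_c_right x y

theorem form_self_outer (x y : V) : X.form x y x = 0 := X.g_c_left x y

/-- The trilinear form of a cross product as an alternating form. -/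
def alternatingForm : V [⋀^Fin 3]→ₗ[R] R where
  toFun v := X.form (v 0) (v 1) (v 2)
  map_update_add' {inst} v i x y := by
    obtain rfl : inst = instDecidableEqFin 3 := Subsingleton.elim _ _
    fin_cases i <;> simp [form, Function.update]
  map_update_smul' {inst} v i c x := by
    obtain rfl : inst = instDecidableEqFin 3 := Subsingleton.elim _ _
    fin_cases i <;> simp [form, Function.update]
  map_eq_zero_of_eq' v i j h hij := by
    fin_cases i <;> fin_cases j <;>
      first
      | exact absurd rfl hij
      | (simp only [Fin.mk_zero, Fin.mk_one, Fin.reduceFinMk] at h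
         simp only [h, form_self, form_self_right, form_self_outer])

theorem alternatingForm_apply (v : Fin 3 → V) :
    X.alternatingForm v = X.form (v 0) (v 1) (v 2) := rfl

end CrossProduct

variable {n : ℕ} {M : Type u} [TopologicalSpace M] [ChartedSpace (EuclideanSpace ℝ (Fin n)) M]
  [IsManifold (𝓡 n) ∞ M] [T2Space M] [SecondCountableTopology M]

open RankSevenBundle OctonionAlgebra

variable {E : RankSevenBundle n M} {X : CrossProduct (SmoothRing n M) E.Sections}

theorem form_eq_model {p : M} {s : ℤˣ} {u : V7 ≃ₗ[ℝ] E.fib p} (hu : (fibreCross X p).IsFrame s u)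
    (x y z : E.Sections) :
    X.form x y z p = (model s).form (u.symm (x p)) (u.symm (y p)) (u.symm (z p)) := by
  rw [← hu, ← fibreCross_form]
  simp only [LinearEquiv.apply_symm_apply]

/-- The `G₂`-structure of all frames that carry the model three-form to the given form. -/
def IsModelled.toG2 (hX : IsModelled X 1) : FormalG2Structure n M where
  bundle := E
  frames p := {u | (fibreCross X p).IsFrame 1 u}
  orbit p u hu u' := by
    constructor
    · intro hu'
      refine ⟨u'.trans u.symm, mem_G2_iff.2 fun x y z => ?_, ?_⟩
      · have h1 := hu (u.symm (u' x)) (u.symm (u' y)) (u.symm (u' z))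
        simp only [LinearEquiv.apply_symm_apply] at h1
        exact h1.symm.trans (hu' x y z)
      · ext x
        simp
    · rintro ⟨g, hg, rfl⟩ x y z
      exact (hu _ _ _).trans (mem_G2_iff.1 hg x y z)
  exists_local_frame p := by
    obtain ⟨U, hU, hp, t, u, hu⟩ := hX.exists_frame p
    refine ⟨U, hU, hp, u, fun q hq => (hu q hq).2, fun x q hq => ?_⟩
    have h : E.SmoothAt (fun q => u q x) q :=
      (SmoothAt.sum_smul (a := fun i _ => x i) (fun i => (t i).contMDiff q)
        fun i => contMDiffAt_const).congr
        (by filter_upwards [hU.mem_nhds hq] with r hr using (hu r hr).1 x)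
    exact h.contMDiffWithinAt

theorem IsModelled.toG2_cross_form (hX : IsModelled X 1) (x y z : E.Sections) :
    hX.toG2.cross.form x y z = X.form x y z := by
  ext p
  obtain ⟨u, hu⟩ := hX.toG2.exists_mem_frames p
  refine (hX.toG2.form_eq hu ![x, y, z]).trans ?_
  refine Eq.trans ?_ (form_eq_model (show (fibreCross X p).IsFrame 1 u from hu) x y z).symm
  exact (model_one_form _).symm

/-- The split `G₂`-structure of a modelled cross product. -/
def IsModelled.toSplitG2 (hX : IsModelled X (-1)) : FormalSplitG2Structure n M where
  bundle := E
  form := X.alternatingForm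
  exists_frame p := by
    obtain ⟨U, -, hp, t, u, hu⟩ := hX.exists_frame p
    refine ⟨u p, fun s => ?_⟩
    rw [CrossProduct.alternatingForm_apply, form_eq_model (hu p hp).2, ← model_neg_one_form]

theorem IsModelled.toSplitG2_cross_form (hX : IsModelled X (-1)) (x y z : E.Sections) :
    hX.toSplitG2.cross.form x y z = X.form x y z :=
  hX.toSplitG2.form_eq ![x, y, z]

variable [ConnectedSpace M]

/-- The imaginary part is realized as the sections of a bundle. The transported cross product has
one sign throughout and so defines a formal structure with the same three-form, which suffices for
an isomorphism of algebras. -/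
instance : (toOct (n := n) (M := M)).EssSurj where
  mem_essImage C := by
    have := finite_imag C.norm_one
    have := projective_imag C.norm_one
    obtain ⟨E, ⟨f⟩⟩ := exists_bundle C.imag (rankAtStalk_imag C.norm_one)
    have hX := (cross C.norm_one).transport_g_bijective (cross_g_bijective C.norm_one) f
    obtain ⟨s, hs⟩ := exists_isModelled hX.2
    have hf : ∀ x y z, (cross C.norm_one).form (f.symm x) (f.symm y) (f.symm z) =
        ((cross C.norm_one).transport f).form x y z := fun x y z =>
      (CrossProduct.transport_form _ f x y z).symm
    rcases Int.units_eq_one_or s with rfl | rfl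
    · obtain ⟨φ, -⟩ := exists_oct_hom hs.toG2.isSmoothModel.isRegular f.symm fun x y z =>
        (hf x y z).trans (hs.toG2_cross_form x y z).symm
      exact ⟨Sum.inl hs.toG2, ⟨Hom.toIso φ⟩⟩
    · obtain ⟨φ, -⟩ := exists_oct_hom hs.toSplitG2.isSmoothModel.isRegular f.symm fun x y z =>
        (hf x y z).trans (hs.toSplitG2_cross_form x y z).symm
      exact ⟨Sum.inr hs.toSplitG2, ⟨Hom.toIso φ⟩⟩

instance : (toOct (n := n) (M := M)).IsEquivalence where

/-! ## Zero divisors in the fibres -/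

section ZeroDivisors

variable {C : OctonionAlgebra (SmoothRing n M)} (f : E.Sections ≃ₗ[SmoothRing n M] C.imag)

/-- The fibre of an octonion algebra. -/
def octFibre (p : M) : FibreAt n p C.carrier (ℝ × E.fib p) :=
  ((FibreAt.self p).prod ((E.evalAt p).congr f)).congr (decomp C.norm_one).symm

theorem octFibre_ev (p : M) (a : SmoothRing n M) (v : E.Sections) :
    (octFibre f p).ev ((decomp C.norm_one).symm (a, f v)) = (a p, v p) := by
  rw [octFibre, FibreAt.congr_ev]
  exact Prod.ext rfl ((E.evalAt p).congr_ev f v)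

theorem norm_apply (hg : ∀ x y, (cross C.norm_one).g (f x) (f y) = X.g x y) (p : M)
    (x : C.carrier) : C.norm x p = ((octFibre f p).ev x).1 * ((octFibre f p).ev x).1 +
      (fibreCross X p).g ((octFibre f p).ev x).2 ((octFibre f p).ev x).2 := by
  obtain ⟨a, v, rfl⟩ := exists_decomp C.norm_one x
  obtain ⟨v, rfl⟩ := f.surjective v
  rw [octFibre_ev, norm_decomp_symm, hg, fibreCross_g]
  rfl

theorem modelForm_one_self_nonneg (x : V7) : 0 ≤ (model 1).g x x := by
  simp only [model_g, modelForm, Units.val_one, Int.cast_one, one_mul]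
  have h0 := fun i => mul_self_nonneg (x i)
  linarith [h0 0, h0 1, h0 2, h0 3, h0 4, h0 5, h0 6]

theorem modelForm_one_self_eq_zero {x : V7} (h : (model 1).g x x = 0) : x = 0 := by
  simp only [model_g, modelForm, Units.val_one, Int.cast_one, one_mul] at h
  have h0 := fun i => mul_self_nonneg (x i)
  have key : ∀ i, x i * x i = 0 := by
    intro i
    fin_cases i <;> simp only [Fin.mk_zero, Fin.mk_one, Fin.reduceFinMk] <;>
      linarith [h0 0, h0 1, h0 2, h0 3, h0 4, h0 5, h0 6]
  funext i
  exact mul_self_eq_zero.1 (key i)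

variable {f} (hX : IsRegular X)
  (hf : ∀ x y z, (cross C.norm_one).form (f x) (f y) (f z) = X.form x y z) {p : M}

include hX hf

/-- On the fibre the norm is a² + g(v, v) with g positive definite, so it vanishes at 0 only;
multiplicativity then excludes zero divisors. -/
theorem nonSplitAt_of_isFrame {u : V7 ≃ₗ[ℝ] E.fib p} (hu : (fibreCross X p).IsFrame 1 u) :
    NonSplitAt C p := by
  have := finite_imag C.norm_one
  have := projective_imag C.norm_one
  have hg := (hX.map_g_and_c (cross_g_bijective C.norm_one).2 f hf).1
  have hY := nondegenerate_fibreCross hX.bijective.2 p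
  have hn : ∀ x, C.norm x p = 0 → (octFibre f p).ev x = 0 := by
    intro x hx
    rw [norm_apply f hg] at hx
    have h1 := hu.map_g hY (u.symm ((octFibre f p).ev x).2) (u.symm ((octFibre f p).ev x).2)
    rw [LinearEquiv.apply_symm_apply] at h1
    have h2 := modelForm_one_self_nonneg (u.symm ((octFibre f p).ev x).2)
    rw [h1] at hx
    have h3 := mul_self_nonneg ((octFibre f p).ev x).1
    refine Prod.ext (mul_self_eq_zero.1 (by linarith)) ?_
    have h4 := modelForm_one_self_eq_zero (show (model 1).g _ _ = 0 by linarith)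
    simpa using h4
  intro x y hxy
  rw [← (octFibre f p).ev_eq_zero_iff] at hxy ⊢
  rw [← (octFibre f p).ev_eq_zero_iff]
  have h : C.norm x p * C.norm y p = 0 := by
    have h1 : C.norm (x * y) p = 0 := by
      rw [norm_apply f hg, hxy]
      simp
    rw [C.norm_mul] at h1
    exact h1
  exact (mul_eq_zero.1 h).imp (hn x) (hn y)

theorem not_nonSplitAt_of_isFrame {u : V7 ≃ₗ[ℝ] E.fib p}
    (hu : (fibreCross X p).IsFrame (-1) u) : ¬ NonSplitAt C p := by
  have := finite_imag C.norm_one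
  have := projective_imag C.norm_one
  have hg := (hX.map_g_and_c (cross_g_bijective C.norm_one).2 f hf).1
  have hY := nondegenerate_fibreCross hX.bijective.2 p
  -- An isotropic vector, the two summands having lengths 1 and -1. Its square in the fibre is
  -- -q(w)1 = 0, so it is a zero divisor.
  let w : V7 := Pi.single 0 1 + Pi.single 3 1
  obtain ⟨v, hv⟩ := exists_section p (u w)
  have hev : (octFibre f p).ev (f v).1 = (0, v p) := by
    have h := octFibre_ev f p 0 v
    rw [decomp_symm_apply, zero_smul, zero_add] at h
    exact h
  have hn : C.norm (f v).1 p = 0 := by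
    rw [norm_apply f hg, hev]
    simp only [hv, hu.map_g hY]
    simp [model_g, modelForm, w]
  have hne : ¬ (octFibre f p).ev (f v).1 = 0 := by
    rw [hev, hv]
    intro h
    have h1 : u w = 0 := congrArg Prod.snd h
    rw [LinearEquiv.map_eq_zero_iff] at h1
    simpa [w] using congrFun h1 0
  intro h
  have h1 := h (f v).1 (f v).1 (by
    rw [imag_mul_self]
    exact neg_mem (Submodule.smul_mem_smul (mem_pointIdeal.2 hn) trivial))
  rw [or_self, ← (octFibre f p).ev_eq_zero_iff] at h1
  exact hne h1

end ZeroDivisors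

/-! ## The three-form -/

omit [IsManifold (𝓡 n) ∞ M] [T2Space M] [SecondCountableTopology M] in
theorem octonionForm_eq {C : OctonionAlgebra (SmoothRing n M)} (x y z : C.imag) :
    octonionForm C x y z = (cross C.norm_one).form x y z := by
  rw [OctonionAlgebra.cross_form, octonionForm, invOf_two_eq, ← Algebra.smul_def, one_div]

/-- The morphism φ is arbitrary so that the counit of the equivalence can be inserted for it. -/
theorem hasForm_and_splitting (A : FormalStructure n M) {C : OctonionAlgebra (SmoothRing n M)}
    (φ : (toOct (n := n) (M := M)).obj A ⟶ C) :
    HasForm A (fun x y z => octonionForm C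
      (imagFunctor.map φ ((sectionsIso (n := n) (M := M)).hom.app A x))
      (imagFunctor.map φ ((sectionsIso (n := n) (M := M)).hom.app A y))
      (imagFunctor.map φ ((sectionsIso (n := n) (M := M)).hom.app A z))) ∧
      ((A.isLeft ∧ ∀ p : M, NonSplitAt C p) ∨ (A.isRight ∧ ∀ p : M, ¬ NonSplitAt C p)) := by
  rcases A with P | S
  · have hf : ∀ x y z, (cross C.norm_one).form (φ.imagEquiv (octImag P.isSmoothModel.isRegular x))
        (φ.imagEquiv (octImag P.isSmoothModel.isRegular y))
        (φ.imagEquiv (octImag P.isSmoothModel.isRegular z)) = P.cross.form x y z := fun x y z =>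
      (φ.cross_form (oct P.cross P.isSmoothModel.isRegular).norm_one C.norm_one _ _ _).trans
        (cross_form_octImag _ x y z)
    refine ⟨fun s p u hu => ?_, Or.inl ⟨rfl, fun p => ?_⟩⟩
    · rw [← P.form_eq hu]
      exact congrArg (fun g : SmoothRing n M => g p) ((octonionForm_eq _ _ _).trans (hf _ _ _))
    · obtain ⟨u, hu⟩ := P.exists_isFrame p
      exact nonSplitAt_of_isFrame (f := octImag P.isSmoothModel.isRegular ≪≫ₗ φ.imagEquiv)
        P.isSmoothModel.isRegular hf hu
  · have hf : ∀ x y z, (cross C.norm_one).form (φ.imagEquiv (octImag S.isSmoothModel.isRegular x))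
        (φ.imagEquiv (octImag S.isSmoothModel.isRegular y))
        (φ.imagEquiv (octImag S.isSmoothModel.isRegular z)) = S.cross.form x y z := fun x y z =>
      (φ.cross_form (oct S.cross S.isSmoothModel.isRegular).norm_one C.norm_one _ _ _).trans
        (cross_form_octImag _ x y z)
    refine ⟨fun s => ?_, Or.inr ⟨rfl, fun p => ?_⟩⟩
    · rw [← S.form_eq]
      exact (octonionForm_eq _ _ _).trans (hf _ _ _)
    · obtain ⟨u, hu⟩ := S.exists_isFrame p
      exact not_nonSplitAt_of_isFrame (f := octImag S.isSmoothModel.isRegular ≪≫ₗ φ.imagEquiv)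
        S.isSmoothModel.isRegular hf hu

end OctG2
end

theorem mainTheorem6 (n : ℕ) (M : Type u) [TopologicalSpace M]
    [ChartedSpace (EuclideanSpace ℝ (Fin n)) M] [IsManifold (𝓡 n) ∞ M]
    [T2Space M] [SecondCountableTopology M] [ConnectedSpace M] :
    ∃ (Φ : OctG2.OctonionAlgebra (OctG2.SmoothRing n M) ≌
        OctG2.FormalStructure n M)
      (θ : Φ.functor ⋙ OctG2.formalSections ≅ OctG2.OctonionAlgebra.imagFunctor),
      ∀ C : OctG2.OctonionAlgebra (OctG2.SmoothRing n M),
        OctG2.HasForm (Φ.functor.obj C)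
          (fun x y z => OctG2.octonionForm C (θ.hom.app C x) (θ.hom.app C y) (θ.hom.app C z)) ∧
        (((Φ.functor.obj C).isLeft ∧ ∀ p : M, OctG2.NonSplitAt C p) ∨
          ((Φ.functor.obj C).isRight ∧ ∀ p : M, ¬ OctG2.NonSplitAt C p)) := by
  let G := (OctG2.toOct (n := n) (M := M)).asEquivalence
  -- The functor of the theorem is the inverse of `toOct`. So θ identifies the sections with the
  -- imaginary part of the algebra rebuilt from C, and then restricts the counit to reach C itself.
  let θ : G.symm.functor ⋙ OctG2.formalSections ≅ OctG2.OctonionAlgebra.imagFunctor :=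
    Functor.isoWhiskerLeft G.inverse OctG2.sectionsIso ≪≫
      (Functor.associator G.inverse OctG2.toOct OctG2.OctonionAlgebra.imagFunctor).symm ≪≫
      Functor.isoWhiskerRight G.counitIso OctG2.OctonionAlgebra.imagFunctor ≪≫
      Functor.leftUnitor _
  exact ⟨G.symm, θ, fun C =>
    OctG2.hasForm_and_splitting (G.inverse.obj C) (G.counitIso.hom.app C)⟩
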